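/- Let $n\ge 0$. By a closed oriented $n$-manifold $(M,\omega_M)$ we mean a compact Hausdorff smooth $n$-manifold without boundary (possibly empty or disconnected) together with an orientation $\omega_M$, i.e. a locally constant choice of an orientation of each tangent space (for $n=0$: a sign at each point); $(M,-\omega_M)$ denotes the same manifold with the opposite orientation. If $(W,\omega_W)$ is a compact oriented smooth $(n+1)$-manifold with (possibly empty) boundary, then $\partial W$ carries the boundary orientation $\partial\omega_W$ (outward vector first). Closed oriented $n$-manifolds $(M,\omega_M)$ and $(N,\omega_N)$ are called cobordant, $M\sim N$, if there is a compact oriented smooth $(n+1)$-manifold $(W,\omega_W)$ with boundary such that, up to an orientation-preserving diffeomorphism, $$(\partial W,\partial\omega_W)=(M,-\omega_M)\amalg(N,\omega_N).$$ Then $\sim$ is an equivalence relation on closed oriented $n$-manifolds, and the set $\Omega^n$ of its equivalence classes is an abelian group with the addition given by disjoint union, $[M]+[N]=[M\amalg N]$ (in particular, this is well defined on classes). In this group, every boundary represents zero: if $(V,\omega_V)=(\partial W,\partial\omega_W)$ for some compact oriented smooth $(n+1)$-manifold $(W,\omega_W)$ with boundary, then $[V,\omega_V]=0$. The inverse of a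 class is given by reversing the orientation: $-[M,\omega_M]=[M,-\omega_M]$. -/

import Mathlib

open scoped Manifold ContDiff Topology

universe u

noncomputable section

namespace OrientedCobordism

/-- The linear map `L : V → W` is an isomorphism that carries the orientation `o` to `o'`. -/
def CarriesOrientation {m : ℕ} {V W : Type*} [AddCommGroup V] [Module ℝ V]
    [AddCommGroup W] [Module ℝ W] (L : V →ₗ[ℝ] W)
    (o : Orientation ℝ V (Fin m)) (o' : Orientation ℝ W (Fin m)) : Prop :=
  ∃ e : V ≃ₗ[ℝ] W, (e : V →ₗ[ℝ] W) = L ∧ Orientation.map (Fin m) e o = o'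

/-- The differential at `y` of the preferred chart at `x`, with values in the model vector space. -/
def chartDifferential {E H M : Type*} [NormedAddCommGroup E] [NormedSpace ℝ E]
    [TopologicalSpace H] (I : ModelWithCorners ℝ E H) [TopologicalSpace M] [ChartedSpace H M]
    (x y : M) : TangentSpace I y →L[ℝ] E :=
  mfderiv I 𝓘(ℝ, E) (extChartAt I x) y

/-- A choice of an orientation of every tangent space of `M` is locally constant if, around each
point `x`, the differentials of the chart at `x` carry the chosen orientations to one and the same
orientation of the model vector space. -/
def IsLocallyConstant {m : ℕ} {E H M : Type*} [NormedAddCommGroup E] [NormedSpace ℝ E]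
    [TopologicalSpace H] (I : ModelWithCorners ℝ E H) [TopologicalSpace M] [ChartedSpace H M]
    (o : ∀ x : M, Orientation ℝ (TangentSpace I x) (Fin m)) : Prop :=
  ∀ x : M, ∃ o₀ : Orientation ℝ E (Fin m), ∀ᶠ y in 𝓝 x,
    CarriesOrientation (chartDifferential I x y).toLinearMap (o y) o₀

/-- A compact oriented smooth `n`-manifold without boundary (Hausdorff; second countability follows
from compactness). It may be empty or disconnected. In dimension `0` an orientation
is a choice of a sign at every point. -/
structure ClosedOrientedManifold (n : ℕ) : Type (u + 1) where
  carrier : Type u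
  [topologicalSpace : TopologicalSpace carrier]
  [t2Space : T2Space carrier]
  [compactSpace : CompactSpace carrier]
  [chartedSpace : ChartedSpace (EuclideanSpace ℝ (Fin n)) carrier]
  [isManifold : IsManifold (𝓡 n) ∞ carrier]
  orientation : ∀ x : carrier, Orientation ℝ (TangentSpace (𝓡 n) x) (Fin n)
  isLocallyConstant : IsLocallyConstant (𝓡 n) orientation

attribute [instance] ClosedOrientedManifold.topologicalSpace ClosedOrientedManifold.t2Space
  ClosedOrientedManifold.compactSpace ClosedOrientedManifold.chartedSpace
  ClosedOrientedManifold.isManifold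

/-- A compact oriented smooth `(n + 1)`-manifold with (possibly empty) boundary. -/
structure CompactOrientedManifoldWithBoundary (n : ℕ) : Type (u + 1) where
  carrier : Type u
  [topologicalSpace : TopologicalSpace carrier]
  [t2Space : T2Space carrier]
  [compactSpace : CompactSpace carrier]
  [chartedSpace : ChartedSpace (EuclideanHalfSpace (n + 1)) carrier]
  [isManifold : IsManifold (𝓡∂ (n + 1)) ∞ carrier]
  orientation : ∀ x : carrier, Orientation ℝ (TangentSpace (𝓡∂ (n + 1)) x) (Fin (n + 1))
  isLocallyConstant : IsLocallyConstant (𝓡∂ (n + 1)) orientation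

attribute [instance] CompactOrientedManifoldWithBoundary.topologicalSpace
  CompactOrientedManifoldWithBoundary.t2Space
  CompactOrientedManifoldWithBoundary.compactSpace
  CompactOrientedManifoldWithBoundary.chartedSpace
  CompactOrientedManifoldWithBoundary.isManifold

section Operations

variable {E H M N : Type*} [NormedAddCommGroup E] [NormedSpace ℝ E] [TopologicalSpace H]
  {I : ModelWithCorners ℝ E H} [TopologicalSpace M] [ChartedSpace H M]
  [TopologicalSpace N] [ChartedSpace H N] {m : ℕ}

theorem IsLocallyConstant.neg {o : ∀ x : M, Orientation ℝ (TangentSpace I x) (Fin m)}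
    (h : IsLocallyConstant I o) : IsLocallyConstant I (fun x => -o x) := by
  intro x
  obtain ⟨o₀, h₀⟩ := h x
  refine ⟨-o₀, h₀.mono ?_⟩
  rintro y ⟨e, he, heo⟩
  exact ⟨e, he, (Orientation.map_neg e (o y)).trans (congrArg Neg.neg heo)⟩

/-- The orientation of `M ⊕ N` that restricts to the given ones. The preferred charts of `M ⊕ N`
are those of `M` and of `N`, so that the tangent spaces of `M ⊕ N` are definitionally
those of `M` and of `N` (the differentials of the two inclusions are identities). -/
def sumOrientation (o : ∀ x : M, Orientation ℝ (TangentSpace I x) (Fin m))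
    (o' : ∀ x : N, Orientation ℝ (TangentSpace I x) (Fin m)) :
    ∀ x : M ⊕ N, Orientation ℝ (TangentSpace I x) (Fin m)
  | .inl x => o x
  | .inr x => o' x

theorem chartDifferential_inl [IsManifold I 1 M] [IsManifold I 1 N] {x y : M}
    (hy : y ∈ (chartAt H x).source) :
    (chartDifferential I (Sum.inl x : M ⊕ N) (Sum.inl y) : E →L[ℝ] E) =
      chartDifferential I x y := by
  have hs : (Sum.inl y : M ⊕ N) ∈ (chartAt H (Sum.inl x : M ⊕ N)).source := by
    rw [ChartedSpace.sum_chartAt_inl]; simpa using hy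
  have h1 : HasMFDerivAt I 𝓘(ℝ, E) (extChartAt I (Sum.inl x : M ⊕ N)) (Sum.inl y) _ :=
    (mdifferentiableAt_extChartAt (I := I) hs).hasMFDerivAt
  have h2 := h1.comp (f := (Sum.inl : M → M ⊕ N)) y
    (hasMFDerivAt_inl (p := (Sum.inl y : M ⊕ N)))
  have h3 : (extChartAt I (Sum.inl x : M ⊕ N)) ∘ (Sum.inl : M → M ⊕ N) = extChartAt I x := by
    ext z; simp
  rw [h3] at h2
  exact h2.mfderiv.symm

theorem chartDifferential_inr [IsManifold I 1 M] [IsManifold I 1 N] {x y : N}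
    (hy : y ∈ (chartAt H x).source) :
    (chartDifferential I (Sum.inr x : M ⊕ N) (Sum.inr y) : E →L[ℝ] E) =
      chartDifferential I x y := by
  have hs : (Sum.inr y : M ⊕ N) ∈ (chartAt H (Sum.inr x : M ⊕ N)).source := by
    rw [ChartedSpace.sum_chartAt_inr]; simpa using hy
  have h1 : HasMFDerivAt I 𝓘(ℝ, E) (extChartAt I (Sum.inr x : M ⊕ N)) (Sum.inr y) _ :=
    (mdifferentiableAt_extChartAt (I := I) hs).hasMFDerivAt
  have h2 := h1.comp (f := (Sum.inr : N → M ⊕ N)) y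
    (hasMFDerivAt_inr (p := (Sum.inr y : M ⊕ N)))
  have h3 : (extChartAt I (Sum.inr x : M ⊕ N)) ∘ (Sum.inr : N → M ⊕ N) = extChartAt I x := by
    ext z; simp
  rw [h3] at h2
  exact h2.mfderiv.symm

theorem IsLocallyConstant.sum [IsManifold I 1 M] [IsManifold I 1 N]
    {o : ∀ x : M, Orientation ℝ (TangentSpace I x) (Fin m)}
    {o' : ∀ x : N, Orientation ℝ (TangentSpace I x) (Fin m)}
    (h : IsLocallyConstant I o) (h' : IsLocallyConstant I o') :
    IsLocallyConstant I (sumOrientation o o') := by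
  rintro (x | x)
  · obtain ⟨o₀, h₀⟩ := h x
    refine ⟨o₀, ?_⟩
    rw [← Topology.IsOpenEmbedding.inl.map_nhds_eq x, Filter.eventually_map]
    filter_upwards [h₀, (chartAt H x).open_source.mem_nhds (mem_chart_source H x)] with y hy hs
    obtain ⟨e, he, heo⟩ := hy
    refine ⟨e, he.trans ?_, heo⟩
    exact congrArg ContinuousLinearMap.toLinearMap (chartDifferential_inl (N := N) hs).symm
  · obtain ⟨o₀, h₀⟩ := h' x
    refine ⟨o₀, ?_⟩
    rw [← Topology.IsOpenEmbedding.inr.map_nhds_eq x, Filter.eventually_map]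
    filter_upwards [h₀, (chartAt H x).open_source.mem_nhds (mem_chart_source H x)] with y hy hs
    obtain ⟨e, he, heo⟩ := hy
    refine ⟨e, he.trans ?_, heo⟩
    exact congrArg ContinuousLinearMap.toLinearMap (chartDifferential_inr (M := M) hs).symm

end Operations

/-- The same manifold with the opposite orientation, `(M, -ω)`. -/
def ClosedOrientedManifold.neg {n : ℕ} (M : ClosedOrientedManifold.{u} n) :
    ClosedOrientedManifold.{u} n where
  carrier := M.carrier
  orientation := fun x => -M.orientation x
  isLocallyConstant := M.isLocallyConstant.neg

/-- The disjoint union of two closed oriented manifolds. -/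
def ClosedOrientedManifold.disjointUnion {n : ℕ} (M N : ClosedOrientedManifold.{u} n) :
    ClosedOrientedManifold.{u} n where
  carrier := M.carrier ⊕ N.carrier
  orientation := sumOrientation M.orientation N.orientation
  isLocallyConstant := M.isLocallyConstant.sum N.isLocallyConstant

/-- A tangent vector at a boundary point `p` of `W` points outward if its first coordinate
in the chart at `p` (with values in the half-space `{x | 0 ≤ x 0}`) is negative. -/
def IsOutward {n : ℕ} (W : CompactOrientedManifoldWithBoundary.{u} n) (p : W.carrier)
    (v : TangentSpace (𝓡∂ (n + 1)) p) : Prop :=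
  chartDifferential (𝓡∂ (n + 1)) p p v 0 < 0

/-- `ι : M → W` identifies the oriented manifold `M` with the boundary of `W`, equipped with the
boundary orientation: `ι` is a smooth embedding (a topological embedding that is a smooth map with
injective differentials) with image `∂W`, and a basis `b` of `T_x M` is positive if and only if the
basis of `T_{ι x} W` formed by an outward vector followed by `dι b` is positive. -/
structure IsOrientedBoundaryMap {n : ℕ} (W : CompactOrientedManifoldWithBoundary.{u} n)
    (M : ClosedOrientedManifold.{u} n) (ι : M.carrier → W.carrier) : Prop where
  contMDiff : ContMDiff (𝓡 n) (𝓡∂ (n + 1)) ∞ ι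
  isEmbedding : Topology.IsEmbedding ι
  injective_mfderiv : ∀ x, Function.Injective (mfderiv (𝓡 n) (𝓡∂ (n + 1)) ι x)
  range_eq : Set.range ι = (𝓡∂ (n + 1)).boundary W.carrier
  orientation_iff : ∀ (x : M.carrier) (v : TangentSpace (𝓡∂ (n + 1)) (ι x)), IsOutward W (ι x) v →
    ∀ (b : Module.Basis (Fin n) ℝ (TangentSpace (𝓡 n) x))
      (b' : Module.Basis (Fin (n + 1)) ℝ (TangentSpace (𝓡∂ (n + 1)) (ι x))),
      b' 0 = v → (∀ i : Fin n, b' i.succ = mfderiv (𝓡 n) (𝓡∂ (n + 1)) ι x (b i)) →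
      (b.orientation = M.orientation x ↔ b'.orientation = W.orientation (ι x))

/-- `(∂W, ∂ω_W) = (M, ω_M)`, up to an orientation-preserving diffeomorphism. -/
def IsOrientedBoundary {n : ℕ} (W : CompactOrientedManifoldWithBoundary.{u} n)
    (M : ClosedOrientedManifold.{u} n) : Prop :=
  ∃ ι : M.carrier → W.carrier, IsOrientedBoundaryMap W M ι

/-- `M` and `N` are cobordant: `(∂W, ∂ω_W) = (M, -ω_M) ⨿ (N, ω_N)` for some `W`. -/
def Cobordant {n : ℕ} (M N : ClosedOrientedManifold.{u} n) : Prop :=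
  ∃ W : CompactOrientedManifoldWithBoundary.{u} n, IsOrientedBoundary W (M.neg.disjointUnion N)

/-- The set `Ω^n` of oriented cobordism classes of closed oriented `n`-manifolds. -/
def CobordismClasses (n : ℕ) : Type (u + 1) :=
  Quot (Cobordant : ClosedOrientedManifold.{u} n → ClosedOrientedManifold.{u} n → Prop)

/-- The cobordism class of `M`. -/
def cobordismClass {n : ℕ} (M : ClosedOrientedManifold.{u} n) : CobordismClasses.{u} n :=
  Quot.mk _ M

end OrientedCobordism

end

/-! Reflexivity comes from the cylinder M × [0, 1], symmetry from reversing the orientation of a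
cobordism, and compatibility with sums from disjoint unions of cobordisms. The same cylinder, read
as a null-cobordism of -M ⨿ M, provides inverses. The one hard point is transitivity. If ∂W = -L ⨿ M
and ∂W' = -M ⨿ N, then ∂(W ⨿ W') is, after rearrangement, (-L ⨿ N) ⨿ (-M ⨿ M), so it suffices to
cancel -M ⨿ M from a boundary (`IsOrientedBoundary.cancel`).

The summand -M ⨿ M carries an orientation reversing involution τ without fixed points, the swap.
Gluing along τ is done without pasting half-spaces: the boundary part in question is deleted, and in
an open collar (x, t) is identified with (τ x, δ - t) for 0 < t < δ. Only interior points are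
identified, so this is an involution of an open subset of W, and the quotient is locally a copy of W
whose transition maps are locally the identity or the involution (`PartialInvolution.transition`).
Smooth structure and orientation therefore descend; the involution preserves orientation because τ
and t ↦ δ - t both reverse it. Hausdorffness follows from the closedness of the graph, compactness
from a closed set that meets all orbits.

The collar (`IsBoundaryEmbedding.exists_isCollar`) is the inverse of a map (r, f). Here r is a
retraction onto the boundary, smooth near it and patched from local retractions by bump functions,
and f is a sum of first chart coordinates weighted by bump functions. Along the boundary (r, f) has
bijective differential; it is injective nearby by compactness and onto V × [0, ε) by an open-closed
argument. Since the collar parameter points inward while the convention is outward first, (r, f)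
carries the orientation of W to the opposite of the product orientation
(`IsCollar.carriesOrientation`). -/

noncomputable section

namespace OrientedCobordism

open Filter

/-! ### Linear algebra of orientations: transport, stabilization by a line, boundary convention. -/

section LinearOrientation

variable {m n : ℕ} {V W U : Type*} [AddCommGroup V] [Module ℝ V] [AddCommGroup W] [Module ℝ W]
  [AddCommGroup U] [Module ℝ U]

theorem CarriesOrientation.id (o : Orientation ℝ V (Fin m)) :
    CarriesOrientation LinearMap.id o o :=
  ⟨LinearEquiv.refl ℝ V, rfl, by rw [Orientation.map_refl]; rfl⟩

theorem CarriesOrientation.bijective {L : V →ₗ[ℝ] W} {o : Orientation ℝ V (Fin m)}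
    {o' : Orientation ℝ W (Fin m)} (h : CarriesOrientation L o o') : Function.Bijective L := by
  obtain ⟨e, rfl, -⟩ := h
  exact e.bijective

theorem orientation_map_trans (e : V ≃ₗ[ℝ] W) (e' : W ≃ₗ[ℝ] U) (o : Orientation ℝ V (Fin m)) :
    Orientation.map (Fin m) (e.trans e') o =
      Orientation.map (Fin m) e' (Orientation.map (Fin m) e o) := by
  induction o using Module.Ray.ind with | h x hx => rfl

theorem CarriesOrientation.comp {L : V →ₗ[ℝ] W} {L' : W →ₗ[ℝ] U} {o : Orientation ℝ V (Fin m)}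
    {o' : Orientation ℝ W (Fin m)} {o'' : Orientation ℝ U (Fin m)}
    (h' : CarriesOrientation L' o' o'') (h : CarriesOrientation L o o') :
    CarriesOrientation (L' ∘ₗ L) o o'' := by
  obtain ⟨e, rfl, rfl⟩ := h
  obtain ⟨e', rfl, rfl⟩ := h'
  exact ⟨e.trans e', rfl, orientation_map_trans e e' o⟩

theorem CarriesOrientation.unique {L : V →ₗ[ℝ] W} {o : Orientation ℝ V (Fin m)}
    {o₁ o₂ : Orientation ℝ W (Fin m)} (h₁ : CarriesOrientation L o o₁)
    (h₂ : CarriesOrientation L o o₂) : o₁ = o₂ := by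
  obtain ⟨e, rfl, rfl⟩ := h₁
  obtain ⟨e', he, rfl⟩ := h₂
  rw [LinearEquiv.toLinearMap_injective he]

theorem CarriesOrientation.unique_left {L : V →ₗ[ℝ] W} {o₁ o₂ : Orientation ℝ V (Fin m)}
    {o : Orientation ℝ W (Fin m)} (h₁ : CarriesOrientation L o₁ o)
    (h₂ : CarriesOrientation L o₂ o) : o₁ = o₂ := by
  obtain ⟨e, rfl, rfl⟩ := h₁
  obtain ⟨e', he, h⟩ := h₂
  rw [LinearEquiv.toLinearMap_injective he] at h
  exact ((Orientation.map (Fin m) e).injective h).symm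

theorem exists_carriesOrientation {L : V →ₗ[ℝ] W} (h : Function.Bijective L)
    (o : Orientation ℝ V (Fin m)) : ∃ o', CarriesOrientation L o o' :=
  ⟨_, LinearEquiv.ofBijective L h, rfl, rfl⟩

theorem exists_carriesOrientation_left {L : V →ₗ[ℝ] W} (h : Function.Bijective L)
    (o' : Orientation ℝ W (Fin m)) : ∃ o, CarriesOrientation L o o' :=
  ⟨(Orientation.map (Fin m) (LinearEquiv.ofBijective L h)).symm o',
    LinearEquiv.ofBijective L h, rfl, Equiv.apply_symm_apply _ _⟩

/-- Two-out-of-three: bijectivity of the remaining factor is automatic, and a bijection determines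
the image of an orientation uniquely. -/
theorem CarriesOrientation.of_comp_left {L : V →ₗ[ℝ] W} {L' : W →ₗ[ℝ] U}
    {o : Orientation ℝ V (Fin m)} {o' : Orientation ℝ W (Fin m)} {o'' : Orientation ℝ U (Fin m)}
    (h : CarriesOrientation (L' ∘ₗ L) o o'') (h' : CarriesOrientation L o o') :
    CarriesOrientation L' o' o'' := by
  have hb : Function.Bijective L' := by
    have := h.bijective
    rw [LinearMap.coe_comp] at this
    exact (Function.Bijective.of_comp_iff _ h'.bijective).1 this
  obtain ⟨o₁, h₁⟩ := exists_carriesOrientation hb o'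
  rwa [h.unique (h₁.comp h')]

theorem CarriesOrientation.of_comp_right {L : V →ₗ[ℝ] W} {L' : W →ₗ[ℝ] U}
    {o : Orientation ℝ V (Fin m)} {o' : Orientation ℝ W (Fin m)} {o'' : Orientation ℝ U (Fin m)}
    (h : CarriesOrientation (L' ∘ₗ L) o o'') (h' : CarriesOrientation L' o' o'') :
    CarriesOrientation L o o' := by
  have hb : Function.Bijective L := by
    have := h.bijective
    rw [LinearMap.coe_comp] at this
    exact (Function.Bijective.of_comp_iff' h'.bijective _).1 this
  obtain ⟨o₁, h₁⟩ := exists_carriesOrientation_left hb o'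
  rwa [h.unique_left (h'.comp h₁)]

theorem orientation_neg_neg (o : Orientation ℝ V (Fin m)) : - -o = o := neg_neg o

theorem CarriesOrientation.neg {L : V →ₗ[ℝ] W} {o : Orientation ℝ V (Fin m)}
    {o' : Orientation ℝ W (Fin m)} (h : CarriesOrientation L o o') :
    CarriesOrientation L (-o) (-o') := by
  obtain ⟨e, rfl, rfl⟩ := h
  exact ⟨e, rfl, Orientation.map_neg e o⟩

theorem CarriesOrientation.basis_iff {L : V →ₗ[ℝ] W} {o : Orientation ℝ V (Fin m)}
    {o' : Orientation ℝ W (Fin m)} (h : CarriesOrientation L o o')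
    (b : Module.Basis (Fin m) ℝ V) (b' : Module.Basis (Fin m) ℝ W) (hb : ∀ i, b' i = L (b i)) :
    b.orientation = o ↔ b'.orientation = o' := by
  obtain ⟨e, rfl, rfl⟩ := h
  have : b' = b.map e := Module.Basis.eq_of_apply_eq fun i => by simpa using hb i
  rw [this, Module.Basis.orientation_map]
  exact (Orientation.map (Fin m) e).injective.eq_iff.symm

/-- The basis of `V × ℝ` formed by the unit vector of `ℝ` followed by a basis of `V`. -/
def consBasis (b : Module.Basis (Fin n) ℝ V) : Module.Basis (Fin (n + 1)) ℝ (V × ℝ) :=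
  (b.prod (Module.Basis.singleton PUnit.{1} ℝ)).reindex
    ((finSuccEquiv n).trans (Equiv.optionEquivSumPUnit.{0} _)).symm

@[simp]
theorem consBasis_zero (b : Module.Basis (Fin n) ℝ V) : consBasis b 0 = (0, 1) := by
  simp [consBasis]

@[simp]
theorem consBasis_succ (b : Module.Basis (Fin n) ℝ V) (i : Fin n) :
    consBasis b i.succ = (b i, 0) := by
  simp [consBasis]

theorem consBasis_repr_zero (b : Module.Basis (Fin n) ℝ V) (v : V × ℝ) :
    (consBasis b).repr v 0 = v.2 := by
  simp only [consBasis, Module.Basis.repr_reindex_apply]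
  simp

theorem consBasis_det (b b' : Module.Basis (Fin n) ℝ V) :
    (consBasis b).det (consBasis b') = b.det b' := by
  rw [Module.Basis.det_apply, Module.Basis.det_apply]
  -- Once the index 0 is split off, the transition matrix is block diagonal with a block 1.
  have : (consBasis b).toMatrix (consBasis b') =
      (Matrix.fromBlocks (b.toMatrix b') 0 0 (1 : Matrix PUnit.{1} PUnit.{1} ℝ)).submatrix
        ((finSuccEquiv n).trans (Equiv.optionEquivSumPUnit.{0} _))
        ((finSuccEquiv n).trans (Equiv.optionEquivSumPUnit.{0} _)) := by
    ext i j
    refine Fin.cases ?_ (fun i => ?_) i <;> refine Fin.cases ?_ (fun j => ?_) j <;>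
      simp only [Module.Basis.toMatrix_apply, consBasis_zero, consBasis_succ] <;>
      simp only [consBasis, Module.Basis.repr_reindex_apply] <;> simp [Module.Basis.toMatrix_apply]
  rw [this, Matrix.det_submatrix_equiv_self, Matrix.det_fromBlocks_zero₂₁]
  simp

theorem consBasis_orientation_iff (b b' : Module.Basis (Fin n) ℝ V) :
    (consBasis b).orientation = (consBasis b').orientation ↔ b.orientation = b'.orientation := by
  rw [Module.Basis.orientation_eq_iff_det_pos, Module.Basis.orientation_eq_iff_det_pos,
    consBasis_det]

/-- The orientation of `V × ℝ` for which the unit vector of `ℝ` followed by a positive basis of `V`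
is positive. -/
def stabilize (h : Module.finrank ℝ V = n) [FiniteDimensional ℝ V]
    (o : Orientation ℝ V (Fin n)) : Orientation ℝ (V × ℝ) (Fin (n + 1)) :=
  open Classical in
  if (Module.finBasisOfFinrankEq ℝ V h).orientation = o then
    (consBasis (Module.finBasisOfFinrankEq ℝ V h)).orientation
  else -(consBasis (Module.finBasisOfFinrankEq ℝ V h)).orientation

/-- Replacing the single vector `b i` gives a family whose determinant with respect to `b` is the
`i`-th coordinate of the new vector. -/
theorem orientation_eq_of_coord_pos {ι : Type*} [Fintype ι] [DecidableEq ι]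
    (b b' : Module.Basis ι ℝ V) (i : ι)
    (hi : ∀ j, j ≠ i → b' j = b j) (hpos : 0 < b.repr (b' i) i) :
    b.orientation = b'.orientation := by
  rw [Module.Basis.orientation_eq_iff_det_pos]
  have h1 : (b' : ι → V) = Function.update b i (b' i) := by
    ext j
    by_cases h : j = i
    · subst h; simp
    · simp [h, hi j h]
  have h2 := Module.Basis.det_smul_mk_coord_eq_det_update b b.linearIndependent b.span_eq.ge i
  have h3 := congrArg (fun f => f (b' i)) h2
  simp only [Module.Basis.det_self, one_smul, MultilinearMap.toLinearMap_apply] at h3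
  have h4 : (Module.Basis.mk b.linearIndependent b.span_eq.ge) = b :=
    Module.Basis.eq_of_apply_eq fun j => by simp
  rw [h4] at h3
  rw [h1]
  have h5 : b.det (Function.update b i (b' i)) = b.repr (b' i) i := by
    simpa using h3.symm
  rwa [h5]

variable [FiniteDimensional ℝ V]

/-- Makes `stabilize` independent of the arbitrary basis in its definition: there are only two
orientations, and `consBasis` separates them. -/
theorem stabilize_basis (h : Module.finrank ℝ V = n) (b : Module.Basis (Fin n) ℝ V) :
    stabilize h b.orientation = (consBasis b).orientation := by
  unfold stabilize
  split_ifs with hb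
  · rwa [consBasis_orientation_iff]
  · rw [← consBasis_orientation_iff] at hb
    rcases (consBasis (Module.finBasisOfFinrankEq ℝ V h)).orientation_eq_or_eq_neg
      (consBasis b).orientation with h' | h'
    · exact absurd h'.symm hb
    · exact h'.symm

/-- Needed as a separate case because in dimension 0 the negative orientation is not the orientation
of any basis. -/
theorem stabilize_neg_basis (h : Module.finrank ℝ V = n) (b : Module.Basis (Fin n) ℝ V) :
    stabilize h (-b.orientation) = -(consBasis b).orientation := by
  unfold stabilize
  split_ifs with hb
  · rcases b.orientation_eq_or_eq_neg (Module.finBasisOfFinrankEq ℝ V h).orientation with h' | h'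
    · rw [h'] at hb
      exact absurd hb (Module.Ray.ne_neg_self _)
    · rcases (consBasis b).orientation_eq_or_eq_neg
        (consBasis (Module.finBasisOfFinrankEq ℝ V h)).orientation with h'' | h''
      · rw [consBasis_orientation_iff] at h''
        rw [h''] at hb
        exact absurd hb (Module.Ray.ne_neg_self _)
      · exact h''
  · rcases b.orientation_eq_or_eq_neg (Module.finBasisOfFinrankEq ℝ V h).orientation with h' | h'
    · rw [← consBasis_orientation_iff] at h'
      rw [h']
    · exact absurd h' hb

theorem stabilize_neg (h : Module.finrank ℝ V = n) (o : Orientation ℝ V (Fin n)) :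
    stabilize h (-o) = -stabilize h o := by
  have b := Module.finBasisOfFinrankEq ℝ V h
  rcases b.orientation_eq_or_eq_neg o with rfl | rfl
  · rw [stabilize_basis, stabilize_neg_basis]
  · rw [orientation_neg_neg, stabilize_basis, stabilize_neg_basis, orientation_neg_neg]

theorem consBasis_orientation_eq_iff (h : Module.finrank ℝ V = n) (b : Module.Basis (Fin n) ℝ V)
    (o : Orientation ℝ V (Fin n)) :
    (consBasis b).orientation = stabilize h o ↔ b.orientation = o := by
  rcases b.orientation_eq_or_eq_neg o with rfl | rfl
  · simp [stabilize_basis]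
  · rw [stabilize_neg_basis]
    exact iff_of_false (Module.Ray.ne_neg_self _) (Module.Ray.ne_neg_self _)

/-- A basis of `V × ℝ` obtained from a basis of `V` by adding in front a vector
with positive last component. -/
theorem orientation_eq_stabilize_iff (h : Module.finrank ℝ V = n) (o : Orientation ℝ V (Fin n))
    (b : Module.Basis (Fin n) ℝ V) (b' : Module.Basis (Fin (n + 1)) ℝ (V × ℝ))
    (h0 : 0 < (b' 0).2) (hs : ∀ i : Fin n, b' i.succ = (b i, 0)) :
    b'.orientation = stabilize h o ↔ b.orientation = o := by
  rw [← consBasis_orientation_eq_iff h,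
    orientation_eq_of_coord_pos (consBasis b) b' 0 ?_ (by rwa [consBasis_repr_zero])]
  intro j hj
  obtain ⟨i, rfl⟩ := Fin.exists_succ_eq.2 hj
  rw [hs, consBasis_succ]

theorem orientation_eq_neg_stabilize_iff (h : Module.finrank ℝ V = n)
    (o : Orientation ℝ V (Fin n))
    (b : Module.Basis (Fin n) ℝ V) (b' : Module.Basis (Fin (n + 1)) ℝ (V × ℝ))
    (h0 : (b' 0).2 < 0) (hs : ∀ i : Fin n, b' i.succ = (b i, 0)) :
    b'.orientation = -stabilize h o ↔ b.orientation = o := by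
  -- Changing the sign of the front vector reverses the orientation and leads back to the positive
  -- case.
  have key := orientation_eq_stabilize_iff h o b (b'.unitsSMul (Function.update 1 0 (-1)))
    (by simpa [Module.Basis.unitsSMul_apply] using h0)
    (fun i => by simp [Module.Basis.unitsSMul_apply, hs])
  rw [← key, Module.Basis.orientation_neg_single]
  constructor
  · intro h
    rw [h, orientation_neg_neg]
  · intro h
    rw [← h, orientation_neg_neg]

theorem CarriesOrientation.stabilize [FiniteDimensional ℝ W]
    (hV : Module.finrank ℝ V = n) (hW : Module.finrank ℝ W = n)
    {A : V →ₗ[ℝ] W} {o : Orientation ℝ V (Fin n)} {o' : Orientation ℝ W (Fin n)}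
    (h : CarriesOrientation A o o') :
    CarriesOrientation (A.prodMap LinearMap.id) (stabilize hV o) (stabilize hW o') := by
  obtain ⟨e, rfl, rfl⟩ := h
  refine ⟨e.prodCongr (LinearEquiv.refl ℝ ℝ), rfl, ?_⟩
  have b := Module.finBasisOfFinrankEq ℝ V hV
  have key : Orientation.map (Fin (n + 1)) (e.prodCongr (LinearEquiv.refl ℝ ℝ))
      (consBasis b).orientation = (consBasis (b.map e)).orientation := by
    rw [← Module.Basis.orientation_map]
    congr 1
  rcases b.orientation_eq_or_eq_neg o with rfl | rfl
  · rw [stabilize_basis, key, ← Module.Basis.orientation_map, stabilize_basis]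
  · rw [stabilize_neg_basis, Orientation.map_neg, key, Orientation.map_neg,
      ← Module.Basis.orientation_map, stabilize_neg_basis]

/-- Two reversals cancel: `A` reverses on `V`, and the reflection reverses on the line. This is the
linear model of the gluing involution of a collar. -/
theorem CarriesOrientation.stabilize_neg [FiniteDimensional ℝ W] (hV : Module.finrank ℝ V = n)
    (hW : Module.finrank ℝ W = n)
    {A : V →ₗ[ℝ] W} {o : Orientation ℝ V (Fin n)} {o' : Orientation ℝ W (Fin n)}
    (h : CarriesOrientation A o (-o')) :
    CarriesOrientation (A.prodMap (-LinearMap.id)) (OrientedCobordism.stabilize hV o)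
      (OrientedCobordism.stabilize hW o') := by
  have h1 : CarriesOrientation (LinearMap.id.prodMap (-LinearMap.id) : W × ℝ →ₗ[ℝ] W × ℝ)
      (OrientedCobordism.stabilize hW o') (-OrientedCobordism.stabilize hW o') := by
    refine ⟨(LinearEquiv.refl ℝ W).prodCongr (LinearEquiv.neg ℝ), rfl, ?_⟩
    have b := Module.finBasisOfFinrankEq ℝ W hW
    have key : Orientation.map (Fin (n + 1))
        ((LinearEquiv.refl ℝ W).prodCongr (LinearEquiv.neg ℝ))
        (consBasis b).orientation = -(consBasis b).orientation := by
      rw [← Module.Basis.orientation_map, ← Module.Basis.orientation_neg_single _ 0]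
      congr 1
      refine Module.Basis.eq_of_apply_eq fun i => ?_
      refine Fin.cases ?_ (fun i => ?_) i <;> simp [Module.Basis.unitsSMul_apply]
    rcases b.orientation_eq_or_eq_neg o' with rfl | rfl
    · rw [stabilize_basis, key]
    · rw [stabilize_neg_basis, Orientation.map_neg, key]
  have h2 := h1.neg.comp (by simpa [OrientedCobordism.stabilize_neg] using h.stabilize hV hW)
  rw [orientation_neg_neg] at h2
  convert h2 using 1
  ext <;> simp

/-- Boundary orientations and stabilizations: if `Φ` maps the hyperplane `j V` to `V × 0`
and the vector `v` to a vector with negative last component, then the orientation `o'` with the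
convention `v` first induces `o` if and only if it corresponds to the opposite of the stabilization
of `o`. -/
theorem CarriesOrientation.boundary_iff (h : Module.finrank ℝ V = n) {Φ : W →ₗ[ℝ] V × ℝ}
    {j : V →ₗ[ℝ] W} (hj : ∀ u, Φ (j u) = (u, 0)) {o : Orientation ℝ V (Fin n)}
    {o' : Orientation ℝ W (Fin (n + 1))}
    (hΦ : CarriesOrientation Φ o' (-OrientedCobordism.stabilize h o))
    (b : Module.Basis (Fin n) ℝ V) (b' : Module.Basis (Fin (n + 1)) ℝ W)
    (h0 : (Φ (b' 0)).2 < 0) (hs : ∀ i : Fin n, b' i.succ = j (b i)) :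
    b.orientation = o ↔ b'.orientation = o' := by
  rw [hΦ.basis_iff b' (b'.map (LinearEquiv.ofBijective Φ hΦ.bijective)) (fun i => by simp),
    orientation_eq_neg_stabilize_iff h o b _ (by simpa using h0) (fun i => by simp [hs, hj])]

theorem CarriesOrientation.boundary_iff' (h : Module.finrank ℝ V = n) {Φ : W →ₗ[ℝ] V × ℝ}
    {j : V →ₗ[ℝ] W} (hj : ∀ u, Φ (j u) = (u, 0)) {o : Orientation ℝ V (Fin n)}
    {o' : Orientation ℝ W (Fin (n + 1))}
    (hΦ : CarriesOrientation Φ o' (OrientedCobordism.stabilize h o))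
    (b : Module.Basis (Fin n) ℝ V) (b' : Module.Basis (Fin (n + 1)) ℝ W)
    (h0 : 0 < (Φ (b' 0)).2) (hs : ∀ i : Fin n, b' i.succ = j (b i)) :
    b.orientation = o ↔ b'.orientation = o' := by
  rw [hΦ.basis_iff b' (b'.map (LinearEquiv.ofBijective Φ hΦ.bijective)) (fun i => by simp),
    orientation_eq_stabilize_iff h o b _ (by simpa using h0) (fun i => by simp [hs, hj])]

/-- Converse of `CarriesOrientation.boundary_iff`. Of the two orientations of `W` only one satisfies
the boundary convention, and a single adapted basis decides which. -/
theorem carriesOrientation_of_boundary_iff (h : Module.finrank ℝ V = n) {Φ : W →ₗ[ℝ] V × ℝ}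
    (hb : Function.Bijective Φ) {j : V →ₗ[ℝ] W} (hj : ∀ u, Φ (j u) = (u, 0))
    {o : Orientation ℝ V (Fin n)} {o' : Orientation ℝ W (Fin (n + 1))}
    (H : ∀ (b : Module.Basis (Fin n) ℝ V) (b' : Module.Basis (Fin (n + 1)) ℝ W),
      (Φ (b' 0)).2 < 0 → (∀ i : Fin n, b' i.succ = j (b i)) →
      (b.orientation = o ↔ b'.orientation = o')) :
    CarriesOrientation Φ o' (-OrientedCobordism.stabilize h o) := by
  obtain ⟨o₁, h₁⟩ := exists_carriesOrientation_left hb (-OrientedCobordism.stabilize h o)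
  have b := Module.finBasisOfFinrankEq ℝ V h
  -- The adapted basis: the preimage under `Φ` of the outward vector (0, -1) followed by `b`.
  set b' : Module.Basis (Fin (n + 1)) ℝ W :=
    ((consBasis b).unitsSMul (Function.update 1 0 (-1))).map (LinearEquiv.ofBijective Φ hb).symm
    with hb'
  have e0 : Φ (b' 0) = (0, -1) := by
    rw [hb', Module.Basis.map_apply]
    have := (LinearEquiv.ofBijective Φ hb).apply_symm_apply
      ((consBasis b).unitsSMul (Function.update 1 0 (-1)) 0)
    rw [LinearEquiv.ofBijective_apply] at this
    rw [this]
    simp [Module.Basis.unitsSMul_apply]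
  have es : ∀ i : Fin n, b' i.succ = j (b i) := by
    intro i
    apply hb.injective
    rw [hj, hb', Module.Basis.map_apply]
    have := (LinearEquiv.ofBijective Φ hb).apply_symm_apply
      ((consBasis b).unitsSMul (Function.update 1 0 (-1)) i.succ)
    rw [LinearEquiv.ofBijective_apply] at this
    rw [this]
    simp [Module.Basis.unitsSMul_apply]
  have k1 := H b b' (by rw [e0]; norm_num) es
  have k2 := h₁.boundary_iff h hj b b' (by rw [e0]; norm_num) es
  have : o₁ = o' := by
    have k3 := k2.symm.trans k1
    rcases b'.orientation_eq_or_eq_neg o₁ with r | r <;>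
      rcases b'.orientation_eq_or_eq_neg o' with r' | r'
    · rw [r, r']
    · exact absurd (k3.1 r.symm) (by rw [r']; exact Module.Ray.ne_neg_self _)
    · exact absurd (k3.2 r'.symm) (by rw [r]; exact Module.Ray.ne_neg_self _)
    · rw [r, r']
  rwa [← this]

end LinearOrientation

/-! ### Openness of the orientation condition on linear maps. -/

section OrientationContinuity

variable {m : ℕ} {E E' : Type*} [NormedAddCommGroup E] [NormedSpace ℝ E] [FiniteDimensional ℝ E]
  [NormedAddCommGroup E'] [NormedSpace ℝ E']

/-- Write A = A₀ ∘ (A₀⁻¹ A). The determinant of A₀⁻¹ A is continuous in A and equals 1 at A₀, hence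
is positive nearby, so this factor preserves every orientation. The neighborhood is thus the same
for all `o` and `o'`. -/
theorem eventually_carriesOrientation_iff (hE : Module.finrank ℝ E = m) {A₀ : E →L[ℝ] E'}
    (hA₀ : Function.Bijective A₀) :
    ∀ᶠ A in 𝓝 A₀, ∀ (o : Orientation ℝ E (Fin m)) (o' : Orientation ℝ E' (Fin m)),
      CarriesOrientation A.toLinearMap o o' ↔ CarriesOrientation A₀.toLinearMap o o' := by
  set e : E ≃L[ℝ] E' := (LinearEquiv.ofBijective A₀.toLinearMap hA₀).toContinuousLinearEquiv
    with he
  have heA : ∀ x, e x = A₀ x := fun x => rfl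
  have hc : Continuous fun A : E →L[ℝ] E' => ((e.symm : E' →L[ℝ] E) ∘L A).det :=
    ContinuousLinearMap.continuous_det.comp (by fun_prop)
  have h1 : ((e.symm : E' →L[ℝ] E) ∘L A₀) = ContinuousLinearMap.id ℝ E := by
    ext x
    simp [← heA]
  have hpos : ∀ᶠ A in 𝓝 A₀, 0 < ((e.symm : E' →L[ℝ] E) ∘L A).det := by
    have : (0 : ℝ) < ((e.symm : E' →L[ℝ] E) ∘L A₀).det := by
      have h2 : (ContinuousLinearMap.id ℝ E).det = 1 := LinearMap.det_id
      rw [h1, h2]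
      exact one_pos
    exact hc.continuousAt.eventually (lt_mem_nhds this)
  filter_upwards [hpos] with A hA
  have key : ∀ (o : Orientation ℝ E (Fin m)) (o' : Orientation ℝ E' (Fin m)),
      CarriesOrientation A₀.toLinearMap o o' → CarriesOrientation A.toLinearMap o o' := by
    intro o o' h
    set B : E →ₗ[ℝ] E := ((e.symm : E' →L[ℝ] E) ∘L A).toLinearMap with hB
    have hdet : 0 < LinearMap.det B := hA
    set b : E ≃ₗ[ℝ] E := LinearMap.equivOfDetNeZero B hdet.ne' with hb
    have hbB : (b : E →ₗ[ℝ] E) = B := by ext; rfl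
    have hcar : CarriesOrientation B o o := by
      refine ⟨b, hbB, ?_⟩
      rw [Orientation.map_eq_iff_det_pos _ _ (by simp [hE]), hbB]
      exact hdet
    have hcomp : A.toLinearMap = A₀.toLinearMap ∘ₗ B := by
      ext x
      change A x = A₀ (e.symm (A x))
      rw [← heA, e.apply_symm_apply]
    rw [hcomp]
    exact h.comp hcar
  refine fun o o' => ⟨fun h => ?_, key o o'⟩
  obtain ⟨o₁, h₁⟩ := exists_carriesOrientation (L := A₀.toLinearMap) hA₀ o
  rwa [h.unique (key _ _ h₁)]

theorem eventually_bijective {A₀ : E →L[ℝ] E'} (hA₀ : Function.Bijective A₀) :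
    ∀ᶠ A : E →L[ℝ] E' in 𝓝 A₀, Function.Bijective A := by
  have h := (LinearEquiv.ofBijective A₀.toLinearMap hA₀).toContinuousLinearEquiv.nhds
  have h0 : (LinearEquiv.ofBijective A₀.toLinearMap hA₀).toContinuousLinearEquiv =
      (A₀ : E →L[ℝ] E') := by ext; rfl
  rw [h0] at h
  filter_upwards [h] with A hA
  obtain ⟨e, rfl⟩ := hA
  exact e.bijective

end OrientationContinuity

/-! ### Differentials read in charts and local constancy of orientation behavior. -/

section Calculus

variable {m : ℕ} {E H M : Type*} [NormedAddCommGroup E] [NormedSpace ℝ E]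
  [TopologicalSpace H] {I : ModelWithCorners ℝ E H} [TopologicalSpace M] [ChartedSpace H M]
  {E' H' M' : Type*} [NormedAddCommGroup E'] [NormedSpace ℝ E']
  [TopologicalSpace H'] {I' : ModelWithCorners ℝ E' H'} [TopologicalSpace M']
  [ChartedSpace H' M']

/-- The derivative is taken within `Set.range I`, so that boundary points of `M` are covered as
well. -/
theorem continuousAt_fderivWithin_chart {g : M → M'} {a : M} (hg : ContMDiffAt I I' 1 g a) :
    ContinuousAt (fun x => fderivWithin ℝ (extChartAt I' (g a) ∘ g ∘ (extChartAt I a).symm)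
      (Set.range I) (extChartAt I a x)) a := by
  have h1 := ((contMDiffAt_iff.1 hg).2.fderivWithin_right (m := 0) I.uniqueDiffOn (by simp)
    (by simp [extChartAt])).continuousWithinAt
  have h2 : Tendsto (extChartAt I a) (𝓝 a) (𝓝[Set.range I] (extChartAt I a a)) :=
    tendsto_nhdsWithin_iff.2 ⟨continuousAt_extChartAt a,
      Eventually.of_forall fun y => by simp [extChartAt]⟩
  exact h1.tendsto.comp h2

theorem eventually_mem_chart_source (x : M) : ∀ᶠ y in 𝓝 x, y ∈ (chartAt H x).source :=
  (chartAt H x).open_source.mem_nhds (mem_chart_source H x)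

variable [IsManifold I 1 M] [IsManifold I' 1 M']

theorem chartDifferential_bijective {x y : M} (hy : y ∈ (chartAt H x).source) :
    Function.Bijective (chartDifferential I x y) :=
  (isInvertible_mfderiv_extChartAt (by simpa using hy)).bijective

/-- Near `a`, the differential of a `C¹` map `g` is read in charts as the continuous family
of derivatives of the coordinate expression of `g`. -/
theorem chartDifferential_mfderiv {g : M → M'} {a x : M} (hx : x ∈ (chartAt H a).source)
    (hgx : g x ∈ (chartAt H' (g a)).source) (hd : MDifferentiableAt I I' g x)
    (v : TangentSpace I x) :
    chartDifferential I' (g a) (g x) (mfderiv I I' g x v) =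
      fderivWithin ℝ (extChartAt I' (g a) ∘ g ∘ (extChartAt I a).symm) (Set.range I)
        (extChartAt I a x) (chartDifferential I a x v) := by
  have hxs : x ∈ (extChartAt I a).source := by simpa using hx
  have ht : extChartAt I a x ∈ (extChartAt I a).target := (extChartAt I a).map_source hxs
  have hU : UniqueMDiffWithinAt 𝓘(ℝ, E) (Set.range I) (extChartAt I a x) :=
    I.uniqueMDiffOn _ (extChartAt_target_subset_range a ht)
  have hG : MDifferentiableAt I 𝓘(ℝ, E') (extChartAt I' (g a) ∘ g) x :=
    (mdifferentiableAt_extChartAt hgx).comp x hd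
  have hinv := (extChartAt I a).left_inv hxs
  have h1 : MDifferentiableWithinAt 𝓘(ℝ, E) 𝓘(ℝ, E')
      (extChartAt I' (g a) ∘ g ∘ (extChartAt I a).symm) (Set.range I) (extChartAt I a x) :=
    MDifferentiableAt.comp_mdifferentiableWithinAt (g := extChartAt I' (g a) ∘ g) _
      (by rwa [hinv]) (mdifferentiableWithinAt_extChartAt_symm ht)
  have h2 := h1.differentiableWithinAt.hasFDerivWithinAt.hasMFDerivWithinAt
  have h3 : HasMFDerivAt I 𝓘(ℝ, E) (extChartAt I a) x (chartDifferential I a x) :=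
    (mdifferentiableAt_extChartAt hx).hasMFDerivAt
  have h4 := (h2.comp x (h3.hasMFDerivWithinAt (s := Set.univ))
    (fun y _ => by simp [extChartAt])).hasMFDerivAt univ_mem
  have h5 : HasMFDerivAt I 𝓘(ℝ, E') (extChartAt I' (g a) ∘ g) x
      (_ : TangentSpace I x →L[ℝ] E') :=
    ((mdifferentiableAt_extChartAt hgx).hasMFDerivAt.comp x hd.hasMFDerivAt)
  have h6 := h4.congr_of_eventuallyEq (f₁ := extChartAt I' (g a) ∘ g) (by
    filter_upwards [(chartAt H a).open_source.mem_nhds hx] with y hy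
    simp only [Function.comp_apply]
    rw [(extChartAt I a).left_inv (by simpa using hy)])
  exact DFunLike.congr_fun (hasMFDerivAt_unique h5 h6) v

theorem eventually_mdifferentiableAt {g : M → M'} {a : M} (hg : ContMDiffAt I I' 1 g a) :
    ∀ᶠ x in 𝓝 a, x ∈ (chartAt H a).source ∧ g x ∈ (chartAt H' (g a)).source ∧
      MDifferentiableAt I I' g x := by
  filter_upwards [eventually_mem_chart_source (H := H) a,
    hg.continuousAt.eventually (eventually_mem_chart_source (H := H') (g a)),
    (contMDiffAt_iff_contMDiffAt_nhds (by simp)).1 hg] with x h1 h2 h3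
  exact ⟨h1, h2, h3.mdifferentiableAt (by simp)⟩

theorem bijective_mfderiv_iff {g : M → M'} {a x : M} (hx : x ∈ (chartAt H a).source)
    (hgx : g x ∈ (chartAt H' (g a)).source) (hd : MDifferentiableAt I I' g x) :
    Function.Bijective (mfderiv I I' g x) ↔ Function.Bijective
      (fderivWithin ℝ (extChartAt I' (g a) ∘ g ∘ (extChartAt I a).symm) (Set.range I)
        (extChartAt I a x)) := by
  rw [← Function.Bijective.of_comp_iff _ (chartDifferential_bijective (I := I) hx),
    ← Function.Bijective.of_comp_iff' (chartDifferential_bijective (I := I') hgx)]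
  rw [iff_iff_eq]
  congr 1
  ext v
  exact chartDifferential_mfderiv hx hgx hd v

variable [FiniteDimensional ℝ E]

theorem eventually_bijective_mfderiv {g : M → M'} {a : M} (hg : ContMDiffAt I I' 1 g a)
    (hb : Function.Bijective (mfderiv I I' g a)) :
    ∀ᶠ x in 𝓝 a, Function.Bijective (mfderiv I I' g x) := by
  have hb' := (bijective_mfderiv_iff (mem_chart_source H a) (mem_chart_source H' (g a))
    (hg.mdifferentiableAt (by simp))).1 hb
  filter_upwards [eventually_mdifferentiableAt hg,
    (continuousAt_fderivWithin_chart hg).eventually (eventually_bijective hb')] with x hx hx'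
  exact (bijective_mfderiv_iff hx.1 hx.2.1 hx.2.2).2 hx'

/-- In charts at `a` and `g a` both orientations are constant and the differential is a continuous
family of isomorphisms, so whether it preserves the orientation cannot change near `a`. This
propagates an orientation statement along a collar. -/
theorem eventually_carriesOrientation_mfderiv_iff (hE : Module.finrank ℝ E = m) {g : M → M'}
    {a : M} (hg : ContMDiffAt I I' 1 g a) (hb : Function.Bijective (mfderiv I I' g a))
    {o : ∀ x : M, Orientation ℝ (TangentSpace I x) (Fin m)}
    {o' : ∀ x : M', Orientation ℝ (TangentSpace I' x) (Fin m)}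
    (ho : IsLocallyConstant I o) (ho' : IsLocallyConstant I' o') :
    ∀ᶠ x in 𝓝 a, (CarriesOrientation (mfderiv I I' g x).toLinearMap (o x) (o' (g x)) ↔
      CarriesOrientation (mfderiv I I' g a).toLinearMap (o a) (o' (g a))) := by
  have hb' := (bijective_mfderiv_iff (mem_chart_source H a) (mem_chart_source H' (g a))
    (hg.mdifferentiableAt (by simp))).1 hb
  obtain ⟨o₀, h₀⟩ := ho a
  obtain ⟨o₀', h₀'⟩ := ho' (g a)
  -- The condition at `x` is compared with one that does not depend on `x`, in the model spaces;
  -- taking `x = a` as well gives the claim.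
  have key : ∀ᶠ x in 𝓝 a, (CarriesOrientation (mfderiv I I' g x).toLinearMap (o x) (o' (g x)) ↔
      CarriesOrientation (fderivWithin ℝ (extChartAt I' (g a) ∘ g ∘ (extChartAt I a).symm)
        (Set.range I) (extChartAt I a a)).toLinearMap o₀ o₀') := by
    filter_upwards [eventually_mdifferentiableAt hg,
      (continuousAt_fderivWithin_chart hg).eventually
        (eventually_carriesOrientation_iff hE hb'), h₀, hg.continuousAt.eventually h₀']
      with x hx hx' h1 h2
    rw [← hx']
    have e : (chartDifferential I' (g a) (g x)).toLinearMap ∘ₗ (mfderiv I I' g x).toLinearMap =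
        (fderivWithin ℝ (extChartAt I' (g a) ∘ g ∘ (extChartAt I a).symm) (Set.range I)
          (extChartAt I a x)).toLinearMap ∘ₗ (chartDifferential I a x).toLinearMap :=
      LinearMap.ext fun v => chartDifferential_mfderiv hx.1 hx.2.1 hx.2.2 v
    constructor
    · intro h
      exact (e ▸ h2.comp h).of_comp_left h1
    · intro h
      exact (e.symm ▸ h.comp h1 : CarriesOrientation _ _ _).of_comp_right h2
  filter_upwards [key] with x hx
  rw [hx, key.self_of_nhds]

/-- An orientation pulled back along maps with bijective differential is again locally constant. It
orients both the quotient of a gluing and the cylinder. -/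
theorem IsLocallyConstant.of_mfderiv (hE : Module.finrank ℝ E = m)
    {o : ∀ x : M, Orientation ℝ (TangentSpace I x) (Fin m)}
    {o' : ∀ x : M', Orientation ℝ (TangentSpace I' x) (Fin m)}
    (ho' : IsLocallyConstant I' o')
    (h : ∀ a, ∃ g : M → M', ContMDiffAt I I' 1 g a ∧
      ∀ᶠ x in 𝓝 a, CarriesOrientation (mfderiv I I' g x).toLinearMap (o x) (o' (g x))) :
    IsLocallyConstant I o := by
  intro a
  obtain ⟨g, hg, h⟩ := h a
  have hb' := (bijective_mfderiv_iff (mem_chart_source H a) (mem_chart_source H' (g a))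
    (hg.mdifferentiableAt (by simp))).1 h.self_of_nhds.bijective
  obtain ⟨o₀', h₀'⟩ := ho' (g a)
  obtain ⟨o₀, h₀⟩ := exists_carriesOrientation_left (L := (fderivWithin ℝ
    (extChartAt I' (g a) ∘ g ∘ (extChartAt I a).symm)
      (Set.range I) (extChartAt I a a)).toLinearMap) hb' o₀'
  refine ⟨o₀, ?_⟩
  filter_upwards [eventually_mdifferentiableAt hg,
    (continuousAt_fderivWithin_chart hg).eventually
      (eventually_carriesOrientation_iff hE hb'), hg.continuousAt.eventually h₀', h]
    with x hx hx' h2 h3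
  rw [← hx'] at h₀
  have e : (chartDifferential I' (g a) (g x)).toLinearMap ∘ₗ (mfderiv I I' g x).toLinearMap =
      (fderivWithin ℝ (extChartAt I' (g a) ∘ g ∘ (extChartAt I a).symm) (Set.range I)
        (extChartAt I a x)).toLinearMap ∘ₗ (chartDifferential I a x).toLinearMap :=
    LinearMap.ext fun v => chartDifferential_mfderiv hx.1 hx.2.1 hx.2.2 v
  exact (e ▸ h2.comp h3).of_comp_right h₀

end Calculus

/-! ### The inverse function theorem for manifolds, with boundary points where possible. -/

section InverseFunction

variable {E H M : Type*} [NormedAddCommGroup E] [NormedSpace ℝ E] [FiniteDimensional ℝ E]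
  [TopologicalSpace H] {I : ModelWithCorners ℝ E H} [TopologicalSpace M] [ChartedSpace H M]
  {E' H' M' : Type*} [NormedAddCommGroup E'] [NormedSpace ℝ E']
  [TopologicalSpace H'] {I' : ModelWithCorners ℝ E' H'} [TopologicalSpace M']
  [ChartedSpace H' M'] [IsManifold I 1 M] [IsManifold I' 1 M']

/-- The injectivity half of the inverse function theorem survives at boundary points: the mean value
inequality on the convex set `ball ∩ s` shows that `F` is close to its linear part there. -/
theorem exists_mem_nhds_injOn_of_contDiffWithinAt {F : E → E'} {s : Set E} {p : E}
    (hs : Convex ℝ s) (hu : UniqueDiffOn ℝ s) (hp : p ∈ s) (hF : ContDiffWithinAt ℝ 1 F s p)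
    (hb : Function.Bijective (fderivWithin ℝ F s p)) :
    ∃ ε > 0, Set.InjOn F (Metric.ball p ε ∩ s) := by
  set e : E ≃L[ℝ] E' :=
    (LinearEquiv.ofBijective (fderivWithin ℝ F s p).toLinearMap hb).toContinuousLinearEquiv
  have he : (e : E →L[ℝ] E') = fderivWithin ℝ F s p := by ext; rfl
  -- An error constant below ‖e⁻¹‖⁻¹ forces injectivity; on a trivial space this norm is zero and
  -- any constant will do.
  obtain ⟨c, hc0, hc⟩ : ∃ c : NNReal, 0 < c ∧
      (Subsingleton E ∨ c < ‖(e.symm : E' →L[ℝ] E)‖₊⁻¹) := by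
    rcases subsingleton_or_nontrivial E with h | h
    · exact ⟨1, one_pos, Or.inl h⟩
    · have h0 : 0 < ‖(e.symm : E' →L[ℝ] E)‖₊⁻¹ := by
        rw [inv_pos]
        exact e.nnnorm_symm_pos
      exact ⟨_, half_pos h0, Or.inr (half_lt_self h0)⟩
  have h1 : ∀ᶠ y in 𝓝[s] p, ContDiffWithinAt ℝ 1 F s y := by
    simpa [Set.insert_eq_of_mem hp] using hF.eventually (by simp)
  have h2 : ∀ᶠ y in 𝓝[s] p, ‖fderivWithin ℝ F s y - e‖ < c := by
    have h3 := (hF.fderivWithin_right (m := 0) hu (by simp) hp).continuousWithinAt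
    have h4 := h3.tendsto (Metric.ball_mem_nhds _ (NNReal.coe_pos.2 hc0))
    filter_upwards [h4] with y hy
    simpa [he, dist_eq_norm] using hy
  obtain ⟨ε, hε, hsub⟩ := Metric.mem_nhdsWithin_iff.1 (h1.and h2)
  refine ⟨ε, hε, ?_⟩
  have hA : ApproximatesLinearOn F (e : E →L[ℝ] E') (Metric.ball p ε ∩ s) c := by
    intro x hx y hy
    exact Convex.norm_image_sub_le_of_norm_hasFDerivWithin_le' (𝕜 := ℝ)
      (fun z hz => (((hsub hz).1.differentiableWithinAt (by simp)).hasFDerivWithinAt).mono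
        Set.inter_subset_right) (fun z hz => (hsub hz).2.le)
      ((convex_ball p ε).inter hs) hy hx
  exact hA.injOn hc

theorem exists_mem_nhds_injOn {g : M → M'} {a : M} (hg : ContMDiffAt I I' 1 g a)
    (hb : Function.Bijective (mfderiv I I' g a)) : ∃ u ∈ 𝓝 a, Set.InjOn g u := by
  have hb' := (bijective_mfderiv_iff (mem_chart_source H a) (mem_chart_source H' (g a))
    (hg.mdifferentiableAt (by simp))).1 hb
  obtain ⟨ε, hε, hinj⟩ := exists_mem_nhds_injOn_of_contDiffWithinAt I.convex_range
    I.uniqueDiffOn (by simp [extChartAt]) (contMDiffAt_iff.1 hg).2 hb'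
  refine ⟨_, (eventually_mdifferentiableAt hg).and ((continuousAt_extChartAt (I := I) a).eventually
    (Metric.ball_mem_nhds _ hε)), ?_⟩
  rintro x ⟨⟨hx, -, -⟩, hx'⟩ y ⟨⟨hy, -, -⟩, hy'⟩ hxy
  have hx0 : x ∈ (extChartAt I a).source := by simpa using hx
  have hy0 : y ∈ (extChartAt I a).source := by simpa using hy
  apply (extChartAt I a).injOn hx0 hy0
  refine hinj ⟨hx', by simp [extChartAt]⟩ ⟨hy', by simp [extChartAt]⟩ ?_
  simp only [Function.comp_apply]
  rw [(extChartAt I a).left_inv hx0, (extChartAt I a).left_inv hy0, hxy]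

/-- The openness half of the inverse function theorem. It needs an interior point, since at a
boundary point neighborhoods have one-sided images. -/
theorem map_nhds_eq_of_bijective_mfderiv [FiniteDimensional ℝ E'] [I'.Boundaryless] {g : M → M'} {a : M}
    (hg : ContMDiffAt I I' 1 g a) (ha : I.IsInteriorPoint a)
    (hb : Function.Bijective (mfderiv I I' g a)) : map g (𝓝 a) = 𝓝 (g a) := by
  have hb' := (bijective_mfderiv_iff (mem_chart_source H a) (mem_chart_source H' (g a))
    (hg.mdifferentiableAt (by simp))).1 hb
  have hr := range_mem_nhds_isInteriorPoint ha
  have hF := (contMDiffAt_iff.1 hg).2.contDiffAt hr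
  rw [fderivWithin_of_mem_nhds hr] at hb'
  have h1 := (hF.hasStrictFDerivAt (by simp)).map_nhds_eq_of_surj
    (LinearMap.range_eq_top.2 hb'.surjective)
  have h2 : map (extChartAt I a).symm (𝓝 (extChartAt I a a)) = 𝓝 a := by
    rw [← map_extChartAt_symm_nhdsWithin_range (I := I) a, nhdsWithin_eq_nhds.2 hr]
  have h3 : map (extChartAt I' (g a)).symm (𝓝 (extChartAt I' (g a) (g a))) = 𝓝 (g a) := by
    rw [← map_extChartAt_symm_nhdsWithin_range (I := I') (g a), I'.range_eq_univ, nhdsWithin_univ]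
  rw [← Function.comp_assoc, ← Filter.map_map, h2, Function.comp_apply, Function.comp_apply,
    extChartAt_to_inv] at h1
  rw [← h3, ← h1, Filter.map_map]
  refine Filter.map_congr ?_
  filter_upwards [hg.continuousAt.eventually (eventually_mem_chart_source (H := H') (g a))]
    with x hx
  exact ((extChartAt I' (g a)).left_inv (by simpa using hx)).symm

/-- In charts, a continuous right inverse agrees near the point with the smooth local inverse,
because its values stay where the latter is a left inverse. -/
theorem contMDiffAt_of_rightInverse [I'.Boundaryless] {n : WithTop ℕ∞} (hn : 1 ≤ n) {g : M → M'}
    {c : M' → M} {a : M} (hg : ContMDiffAt I I' n g a) (ha : I.IsInteriorPoint a)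
    (hb : Function.Bijective (mfderiv I I' g a)) (hc : ContinuousAt c (g a)) (hca : c (g a) = a)
    (hgc : ∀ᶠ y in 𝓝 (g a), g (c y) = y) : ContMDiffAt I' I n c (g a) := by
  have hn0 : n ≠ 0 := by rintro rfl; simp at hn
  have hb' := (bijective_mfderiv_iff (mem_chart_source H a) (mem_chart_source H' (g a))
    (hg.mdifferentiableAt hn0)).1 hb
  have hr := range_mem_nhds_isInteriorPoint ha
  have hF := (contMDiffAt_iff.1 hg).2.contDiffAt hr
  rw [fderivWithin_of_mem_nhds hr] at hb'
  set F := extChartAt I' (g a) ∘ g ∘ (extChartAt I a).symm with hFdef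
  set e : E ≃L[ℝ] E' :=
    (LinearEquiv.ofBijective (fderiv ℝ F (extChartAt I a a)).toLinearMap hb').toContinuousLinearEquiv
  have he : (e : E →L[ℝ] E') = fderiv ℝ F (extChartAt I a a) := by ext; rfl
  have hFd : HasFDerivAt F (e : E →L[ℝ] E') (extChartAt I a a) := by
    rw [he]; exact (hF.differentiableAt hn0).hasFDerivAt
  have hL := hF.to_localInverse hFd hn0
  have hFa : F (extChartAt I a a) = extChartAt I' (g a) (g a) := by
    simp only [hFdef, Function.comp_apply, extChartAt_to_inv]
  rw [hFa] at hL
  refine contMDiffAt_iff.2 ⟨hc, ?_⟩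
  rw [I'.range_eq_univ, contDiffWithinAt_univ, hca]
  refine hL.congr_of_eventuallyEq ?_
  have hsymm : Tendsto (extChartAt I' (g a)).symm (𝓝 (extChartAt I' (g a) (g a))) (𝓝 (g a)) := by
    have := (continuousAt_extChartAt_symm (I := I') (g a)).tendsto
    rwa [extChartAt_to_inv] at this
  have hcc : Tendsto c (𝓝 (g a)) (𝓝 a) := by
    have := hc.tendsto
    rwa [hca] at this
  have hinv := (hF.hasStrictFDerivAt' hFd hn0).eventually_left_inverse
  have hT : Tendsto (extChartAt I a ∘ c ∘ (extChartAt I' (g a)).symm)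
      (𝓝 (extChartAt I' (g a) (g a))) (𝓝 (extChartAt I a a)) :=
    (continuousAt_extChartAt a).tendsto.comp (hcc.comp hsymm)
  filter_upwards [hT.eventually hinv, hsymm.eventually hgc,
    (hcc.comp hsymm).eventually (eventually_mem_chart_source (H := H) a),
    (extChartAt_target_mem_nhds (I := I') (g a))] with y h1 h2 h3 h4
  simp only [Function.comp_apply] at h1 h3 ⊢
  rw [← h1]
  unfold ContDiffAt.localInverse
  congr 1
  simp only [hFdef, Function.comp_apply]
  rw [(extChartAt I a).left_inv (by simpa using h3), h2, (extChartAt I' (g a)).right_inv h4]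

end InverseFunction

/-! ### A function vanishing on the boundary with positive inward derivative. -/

section BoundaryFunction

variable {n : ℕ} {W : Type*} [TopologicalSpace W] [ChartedSpace (EuclideanHalfSpace (n + 1)) W]
  
local notation "𝔼" => EuclideanSpace ℝ (Fin (n + 1))

theorem extChartAt_zero_nonneg (p y : W) : 0 ≤ extChartAt (𝓡∂ (n + 1)) p y 0 := by
  have : extChartAt (𝓡∂ (n + 1)) p y ∈ Set.range (𝓡∂ (n + 1)) := by simp [extChartAt]
  rwa [range_modelWithCornersEuclideanHalfSpace] at this

/-- A function which has a local minimum at `p` has nonnegative derivatives at `p`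
in the directions that do not point outward. -/
theorem hasMFDerivAt_nonneg_of_isLocalMin {u : W → ℝ} {p : W} {D : 𝔼 →L[ℝ] ℝ}
    (hu : HasMFDerivAt (𝓡∂ (n + 1)) 𝓘(ℝ, ℝ) u p D) (hmin : ∀ᶠ y in 𝓝 p, u p ≤ u y)
    (v : 𝔼) (hv : 0 ≤ v 0) : 0 ≤ D v := by
  have h1 := hu.2
  set p₀ := extChartAt (𝓡∂ (n + 1)) p p with hp₀
  have h2 : IsLocalMinOn (writtenInExtChartAt (𝓡∂ (n + 1)) 𝓘(ℝ, ℝ) p u)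
      (Set.range (𝓡∂ (n + 1))) p₀ := by
    have h3 : Tendsto (extChartAt (𝓡∂ (n + 1)) p).symm (𝓝[Set.range (𝓡∂ (n + 1))] p₀) (𝓝 p) :=
      (map_extChartAt_symm_nhdsWithin_range (I := 𝓡∂ (n + 1)) p).le
    filter_upwards [h3.eventually hmin] with y hy
    change u ((extChartAt (𝓡∂ (n + 1)) p).symm p₀) ≤ u ((extChartAt (𝓡∂ (n + 1)) p).symm y)
    rwa [hp₀, extChartAt_to_inv]
  refine h2.hasFDerivWithinAt_nonneg h1 (mem_posTangentConeAt_of_segment_subset ?_)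
  refine (𝓡∂ (n + 1)).convex_range.segment_subset (by simp [hp₀, extChartAt]) ?_
  rw [range_modelWithCornersEuclideanHalfSpace]
  exact add_nonneg (extChartAt_zero_nonneg p p) hv

/-- Both `v` and `-v` are admissible directions for the one-sided inequality. -/
theorem hasMFDerivAt_eq_zero_of_isLocalMin {u : W → ℝ} {p : W} {D : 𝔼 →L[ℝ] ℝ}
    (hu : HasMFDerivAt (𝓡∂ (n + 1)) 𝓘(ℝ, ℝ) u p D) (hmin : ∀ᶠ y in 𝓝 p, u p ≤ u y)
    (v : 𝔼) (hv : v 0 = 0) : D v = 0 := by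
  refine le_antisymm ?_ (hasMFDerivAt_nonneg_of_isLocalMin hu hmin v hv.ge)
  have := hasMFDerivAt_nonneg_of_isLocalMin hu hmin (-v) (by simp [hv])
  rwa [map_neg, Left.nonneg_neg_iff] at this

variable [IsManifold (𝓡∂ (n + 1)) ∞ W]

/-- By definition interior points are tested in their own preferred chart; for a smooth structure
any chart of the atlas gives the same answer. -/
theorem isInteriorPoint_iff_extChartAt_pos {p y : W}
    (hy : y ∈ (chartAt (EuclideanHalfSpace (n + 1)) p).source) :
    (𝓡∂ (n + 1)).IsInteriorPoint y ↔ 0 < extChartAt (𝓡∂ (n + 1)) p y 0 := by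
  rw [ModelWithCorners.isInteriorPoint_iff_of_mem_atlas (n := ∞) (by simp)
    (chart_mem_atlas (EuclideanHalfSpace (n + 1)) p) hy, OpenPartialHomeomorph.extend_target,
    interior_inter, interior_range_modelWithCornersEuclideanHalfSpace,
    ((𝓡∂ (n + 1)).continuous_symm.isOpen_preimage _
      (chartAt (EuclideanHalfSpace (n + 1)) p).open_target).interior_eq]
  constructor
  · exact fun h => h.2
  · refine fun h => ⟨?_, h⟩
    change (𝓡∂ (n + 1)).symm ((𝓡∂ (n + 1)) (chartAt (EuclideanHalfSpace (n + 1)) p y)) ∈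
      (chartAt (EuclideanHalfSpace (n + 1)) p).target
    rw [ModelWithCorners.left_inv]
    exact (chartAt (EuclideanHalfSpace (n + 1)) p).map_source hy

theorem isBoundaryPoint_iff_extChartAt_eq_zero {p y : W}
    (hy : y ∈ (chartAt (EuclideanHalfSpace (n + 1)) p).source) :
    (𝓡∂ (n + 1)).IsBoundaryPoint y ↔ extChartAt (𝓡∂ (n + 1)) p y 0 = 0 := by
  rw [ModelWithCorners.isBoundaryPoint_iff_not_isInteriorPoint,
    isInteriorPoint_iff_extChartAt_pos hy, not_lt]
  exact ⟨fun h => le_antisymm h (extChartAt_zero_nonneg p y), fun h => h.le⟩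

/-- The first coordinate of a chart has positive derivative in the inward directions. -/
theorem exists_hasMFDerivAt_extChartAt_zero {p q : W}
    (hp : p ∈ (chartAt (EuclideanHalfSpace (n + 1)) q).source)
    (hpb : (𝓡∂ (n + 1)).IsBoundaryPoint p) :
    ∃ D : 𝔼 →L[ℝ] ℝ,
      HasMFDerivAt (𝓡∂ (n + 1)) 𝓘(ℝ, ℝ) (fun y => extChartAt (𝓡∂ (n + 1)) q y 0) p D ∧
      ∀ v : 𝔼, 0 < v 0 → 0 < D v := by
  set L : 𝔼 →L[ℝ] ℝ := EuclideanSpace.proj 0 with hL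
  have hd0 := mdifferentiableAt_extChartAt (I := 𝓡∂ (n + 1)) hp
  set A : 𝔼 →L[ℝ] 𝔼 := chartDifferential (𝓡∂ (n + 1)) q p with hA
  have hLd : HasMFDerivAt 𝓘(ℝ, 𝔼) 𝓘(ℝ, ℝ) L (extChartAt (𝓡∂ (n + 1)) q p) L := L.hasMFDerivAt
  set D : 𝔼 →L[ℝ] ℝ := L ∘L A with hD
  have hd : HasMFDerivAt (𝓡∂ (n + 1)) 𝓘(ℝ, ℝ) (fun y => extChartAt (𝓡∂ (n + 1)) q y 0) p
      D := hLd.comp p hd0.hasMFDerivAt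
  have hmin : ∀ᶠ y in 𝓝 p, extChartAt (𝓡∂ (n + 1)) q p 0 ≤ extChartAt (𝓡∂ (n + 1)) q y 0 := by
    rw [(isBoundaryPoint_iff_extChartAt_eq_zero hp).1 hpb]
    exact Eventually.of_forall fun y => extChartAt_zero_nonneg q y
  refine ⟨D, hd, fun v hv => ?_⟩
  refine lt_of_le_of_ne (hasMFDerivAt_nonneg_of_isLocalMin hd hmin v hv.le) fun h0 => ?_
  -- `D` already vanishes on the boundary hyperplane. If it also killed one inward vector it would
  -- be zero, although the chart differential is onto.
  have hall : ∀ w, D w = 0 := by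
    intro w
    have h1 := hasMFDerivAt_eq_zero_of_isLocalMin hd hmin (w - (w 0 / v 0) • v) (by simp [hv.ne'])
    rwa [map_sub, map_smul, ← h0, smul_zero, sub_zero] at h1
  obtain ⟨w, hw⟩ : ∃ w, A w = EuclideanSpace.single 0 1 :=
    (chartDifferential_bijective (I := 𝓡∂ (n + 1)) hp).surjective _
  have h3 := hall w
  rw [hD, ContinuousLinearMap.comp_apply, hw] at h3
  simp [hL] at h3

/-- A finite sum of nonnegative terms, bump function times first chart coordinate. Near a boundary
point some bump function is 1, so the sum dominates that chart coordinate, with equality on the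
boundary; positivity and the derivative estimate are inherited from the coordinate. -/
theorem exists_boundary_function [CompactSpace W] [T2Space W] :
    ∃ f : W → ℝ, ContMDiff (𝓡∂ (n + 1)) 𝓘(ℝ, ℝ) ∞ f ∧
      (∀ p, (𝓡∂ (n + 1)).IsBoundaryPoint p → f p = 0) ∧
      (∀ p, (𝓡∂ (n + 1)).IsBoundaryPoint p →
        ∀ᶠ y in 𝓝 p, (𝓡∂ (n + 1)).IsInteriorPoint y → 0 < f y) ∧
      ∀ p, (𝓡∂ (n + 1)).IsBoundaryPoint p → ∃ D : 𝔼 →L[ℝ] ℝ,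
        HasMFDerivAt (𝓡∂ (n + 1)) 𝓘(ℝ, ℝ) f p D ∧ ∀ v : 𝔼, 0 < v 0 → 0 < D v := by
  have hK : IsCompact ((𝓡∂ (n + 1)).boundary W) :=
    (ModelWithCorners.isClosed_boundary (n := ∞) (by simp)).isCompact
  let χ : ∀ p : W, SmoothBumpFunction (𝓡∂ (n + 1)) p := fun p => Classical.arbitrary _
  obtain ⟨t, -, ht⟩ := hK.elim_nhds_subcover (fun p => {y | ∀ᶠ z in 𝓝 y, χ p z = 1})
    (fun p _ => eventually_eventually_nhds.2 (χ p).eventuallyEq_one)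
  set x₀ : W → W → ℝ := fun p y => extChartAt (𝓡∂ (n + 1)) p y 0 with hx₀
  have hterm : ∀ p y, 0 ≤ χ p y • x₀ p y := fun p y =>
    mul_nonneg (χ p).nonneg (extChartAt_zero_nonneg p y)
  set f : W → ℝ := fun y => ∑ p ∈ t, χ p y • x₀ p y with hf
  have hsmooth : ContMDiff (𝓡∂ (n + 1)) 𝓘(ℝ, ℝ) ∞ f := by
    refine contMDiff_finsetSum fun p _ => (χ p).contMDiff_smul ?_
    have hL : ContMDiff 𝓘(ℝ, 𝔼) 𝓘(ℝ, ℝ) ∞ (EuclideanSpace.proj (𝕜 := ℝ) (0 : Fin (n + 1)) :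
        𝔼 →L[ℝ] ℝ) := ContinuousLinearMap.contMDiff _
    exact hL.comp_contMDiffOn contMDiffOn_extChartAt
  have hf0 : ∀ p, (𝓡∂ (n + 1)).IsBoundaryPoint p → f p = 0 := by
    refine fun p hp => Finset.sum_eq_zero fun q _ => ?_
    by_cases hq : p ∈ (chartAt (EuclideanHalfSpace (n + 1)) q).source
    · rw [hx₀]
      simp only
      rw [(isBoundaryPoint_iff_extChartAt_eq_zero hq).1 hp, smul_zero]
    · rw [Function.notMem_support.1 fun h => hq ((χ q).support_subset_source h), zero_smul]
  have hle : ∀ p, (𝓡∂ (n + 1)).IsBoundaryPoint p → ∃ q ∈ t,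
      p ∈ (chartAt (EuclideanHalfSpace (n + 1)) q).source ∧ ∀ᶠ y in 𝓝 p, x₀ q y ≤ f y := by
    intro p hp
    obtain ⟨q, hqt, hq⟩ := Set.mem_iUnion₂.1 (ht hp)
    refine ⟨q, hqt, (χ q).support_subset_source ?_, ?_⟩
    · rw [Function.mem_support, (Filter.Eventually.self_of_nhds hq)]
      exact one_ne_zero
    · filter_upwards [hq] with y hy
      calc x₀ q y = χ q y • x₀ q y := by rw [hy, one_smul]
        _ ≤ f y := Finset.single_le_sum (fun p _ => hterm p y) hqt
  refine ⟨f, hsmooth, hf0, fun p hp => ?_, fun p hp => ?_⟩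
  · obtain ⟨q, -, hq, hy⟩ := hle p hp
    filter_upwards [hy, (chartAt (EuclideanHalfSpace (n + 1)) q).open_source.mem_nhds hq]
      with y h1 h2 h3
    exact ((isInteriorPoint_iff_extChartAt_pos h2).1 h3).trans_le h1
  · obtain ⟨q, -, hq, hy⟩ := hle p hp
    obtain ⟨D₀, hD₀, hpos⟩ := exists_hasMFDerivAt_extChartAt_zero hq hp
    have hd := (hsmooth p).mdifferentiableAt (by simp)
    set D : 𝔼 →L[ℝ] ℝ := mfderiv (𝓡∂ (n + 1)) 𝓘(ℝ, ℝ) f p with hD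
    have hDf : HasMFDerivAt (𝓡∂ (n + 1)) 𝓘(ℝ, ℝ) f p D := hd.hasMFDerivAt
    refine ⟨D, hDf, fun v hv => (hpos v hv).trans_le ?_⟩
    -- The difference is nonnegative near `p` and zero at `p`, so its inward derivatives are
    -- nonnegative.
    have hsub : HasMFDerivAt (𝓡∂ (n + 1)) 𝓘(ℝ, ℝ) (f - x₀ q) p (D - D₀) := hDf.sub hD₀
    have h0 : x₀ q p = 0 := (isBoundaryPoint_iff_extChartAt_eq_zero hq).1 hp
    have := hasMFDerivAt_nonneg_of_isLocalMin hsub (by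
      filter_upwards [hy] with y hy
      simp only [Pi.sub_apply, hf0 p hp, h0]
      linarith) v hv.le
    simpa using this

end BoundaryFunction

/-! ### A retraction onto an embedded compact manifold, smooth near it. -/

section Retraction

/-- Smoothness is assumed and obtained on a whole neighborhood: `ContDiffAt ℝ ∞` at one point gives
each finite order on a neighborhood that may depend on the order. -/
theorem exists_smooth_local_leftInverse {E E' : Type*} [NormedAddCommGroup E] [NormedSpace ℝ E]
    [FiniteDimensional ℝ E] [NormedAddCommGroup E'] [NormedSpace ℝ E'] {F : E → E'} {a : E}
    (hF : ∀ᶠ z in 𝓝 a, ContDiffAt ℝ ∞ F z) (hb : Function.Bijective (fderiv ℝ F a)) :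
    ∃ G : E' → E, (∀ᶠ y in 𝓝 (F a), ContDiffAt ℝ ∞ G y) ∧ ∀ᶠ z in 𝓝 a, G (F z) = z := by
  have hFa := hF.self_of_nhds
  have key : ∀ A : E →L[ℝ] E', Function.Bijective A → ∃ e : E ≃L[ℝ] E', (e : E →L[ℝ] E') = A :=
    fun A hA => ⟨(LinearEquiv.ofBijective A.toLinearMap hA).toContinuousLinearEquiv, by ext; rfl⟩
  obtain ⟨e, he⟩ := key _ hb
  have hd : HasFDerivAt F (e : E →L[ℝ] E') a := by
    rw [he]; exact (hFa.differentiableAt (by simp)).hasFDerivAt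
  set Φ := hFa.toOpenPartialHomeomorph F hd (by simp) with hΦ
  have hΦF : (Φ : E → E') = F := hFa.toOpenPartialHomeomorph_coe hd (by simp)
  have has : a ∈ Φ.source := hFa.mem_toOpenPartialHomeomorph_source hd (by simp)
  have hat : F a ∈ Φ.target := hFa.image_mem_toOpenPartialHomeomorph_target hd (by simp)
  have hsymm : Tendsto Φ.symm (𝓝 (F a)) (𝓝 a) := by
    have := (Φ.symm.continuousAt hat).tendsto
    rwa [← hΦF, Φ.left_inv has] at this
  have hcont : ContinuousAt (fderiv ℝ F) a := (hFa.fderiv_right (m := 0) (by simp)).continuousAt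
  refine ⟨Φ.symm, ?_, ?_⟩
  · filter_upwards [Φ.open_target.mem_nhds hat, hsymm.eventually hF,
      hsymm.eventually (hcont.eventually (eventually_bijective hb))] with y h1 h2 h3
    obtain ⟨e', he'⟩ := key _ h3
    refine Φ.contDiffAt_symm (f₀' := e') h1 ?_ (by rwa [hΦF])
    rw [he', hΦF]
    exact (h2.differentiableAt (by simp)).hasFDerivAt
  · filter_upwards [Φ.open_source.mem_nhds has] with z hz
    rw [← hΦF, Φ.left_inv hz]

variable {E H W : Type*} [NormedAddCommGroup E] [NormedSpace ℝ E] [FiniteDimensional ℝ E]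
  [TopologicalSpace H] {I : ModelWithCorners ℝ E H} [TopologicalSpace W] [ChartedSpace H W]
  {E' H' V : Type*} [NormedAddCommGroup E'] [NormedSpace ℝ E'] [FiniteDimensional ℝ E']
  [TopologicalSpace H'] {I' : ModelWithCorners ℝ E' H'} [I'.Boundaryless] [TopologicalSpace V]
  [ChartedSpace H' V] [IsManifold I ∞ W] [IsManifold I' ∞ V] {ι : V → W}

/-- Compose a chart of `W` with a linear left inverse of the differential of `ι`. The restriction of
this map to `V` is a local diffeomorphism onto the model space, and inverting it gives the
retraction. -/
theorem exists_local_retraction (hι : ContMDiff I' I ∞ ι)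
    (hinj : ∀ x, Function.Injective (mfderiv I' I ι x)) (x : V) :
    ∃ r : W → V, (∀ᶠ w in 𝓝 (ι x), ContMDiffAt I I' ∞ r w) ∧ ∀ᶠ y in 𝓝 x, r (ι y) = y := by
  set A : E' →L[ℝ] E := chartDifferential I (ι x) (ι x) ∘L mfderiv I' I ι x with hA
  have hAinj : Function.Injective A :=
    (chartDifferential_bijective (mem_chart_source H (ι x))).injective.comp (hinj x)
  obtain ⟨π', hπ'⟩ := A.toLinearMap.exists_leftInverse_of_injective (LinearMap.ker_eq_bot.2 hAinj)
  set π : E →L[ℝ] E' := LinearMap.toContinuousLinearMap π' with hπ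
  have hπA : ∀ v, π (A v) = v := fun v => LinearMap.congr_fun hπ' v
  set g : V → E' := fun y => π (extChartAt I (ι x) (ι y)) with hg
  have hπs : ∀ z, ContMDiffAt 𝓘(ℝ, E) 𝓘(ℝ, E') ∞ π z := π.contMDiff
  have hgs : ∀ᶠ y in 𝓝 x, ContMDiffAt I' 𝓘(ℝ, E') ∞ g y := by
    filter_upwards [hι.continuous.continuousAt.eventually
      (eventually_mem_chart_source (H := H) (ι x))] with y hy
    exact (hπs _).comp y ((contMDiffAt_extChartAt' hy).comp y (hι y))
  have hgd : HasMFDerivAt I' 𝓘(ℝ, E') g x (π ∘L A : E' →L[ℝ] E') := by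
    have h1 : HasMFDerivAt 𝓘(ℝ, E) 𝓘(ℝ, E') π (extChartAt I (ι x) (ι x)) π := π.hasMFDerivAt
    have h2 : HasMFDerivAt I 𝓘(ℝ, E) (extChartAt I (ι x)) (ι x)
        (chartDifferential I (ι x) (ι x)) :=
      (mdifferentiableAt_extChartAt (mem_chart_source H (ι x))).hasMFDerivAt
    exact h1.comp x (h2.comp x ((hι x).mdifferentiableAt (by simp)).hasMFDerivAt)
  have hgb : Function.Bijective (mfderiv I' 𝓘(ℝ, E') g x) := by
    rw [hgd.mfderiv]
    have : (π ∘L A : E' →L[ℝ] E') = ContinuousLinearMap.id ℝ E' := by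
      ext v; exact hπA v
    rw [this]
    exact Function.bijective_id
  set F : E' → E' := g ∘ (extChartAt I' x).symm with hF
  set a := extChartAt I' x x with ha
  have hsymm : Tendsto (extChartAt I' x).symm (𝓝 a) (𝓝 x) := by
    have := (continuousAt_extChartAt_symm (I := I') x).tendsto
    rwa [extChartAt_to_inv] at this
  have hsm : ∀ᶠ z in 𝓝 a, ContMDiffAt 𝓘(ℝ, E') I' ∞ (extChartAt I' x).symm z := by
    filter_upwards [extChartAt_target_mem_nhds (I := I') x] with z hz
    exact (contMDiffOn_extChartAt_symm x).contMDiffAt ((isOpen_extChartAt_target x).mem_nhds hz)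
  have hFs : ∀ᶠ z in 𝓝 a, ContDiffAt ℝ ∞ F z := by
    filter_upwards [hsm, hsymm.eventually hgs] with z h1 h2
    exact (h2.comp z h1).contDiffAt
  have hFb : Function.Bijective (fderiv ℝ F a) := by
    have := (bijective_mfderiv_iff (mem_chart_source H' x) (mem_chart_source E' (g x))
      hgd.mdifferentiableAt).1 hgb
    rw [I'.range_eq_univ, fderivWithin_univ] at this
    exact this
  obtain ⟨G, hG, hGF⟩ := exists_smooth_local_leftInverse hFs hFb
  have hFa : F a = π (extChartAt I (ι x) (ι x)) := by
    simp only [hF, ha, hg, Function.comp_apply, extChartAt_to_inv]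
  have hGa : G (F a) = a := hGF.self_of_nhds
  have hGc : Tendsto G (𝓝 (F a)) (𝓝 a) := by
    have := hG.self_of_nhds.continuousAt.tendsto
    rwa [hGa] at this
  have hπc : Tendsto (fun w => π (extChartAt I (ι x) w)) (𝓝 (ι x)) (𝓝 (F a)) := by
    rw [hFa]
    exact (π.continuous.continuousAt.comp (continuousAt_extChartAt (ι x))).tendsto
  refine ⟨fun w => (extChartAt I' x).symm (G (π (extChartAt I (ι x) w))), ?_, ?_⟩
  · filter_upwards [(hGc.comp hπc).eventually hsm, hπc.eventually hG,
      eventually_mem_chart_source (H := H) (ι x)] with w h1 h2 h3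
    exact h1.comp w (h2.contMDiffAt.comp w ((hπs _).comp w (contMDiffAt_extChartAt' h3)))
  · filter_upwards [(continuousAt_extChartAt (I := I') x).eventually hGF,
      eventually_mem_chart_source (H := H') x] with y h1 h2
    have h3 := (extChartAt I' x).left_inv (show y ∈ (extChartAt I' x).source by simpa using h2)
    simp only [hF, hg, Function.comp_apply] at h1
    rw [h3] at h1
    rw [h1, h3]

variable [T2Space W]

/-- A retraction which is smooth near the points of `s` can be modified to be also smooth
near the points of a neighborhood of `x`. -/
theorem exists_retraction_extension (hι : ContMDiff I' I ∞ ι) (hemb : Topology.IsEmbedding ι)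
    (hinj : ∀ x, Function.Injective (mfderiv I' I ι x)) (x : V) :
    ∃ t ∈ 𝓝 x, ∀ s : Set V,
      (∃ r : W → V, (∀ y, r (ι y) = y) ∧
        ∀ y ∈ s, ∀ᶠ w in 𝓝 (ι y), ContMDiffAt I I' ∞ r w) →
      ∃ r : W → V, (∀ y, r (ι y) = y) ∧
        ∀ y ∈ s ∪ t, ∀ᶠ w in 𝓝 (ι y), ContMDiffAt I I' ∞ r w := by
  obtain ⟨r', hr's, hr'⟩ := exists_local_retraction hι hinj x
  have hr'x : r' (ι x) = x := hr'.self_of_nhds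
  rw [hemb.isInducing.nhds_eq_comap, eventually_comap] at hr'
  have hA : ∀ᶠ w in 𝓝 (ι x), (∀ᶠ z in 𝓝 w, ContMDiffAt I I' ∞ r' z) ∧ (∀ y, ι y = w → r' (ι y) = y) ∧
      r' w ∈ (chartAt H' x).source := by
    refine (eventually_eventually_nhds.2 hr's).and (Eventually.and (hr'.mono fun w hw y hy => hw y hy) ?_)
    have := hr's.self_of_nhds.continuousAt.eventually
      (eventually_mem_chart_source (H := H') (r' (ι x)))
    rwa [hr'x] at this
  -- The bump function is supported where `r'` is smooth, retracts, and takes values in the chart of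
  -- `V` at `x`.
  obtain ⟨χ, -, hχ⟩ := (SmoothBumpFunction.nhds_basis_tsupport (I := I) (ι x)).mem_iff.1 hA
  refine ⟨{y | ∀ᶠ w in 𝓝 (ι y), χ w = 1},
    hι.continuous.continuousAt.eventually (eventually_eventually_nhds.2 χ.eventuallyEq_one), ?_⟩
  rintro s ⟨r, hr, hrs⟩
  set φ := extChartAt I' x with hφ
  have hχ' : ∀ w, χ w ≠ 0 → w ∈ tsupport χ := fun w hw => subset_tsupport _ hw
  -- Convex combination of the two retractions in the chart at `x`. Near `ι y` both take values
  -- close to `y`, so it stays in the chart target, and on the image of `ι` both give `y`.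
  set b : W → V := fun w => φ.symm ((1 - χ w) • φ (r w) + χ w • φ (r' w)) with hb
  refine ⟨fun w => open Classical in if χ w = 0 then r w else b w, ?_, ?_⟩
  · intro y
    by_cases h : χ (ι y) = 0
    · simp [h, hr]
    · have h1 := hχ (hχ' _ h)
      have h2 : r' (ι y) = y := h1.2.1 y rfl
      have h3 : y ∈ φ.source := by simpa [h2, hφ] using h1.2.2
      simp only [h, if_false, hb, hr, h2]
      rw [← add_smul, sub_add_cancel, one_smul, φ.left_inv h3]
  · rintro y (hy | hy)
    · by_cases h : ι y ∈ tsupport χ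
      · have h1 := hχ h
        have h2 : r' (ι y) = y := h1.2.1 y rfl
        have h3 : y ∈ (chartAt H' x).source := by simpa [h2] using h1.2.2
        have h3' : y ∈ φ.source := by simpa [hφ] using h3
        have hrc : ContinuousAt r (ι y) := (hrs y hy).self_of_nhds.continuousAt
        have hr'c : ContinuousAt r' (ι y) := h1.1.self_of_nhds.continuousAt
        have hφc : ContinuousAt φ y := continuousAt_extChartAt' h3'
        have hcomb : ContinuousAt (fun w => (1 - χ w) • φ (r w) + χ w • φ (r' w)) (ι y) := by
          have e1 : ContinuousAt (fun w => φ (r w)) (ι y) :=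
            ContinuousAt.comp (g := φ) (by rwa [hr]) hrc
          have e2 : ContinuousAt (fun w => φ (r' w)) (ι y) :=
            ContinuousAt.comp (g := φ) (by rwa [h2]) hr'c
          have e3 : ContinuousAt χ (ι y) := χ.continuous.continuousAt
          exact ((continuousAt_const.sub e3).smul e1).add (e3.smul e2)
        have hval : (1 - χ (ι y)) • φ (r (ι y)) + χ (ι y) • φ (r' (ι y)) = φ y := by
          rw [hr, h2, ← add_smul, sub_add_cancel, one_smul]
        have htgt : ∀ᶠ w in 𝓝 (ι y),
            (1 - χ w) • φ (r w) + χ w • φ (r' w) ∈ φ.target := by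
          refine hcomb.eventually ((isOpen_extChartAt_target x).mem_nhds ?_)
          change (1 - χ (ι y)) • φ (r (ι y)) + χ (ι y) • φ (r' (ι y)) ∈ φ.target
          rw [hval]
          exact φ.map_source h3'
        have hrsrc : ∀ᶠ w in 𝓝 (ι y), r w ∈ (chartAt H' x).source :=
          hrc.eventually ((chartAt H' x).open_source.mem_nhds (by rwa [hr]))
        have hr'src : ∀ᶠ w in 𝓝 (ι y), r' w ∈ (chartAt H' x).source :=
          hr'c.eventually ((chartAt H' x).open_source.mem_nhds (by rwa [h2]))
        filter_upwards [hrs y hy, htgt, hrsrc, hr'src, h1.1,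
          eventually_eventually_nhds.2 hrsrc] with w k1 k2 k3 k4 k5 k6
        have m1 : ContMDiffAt I 𝓘(ℝ, E') ∞ (fun w => φ (r w)) w :=
          (contMDiffAt_extChartAt' k3).comp w k1
        have m2 : ContMDiffAt I 𝓘(ℝ, E') ∞ (fun w => φ (r' w)) w :=
          (contMDiffAt_extChartAt' k4).comp w k5
        have m3 : ContMDiffAt I 𝓘(ℝ, E') ∞
            (fun w => (1 - χ w) • φ (r w) + χ w • φ (r' w)) w :=
          ((contMDiffAt_const.sub χ.contMDiffAt).smul m1).add (χ.contMDiffAt.smul m2)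
        have m4 : ContMDiffAt I I' ∞ b w :=
          ((contMDiffOn_extChartAt_symm x).contMDiffAt
            ((isOpen_extChartAt_target x).mem_nhds k2)).comp w m3
        refine m4.congr_of_eventuallyEq ?_
        -- Where χ vanishes, `b` reduces to `r`, so the two branches define one smooth map here.
        filter_upwards [k6] with w' hw'
        by_cases h0 : χ w' = 0
        · simp only [h0, if_true, hb, sub_zero, one_smul, zero_smul, add_zero]
          rw [φ.left_inv (by simpa [hφ] using hw')]
        · simp [h0]
      · have h0 : ∀ᶠ w in 𝓝 (ι y), χ w = 0 := by
          filter_upwards [(isClosed_tsupport χ).isOpen_compl.mem_nhds h] with w hw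
          exact image_eq_zero_of_notMem_tsupport hw
        filter_upwards [hrs y hy, eventually_eventually_nhds.2 h0] with w h1 h2
        refine h1.congr_of_eventuallyEq ?_
        filter_upwards [h2] with w' hw'
        simp [hw']
    · have hy' : ∀ᶠ w in 𝓝 (ι y), χ w = 1 := hy
      have h1 := hχ (hχ' (ι y) (by rw [hy'.self_of_nhds]; exact one_ne_zero))
      have hr'src : ∀ᶠ w in 𝓝 (ι y), r' w ∈ (chartAt H' x).source :=
        h1.1.self_of_nhds.continuousAt.eventually ((chartAt H' x).open_source.mem_nhds h1.2.2)
      filter_upwards [h1.1, eventually_eventually_nhds.2 (hy'.and hr'src)] with w k1 k2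
      refine k1.congr_of_eventuallyEq ?_
      filter_upwards [k2] with w' hw'
      simp only [hw'.1, one_ne_zero, if_false, hb, sub_self, zero_smul, one_smul, zero_add]
      exact φ.left_inv (by simpa [hφ] using hw'.2)

/-- Finitely many applications of `exists_retraction_extension` suffice by compactness. Away from
the image of `ι` nothing is required of `r`, not even continuity. -/
theorem exists_retraction [CompactSpace V] [Nonempty V] (hι : ContMDiff I' I ∞ ι)
    (hemb : Topology.IsEmbedding ι) (hinj : ∀ x, Function.Injective (mfderiv I' I ι x)) :
    ∃ r : W → V, (∀ y, r (ι y) = y) ∧ ∀ y, ∀ᶠ w in 𝓝 (ι y), ContMDiffAt I I' ∞ r w := by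
  have key := isCompact_univ.induction_on (X := V) (p := fun t => ∀ s : Set V,
      (∃ r : W → V, (∀ y, r (ι y) = y) ∧
        ∀ y ∈ s, ∀ᶠ w in 𝓝 (ι y), ContMDiffAt I I' ∞ r w) →
      ∃ r : W → V, (∀ y, r (ι y) = y) ∧
        ∀ y ∈ s ∪ t, ∀ᶠ w in 𝓝 (ι y), ContMDiffAt I I' ∞ r w)
    (fun s hs => by simpa using hs)
    (fun t t' htt' h s hs => by
      obtain ⟨r, h1, h2⟩ := h s hs
      exact ⟨r, h1, fun y hy => h2 y (Set.union_subset_union_right s htt' hy)⟩)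
    (fun t t' h h' s hs => by
      rw [← Set.union_assoc]
      exact h' _ (h s hs))
    (fun x _ => by
      obtain ⟨t, ht, h⟩ := exists_retraction_extension hι hemb hinj x
      exact ⟨t, mem_nhdsWithin_of_mem_nhds ht, h⟩)
  -- The process starts from a set-theoretic left inverse of `ι`, smooth near no point in
  -- particular.
  obtain ⟨r, h1, h2⟩ := key ∅ ⟨Function.invFun ι,
    Function.leftInverse_invFun hemb.injective, by simp⟩
  exact ⟨r, h1, fun y => h2 y (by simp)⟩

end Retraction

/-! ### The collar neighborhood theorem. -/

section CollarTheorem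

variable {n : ℕ} {V W : Type*} [TopologicalSpace W] [ChartedSpace (EuclideanHalfSpace (n + 1)) W]
  [TopologicalSpace V] [ChartedSpace (EuclideanSpace ℝ (Fin n)) V]

variable (n) in
/-- A smooth embedding of `V` into `W` whose image is the boundary of `W`. -/
structure IsBoundaryEmbedding (ι : V → W) : Prop where
  contMDiff : ContMDiff (𝓡 n) (𝓡∂ (n + 1)) ∞ ι
  isEmbedding : Topology.IsEmbedding ι
  injective_mfderiv : ∀ x, Function.Injective (mfderiv (𝓡 n) (𝓡∂ (n + 1)) ι x)
  range_eq : Set.range ι = (𝓡∂ (n + 1)).boundary W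

variable (n) in
/-- A collar of the boundary `ι : V → W`, given by the two components `r` and `f` of a bijection
of the open set `O` onto `V × [0, ε)`, and by the inverse `c` of this bijection. -/
structure IsCollar (ι : V → W) (r : W → V) (f : W → ℝ) (ε : ℝ) (O : Set W) (c : V × ℝ → W) :
    Prop where
  pos : 0 < ε
  isOpen : IsOpen O
  contMDiffAt : ∀ w ∈ O, ContMDiffAt (𝓡∂ (n + 1)) ((𝓡 n).prod 𝓘(ℝ, ℝ)) ∞ (fun w => (r w, f w)) w
  bijective : ∀ w ∈ O, Function.Bijective
    (mfderiv (𝓡∂ (n + 1)) ((𝓡 n).prod 𝓘(ℝ, ℝ)) (fun w => (r w, f w)) w)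
  mem_Ico : ∀ w ∈ O, f w ∈ Set.Ico 0 ε
  left_inv : ∀ w ∈ O, c (r w, f w) = w
  mem : ∀ x, ∀ t ∈ Set.Ico 0 ε, c (x, t) ∈ O
  right_inv : ∀ x, ∀ t ∈ Set.Ico 0 ε, (r (c (x, t)), f (c (x, t))) = (x, t)
  zero : ∀ x, c (x, 0) = ι x
  continuousOn : ContinuousOn c (Set.univ ×ˢ Set.Ico 0 ε)
  contMDiffAt_symm : ∀ x, ∀ t ∈ Set.Ioo 0 ε,
    ContMDiffAt ((𝓡 n).prod 𝓘(ℝ, ℝ)) (𝓡∂ (n + 1)) ∞ c (x, t)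
  isInteriorPoint : ∀ w ∈ O, 0 < f w → (𝓡∂ (n + 1)).IsInteriorPoint w
  mfderiv_pos : ∀ x, ∃ D : EuclideanSpace ℝ (Fin (n + 1)) →L[ℝ] ℝ,
    HasMFDerivAt (𝓡∂ (n + 1)) 𝓘(ℝ, ℝ) f (ι x) D ∧ ∀ v : EuclideanSpace ℝ (Fin (n + 1)),
      0 < v 0 → 0 < D v

variable {ι : V → W}

/-- On vectors tangent to the boundary the differential is (id, 0), and on an inward vector its last
component is nonzero. Hence it is onto, and the dimensions agree. -/
theorem IsBoundaryEmbedding.bijective_mfderiv (h : IsBoundaryEmbedding n ι) {r : W → V} {f : W → ℝ}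
    (hr : ∀ x, r (ι x) = x) (hf : ∀ x, f (ι x) = 0) (x : V)
    (hrs : MDifferentiableAt (𝓡∂ (n + 1)) (𝓡 n) r (ι x))
    {D : EuclideanSpace ℝ (Fin (n + 1)) →L[ℝ] ℝ}
    (hD : HasMFDerivAt (𝓡∂ (n + 1)) 𝓘(ℝ, ℝ) f (ι x) D)
    (hpos : ∀ v : EuclideanSpace ℝ (Fin (n + 1)), 0 < v 0 → 0 < D v) :
    Function.Bijective
      (mfderiv (𝓡∂ (n + 1)) ((𝓡 n).prod 𝓘(ℝ, ℝ)) (fun w => (r w, f w)) (ι x)) := by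
  set A : EuclideanSpace ℝ (Fin (n + 1)) →L[ℝ] EuclideanSpace ℝ (Fin n) :=
    mfderiv (𝓡∂ (n + 1)) (𝓡 n) r (ι x) with hA
  set B : EuclideanSpace ℝ (Fin n) →L[ℝ] EuclideanSpace ℝ (Fin (n + 1)) :=
    mfderiv (𝓡 n) (𝓡∂ (n + 1)) ι x with hB
  have hAd : HasMFDerivAt (𝓡∂ (n + 1)) (𝓡 n) r (ι x) A := hrs.hasMFDerivAt
  have hBd : HasMFDerivAt (𝓡 n) (𝓡∂ (n + 1)) ι x B :=
    ((h.contMDiff x).mdifferentiableAt (by simp)).hasMFDerivAt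
  have hAB : ∀ v, A (B v) = v := by
    have h1 : HasMFDerivAt (𝓡 n) (𝓡 n) (r ∘ ι) x
        (A ∘L B : EuclideanSpace ℝ (Fin n) →L[ℝ] EuclideanSpace ℝ (Fin n)) := hAd.comp x hBd
    have h2 : r ∘ ι = id := funext hr
    rw [h2] at h1
    exact fun v => DFunLike.congr_fun (hasMFDerivAt_unique h1 (hasMFDerivAt_id x)) v
  have hDB : ∀ v, D (B v) = 0 := by
    have h1 : HasMFDerivAt (𝓡 n) 𝓘(ℝ, ℝ) (f ∘ ι) x
        (D ∘L B : EuclideanSpace ℝ (Fin n) →L[ℝ] ℝ) := hD.comp x hBd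
    have h2 : f ∘ ι = fun _ => 0 := funext hf
    rw [h2] at h1
    exact fun v => DFunLike.congr_fun (hasMFDerivAt_unique h1 (hasMFDerivAt_const 0 x)) v
  have hd : HasMFDerivAt (𝓡∂ (n + 1)) ((𝓡 n).prod 𝓘(ℝ, ℝ)) (fun w => (r w, f w)) (ι x)
      (A.prod D : EuclideanSpace ℝ (Fin (n + 1)) →L[ℝ] EuclideanSpace ℝ (Fin n) × ℝ) :=
    hAd.prodMk hD
  rw [hd.mfderiv]
  have hsurj : Function.Surjective (A.prod D) := by
    rintro ⟨u, t⟩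
    have h0 : 0 < D (EuclideanSpace.single 0 1) := hpos _ (by simp)
    set ν : EuclideanSpace ℝ (Fin (n + 1)) :=
      (t / D (EuclideanSpace.single 0 1)) • EuclideanSpace.single 0 1 with hν
    refine ⟨B (u - A ν) + ν, ?_⟩
    simp only [ContinuousLinearMap.prod_apply, map_add, hAB, hDB]
    refine Prod.ext (by simp) ?_
    simp [hν, h0.ne']
  exact ⟨(LinearMap.injective_iff_surjective_of_finrank_eq_finrank
    (f := (A.prod D).toLinearMap) (by simp)).2 hsurj, hsurj⟩

theorem IsBoundaryEmbedding.isBoundaryPoint (h : IsBoundaryEmbedding n ι) (x : V) :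
    (𝓡∂ (n + 1)).IsBoundaryPoint (ι x) := by
  have : ι x ∈ (𝓡∂ (n + 1)).boundary W := h.range_eq ▸ Set.mem_range_self x
  exact this

variable [IsManifold (𝓡∂ (n + 1)) ∞ W] [IsManifold (𝓡 n) ∞ V]

/-- The map Φ = (r, f) is a local diffeomorphism near the compact boundary and injective on it,
hence injective on a neighborhood. What remains is a uniform height ε, surjectivity, and continuity
of the inverse, all of which rest on a compact neighborhood `d` of the boundary on which Φ is well
behaved. -/
theorem IsBoundaryEmbedding.exists_isCollar [CompactSpace W] [T2Space W] [CompactSpace V]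
    [T2Space V] [Nonempty V] (h : IsBoundaryEmbedding n ι) :
    ∃ (r : W → V) (f : W → ℝ) (ε : ℝ) (O : Set W) (c : V × ℝ → W), IsCollar n ι r f ε O c := by
  obtain ⟨r, hr, hrs⟩ := exists_retraction h.contMDiff h.isEmbedding h.injective_mfderiv
  obtain ⟨f, hfs, hf0, hfpos, hfD⟩ := exists_boundary_function (n := n) (W := W)
  have hb := h.isBoundaryPoint
  set K : Set W := (𝓡∂ (n + 1)).boundary W with hK
  have hKι : ∀ w ∈ K, ∃ x, ι x = w := fun w hw => h.range_eq.ge hw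
  have hKc : IsCompact K := (ModelWithCorners.isClosed_boundary (n := ∞) (by simp)).isCompact
  set Φ : W → V × ℝ := fun w => (r w, f w) with hΦ
  have hΦι : ∀ x, Φ (ι x) = (x, 0) := fun x => Prod.ext (hr x) (hf0 _ (hb x))
  have hΦs : ∀ x, ∀ᶠ w in 𝓝 (ι x), ContMDiffAt (𝓡∂ (n + 1)) ((𝓡 n).prod 𝓘(ℝ, ℝ)) ∞ Φ w :=
    fun x => (hrs x).mono fun w hw => hw.prodMk (hfs w)
  have hΦb : ∀ x, Function.Bijective
      (mfderiv (𝓡∂ (n + 1)) ((𝓡 n).prod 𝓘(ℝ, ℝ)) Φ (ι x)) := by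
    intro x
    obtain ⟨D, hD, hpos⟩ := hfD _ (hb x)
    exact h.bijective_mfderiv hr (fun x => hf0 _ (hb x)) x
      ((hrs x).self_of_nhds.mdifferentiableAt (by simp)) hD hpos
  have hΦ1 : ∀ x, ContMDiffAt (𝓡∂ (n + 1)) ((𝓡 n).prod 𝓘(ℝ, ℝ)) 1 Φ (ι x) :=
    fun x => (hΦs x).self_of_nhds.of_le (by simp)
  -- injectivity near the boundary
  obtain ⟨t, htK, htinj⟩ : ∃ t ∈ 𝓝ˢ K, Set.InjOn Φ t := by
    refine Set.InjOn.exists_mem_nhdsSet ?_ hKc ?_ ?_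
    · intro w hw w' hw' hww'
      obtain ⟨x, rfl⟩ := hKι w hw
      obtain ⟨x', rfl⟩ := hKι w' hw'
      rw [hΦι, hΦι, Prod.mk.injEq] at hww'
      rw [hww'.1]
    · intro w hw
      obtain ⟨x, rfl⟩ := hKι w hw
      exact (hΦs x).self_of_nhds.continuousAt
    · intro w hw
      obtain ⟨x, rfl⟩ := hKι w hw
      exact exists_mem_nhds_injOn (hΦ1 x) (hΦb x)
  set G : Set W := {w | ContMDiffAt (𝓡∂ (n + 1)) ((𝓡 n).prod 𝓘(ℝ, ℝ)) ∞ Φ w ∧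
    Function.Bijective (mfderiv (𝓡∂ (n + 1)) ((𝓡 n).prod 𝓘(ℝ, ℝ)) Φ w) ∧
    ((𝓡∂ (n + 1)).IsInteriorPoint w → 0 < f w)} with hG
  have hGK : G ∈ 𝓝ˢ K := by
    refine mem_nhdsSet_iff_forall.2 fun w hw => ?_
    obtain ⟨x, rfl⟩ := hKι w hw
    exact (hΦs x).and ((eventually_bijective_mfderiv (hΦ1 x) (hΦb x)).and (hfpos _ (hb x)))
  obtain ⟨d, hdK, hdc, hdsub⟩ := exists_mem_nhdsSet_isClosed_subset (inter_mem htK hGK)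
    (ModelWithCorners.isClosed_boundary (n := ∞) (by simp))
  have hintK : K ⊆ interior d := subset_interior_iff_mem_nhdsSet.2 hdK
  have hnotK : ∀ w, w ∉ K → (𝓡∂ (n + 1)).IsInteriorPoint w := fun w hw =>
    (ModelWithCorners.isInteriorPoint_iff_not_isBoundaryPoint w).2 hw
  have hdcomp : IsCompact d := hdc.isCompact
  -- Take ε to be the minimum of `f` on the frontier of `d`. Below this level, points of `d` are
  -- interior to `d`, so `O` is open in `W` and also cut out of the compact set `d` by `f < ε`.
  obtain ⟨ε, hε, hεd⟩ : ∃ ε > 0, ∀ w ∈ d, w ∉ interior d → ε ≤ f w := by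
    have hcomp : IsCompact (d \ interior d) := hdcomp.diff isOpen_interior
    rcases (d \ interior d).eq_empty_or_nonempty with h0 | h0
    · refine ⟨1, one_pos, fun w hw hw' => ?_⟩
      exact absurd (show w ∈ d \ interior d from ⟨hw, hw'⟩) (by rw [h0]; exact fun h => h)
    · obtain ⟨w₀, hw₀, hmin⟩ := hcomp.exists_isMinOn h0 hfs.continuous.continuousOn
      refine ⟨f w₀, (hdsub hw₀.1).2.2.2 (hnotK _ fun hk => hw₀.2 (hintK hk)), fun w hw hw' => ?_⟩
      exact hmin ⟨hw, hw'⟩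
  set O : Set W := interior d ∩ {w | f w < ε} with hO
  have hOo : IsOpen O := isOpen_interior.inter (isOpen_lt hfs.continuous continuous_const)
  have hOd : O ⊆ d := fun w hw => interior_subset hw.1
  have hdO : ∀ w ∈ d, f w < ε → w ∈ O := by
    intro w hw hlt
    refine ⟨?_, hlt⟩
    by_contra hcon
    exact absurd (hεd w hw hcon) (not_le.2 hlt)
  have hιO : ∀ x, ι x ∈ O := fun x => ⟨hintK (hb x), by
    change f (ι x) < ε
    rwa [hf0 _ (hb x)]⟩
  have hOf : ∀ w ∈ O, f w ∈ Set.Ico 0 ε := by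
    refine fun w hw => ⟨?_, hw.2⟩
    by_cases hwK : w ∈ K
    · exact (hf0 w hwK).ge
    · exact ((hdsub (hOd hw)).2.2.2 (hnotK w hwK)).le
  have hΦd : ContinuousOn Φ d := fun w hw => (hdsub hw).2.1.continuousAt.continuousWithinAt
  have hinj : Set.InjOn Φ O := htinj.mono fun w hw => (hdsub (hOd hw)).1
  have hfint : ∀ w ∈ O, 0 < f w → (𝓡∂ (n + 1)).IsInteriorPoint w :=
    fun w _ hw => hnotK w fun hk => hw.ne' (hf0 w hk)
  have hsurj : ∀ x, ∀ t ∈ Set.Ico 0 ε, ∃ w ∈ O, Φ w = (x, t) := by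
    rintro x t ⟨ht0, htε⟩
    rcases ht0.eq_or_lt with rfl | ht0
    · exact ⟨ι x, hιO x, hΦι x⟩
    have : LocallyConnectedSpace V :=
      ChartedSpace.locallyConnectedSpace (EuclideanSpace ℝ (Fin n)) V
    set S : Set (V × ℝ) := Φ '' (O ∩ Kᶜ) with hS
    have hSo : IsOpen S := by
      rw [isOpen_iff_mem_nhds]
      rintro _ ⟨w, ⟨hwO, hwK⟩, rfl⟩
      have hw := hdsub (hOd hwO)
      rw [← map_nhds_eq_of_bijective_mfderiv (hw.2.1.of_le (by simp)) (hnotK w hwK) hw.2.2.1]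
      exact image_mem_map ((hOo.inter hKc.isClosed.isOpen_compl).mem_nhds ⟨hwO, hwK⟩)
    have hT : IsPreconnected (connectedComponent x ×ˢ Set.Ioo 0 ε) :=
      isPreconnected_connectedComponent.prod isPreconnected_Ioo
    -- The image `S` of the non-boundary part is open. It is closed relative to heights in (0, ε)
    -- because Φ maps the compact `d` to a closed set, and it meets the connected set in question;
    -- hence it contains that set.
    have hTS : connectedComponent x ×ˢ Set.Ioo 0 ε ⊆ S := by
      refine hT.subset_of_closure_inter_subset hSo ?_ ?_
      · obtain ⟨D, hD, hpos⟩ := hfD _ (hb x)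
        -- Non-boundary points accumulate at `ι x`: otherwise `f` would vanish near it, against its
        -- nonzero derivative.
        have hfreq : ∃ᶠ w in 𝓝 (ι x), w ∉ K := by
          intro hcon
          have h0 : f =ᶠ[𝓝 (ι x)] fun _ => 0 := hcon.mono fun w hw => hf0 w (not_not.1 hw)
          have h1 : HasMFDerivAt (𝓡∂ (n + 1)) 𝓘(ℝ, ℝ) f (ι x)
              (0 : EuclideanSpace ℝ (Fin (n + 1)) →L[ℝ] ℝ) :=
            (hasMFDerivAt_const 0 _).congr_of_eventuallyEq h0
          have h2 : D = 0 := hasMFDerivAt_unique hD h1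
          have h3 := hpos (EuclideanSpace.single 0 1) (by simp)
          simp [h2] at h3
        have hrc : ∀ᶠ w in 𝓝 (ι x), r w ∈ connectedComponent x := by
          refine (hrs x).self_of_nhds.continuousAt.eventually
            (isOpen_connectedComponent.mem_nhds ?_)
          rw [hr]
          exact mem_connectedComponent
        obtain ⟨w, hwK, hwO, hwr⟩ := (hfreq.and_eventually
          ((show ∀ᶠ w in 𝓝 (ι x), w ∈ O from hOo.mem_nhds (hιO x)).and hrc)).exists
        exact ⟨Φ w, ⟨hwr, (hdsub (hOd hwO)).2.2.2 (hnotK w hwK), hwO.2⟩, w, ⟨hwO, hwK⟩, rfl⟩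
      · rintro y ⟨hy, hyT⟩
        have hcl : IsClosed (Φ '' d) := (hdcomp.image_of_continuousOn hΦd).isClosed
        obtain ⟨w, hwd, rfl⟩ := hcl.closure_subset_iff.2
          (Set.image_mono fun w hw => hOd hw.1) hy
        exact ⟨w, ⟨hdO w hwd hyT.2.2, fun hk => hyT.2.1.ne' (hf0 w hk)⟩, rfl⟩
    obtain ⟨w, hw, hwx⟩ := hTS (show (x, t) ∈ _ from ⟨mem_connectedComponent, ht0, htε⟩)
    exact ⟨w, hw.1, hwx⟩
  have : Nonempty W := ⟨ι (Classical.arbitrary V)⟩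
  set c : V × ℝ → W := Function.invFunOn Φ O with hc
  have hcl : ∀ w ∈ O, c (Φ w) = w := hinj.leftInvOn_invFunOn
  have hcr : ∀ x, ∀ t ∈ Set.Ico 0 ε, c (x, t) ∈ O ∧ Φ (c (x, t)) = (x, t) := fun x t ht =>
    ⟨Function.invFunOn_mem (hsurj x t ht), Function.invFunOn_eq (hsurj x t ht)⟩
  have hccont : ContinuousOn c (Set.univ ×ˢ Set.Ico 0 ε) := by
    rw [continuousOn_iff_isClosed]
    intro F hF
    -- The inverse is continuous because Φ is closed on the compact `d`; at heights below ε every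
    -- preimage in `d` lies in `O`.
    refine ⟨Φ '' (F ∩ d), ?_, ?_⟩
    · exact ((hdcomp.inter_left hF).image_of_continuousOn
        (hΦd.mono Set.inter_subset_right)).isClosed
    · ext ⟨x, t⟩
      constructor
      · rintro ⟨h1, h2⟩
        have h3 := hcr x t h2.2
        exact ⟨⟨_, ⟨h1, hOd h3.1⟩, h3.2⟩, h2⟩
      · rintro ⟨⟨w, ⟨hwF, hwd⟩, hw⟩, h2⟩
        refine ⟨?_, h2⟩
        have h4 : f w = t := congrArg Prod.snd hw
        have h3 := hcl w (hdO w hwd (by rw [h4]; exact h2.2.2))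
        change c (x, t) ∈ F
        rwa [← hw, h3]
  refine ⟨r, f, ε, O, c, hε, hOo, fun w hw => (hdsub (hOd hw)).2.1,
    fun w hw => (hdsub (hOd hw)).2.2.1, hOf, hcl, fun x t ht => (hcr x t ht).1,
    fun x t ht => (hcr x t ht).2, fun x => ?_, hccont, fun x t ht => ?_, hfint,
    fun x => hfD _ (hb x)⟩
  · rw [← hΦι x]
    exact hcl _ (hιO x)
  · have ht' : t ∈ Set.Ico 0 ε := ⟨ht.1.le, ht.2⟩
    obtain ⟨h1, h2⟩ := hcr x t ht'
    have hw := (hdsub (hOd h1)).2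
    have hnhds : (Set.univ : Set V) ×ˢ Set.Ioo 0 ε ∈ 𝓝 (x, t) :=
      (isOpen_univ.prod isOpen_Ioo).mem_nhds ⟨trivial, ht⟩
    -- Smoothness of the inverse is obtained at positive heights only, where the preimage is an
    -- interior point.
    have key := contMDiffAt_of_rightInverse (c := c) (n := ∞) (by simp) hw.1 (hfint _ h1 (by
      rw [show f (c (x, t)) = t from congrArg Prod.snd h2]; exact ht.1)) hw.2.1
    rw [h2] at key
    refine key ?_ rfl ?_
    · exact (hccont.mono (Set.prod_mono_right Set.Ioo_subset_Ico_self)).continuousAt hnhds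
    · filter_upwards [hnhds] with y hy
      exact (hcr y.1 y.2 ⟨hy.2.1.le, hy.2.2⟩).2

end CollarTheorem

/-! ### The orientation of V × ℝ. -/

section ProductOrientation

variable {n : ℕ} {V : Type*} [TopologicalSpace V] [ChartedSpace (EuclideanSpace ℝ (Fin n)) V]

variable (n) in
/-- The orientation of `ℝⁿ × ℝ` for which `(0, 1)` followed by a positive basis of `ℝⁿ` is
positive. -/
def stabilizeEuclidean (o : Orientation ℝ (EuclideanSpace ℝ (Fin n)) (Fin n)) :
    Orientation ℝ (EuclideanSpace ℝ (Fin n) × ℝ) (Fin (n + 1)) :=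
  stabilize (by simp) o

/-- The orientation of `V × ℝ` for which `∂/∂t` followed by a positive basis of the tangent space
of `V` is positive. -/
def productOrientation (o : ∀ x : V, Orientation ℝ (TangentSpace (𝓡 n) x) (Fin n)) :
    ∀ y : V × ℝ, Orientation ℝ (TangentSpace ((𝓡 n).prod 𝓘(ℝ, ℝ)) y) (Fin (n + 1)) :=
  fun y => stabilizeEuclidean n (o y.1)

theorem chartDifferential_prod_real [IsManifold (𝓡 n) 1 V] {x y : V} {s t : ℝ}
    (hy : y ∈ (chartAt (EuclideanSpace ℝ (Fin n)) x).source) :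
    (chartDifferential ((𝓡 n).prod 𝓘(ℝ, ℝ)) (x, s) (y, t) :
      EuclideanSpace ℝ (Fin n) × ℝ →L[ℝ] EuclideanSpace ℝ (Fin n) × ℝ) =
      (chartDifferential (𝓡 n) x y :
        EuclideanSpace ℝ (Fin n) →L[ℝ] EuclideanSpace ℝ (Fin n)).prodMap
          (ContinuousLinearMap.id ℝ ℝ) := by
  have h1 : HasMFDerivAt (𝓡 n) 𝓘(ℝ, EuclideanSpace ℝ (Fin n)) (extChartAt (𝓡 n) x) y
      (chartDifferential (𝓡 n) x y) := (mdifferentiableAt_extChartAt hy).hasMFDerivAt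
  have h2 : HasMFDerivAt 𝓘(ℝ, ℝ) 𝓘(ℝ, ℝ) (id : ℝ → ℝ) t (ContinuousLinearMap.id ℝ ℝ) :=
    hasMFDerivAt_id t
  have h3 : HasMFDerivAt ((𝓡 n).prod 𝓘(ℝ, ℝ)) (𝓘(ℝ, EuclideanSpace ℝ (Fin n)).prod 𝓘(ℝ, ℝ))
      (Prod.map (extChartAt (𝓡 n) x) (id : ℝ → ℝ)) (y, t)
      ((chartDifferential (𝓡 n) x y :
        EuclideanSpace ℝ (Fin n) →L[ℝ] EuclideanSpace ℝ (Fin n)).prodMap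
          (ContinuousLinearMap.id ℝ ℝ)) := by
    have h := HasMFDerivAt.prodMap (p := (y, t)) h1 h2
    rw [h1.mfderiv, h2.mfderiv] at h
    exact h
  have h5 : HasMFDerivAt ((𝓡 n).prod 𝓘(ℝ, ℝ)) 𝓘(ℝ, EuclideanSpace ℝ (Fin n) × ℝ)
      (extChartAt ((𝓡 n).prod 𝓘(ℝ, ℝ)) (x, s)) (y, t)
      ((chartDifferential (𝓡 n) x y :
        EuclideanSpace ℝ (Fin n) →L[ℝ] EuclideanSpace ℝ (Fin n)).prodMap
          (ContinuousLinearMap.id ℝ ℝ)) := by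
    rw [modelWithCornersSelf_prod, ← chartedSpaceSelf_prod]
    exact h3
  exact h5.mfderiv

theorem IsLocallyConstant.productOrientation [IsManifold (𝓡 n) 1 V]
    {o : ∀ x : V, Orientation ℝ (TangentSpace (𝓡 n) x) (Fin n)} (h : IsLocallyConstant (𝓡 n) o) :
    IsLocallyConstant ((𝓡 n).prod 𝓘(ℝ, ℝ)) (productOrientation o) := by
  rintro ⟨x, s⟩
  obtain ⟨o₀, h₀⟩ := h x
  refine ⟨stabilizeEuclidean n o₀, ?_⟩
  have h1 : Tendsto Prod.fst (𝓝 (x, s)) (𝓝 x) := continuous_fst.continuousAt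
  filter_upwards [h1.eventually h₀, h1.eventually
    (eventually_mem_chart_source (H := EuclideanSpace ℝ (Fin n)) x)] with y h2 h3
  have h4 := CarriesOrientation.stabilize (V := EuclideanSpace ℝ (Fin n))
    (W := EuclideanSpace ℝ (Fin n)) (by simp) (by simp) h2
  have h5 := congrArg ContinuousLinearMap.toLinearMap
    (chartDifferential_prod_real (s := s) (t := y.2) h3)
  exact h5.symm ▸ h4

end ProductOrientation

/-! ### A collar compares the orientation of W with the product orientation. -/

section CollarOrientation

variable {n : ℕ} {W : CompactOrientedManifoldWithBoundary.{u} n}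
  {V : ClosedOrientedManifold.{u} n} {ι : V.carrier → W.carrier}

theorem IsOrientedBoundaryMap.isBoundaryEmbedding (h : IsOrientedBoundaryMap W V ι) :
    IsBoundaryEmbedding n ι :=
  ⟨h.contMDiff, h.isEmbedding, h.injective_mfderiv, h.range_eq⟩

/-- Tangent vectors at `p` are expressed in the preferred chart at `p`, whose differential there is
the identity. -/
theorem isOutward_iff (p : W.carrier) (v : EuclideanSpace ℝ (Fin (n + 1))) :
    IsOutward W p v ↔ v 0 < 0 := by
  have h : chartDifferential (𝓡∂ (n + 1)) p p = ContinuousLinearMap.id ℝ _ :=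
    mfderiv_extChartAt_self
  unfold IsOutward
  rw [h]
  rfl

/-- The minus sign reflects that `f` grows inward while boundary orientations put the outward vector
first. The claim holds on the boundary by definition of the boundary orientation, and it spreads
along each collar segment because it is locally constant. -/
theorem IsCollar.carriesOrientation (h : IsOrientedBoundaryMap W V ι)
    {r : W.carrier → V.carrier} {f : W.carrier → ℝ} {ε : ℝ} {O : Set W.carrier}
    {c : V.carrier × ℝ → W.carrier} (hc : IsCollar n ι r f ε O c) {w : W.carrier} (hw : w ∈ O) :
    CarriesOrientation
      (mfderiv (𝓡∂ (n + 1)) ((𝓡 n).prod 𝓘(ℝ, ℝ)) (fun w => (r w, f w)) w).toLinearMap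
      (W.orientation w) (-productOrientation V.orientation (r w, f w)) := by
  set Φ : W.carrier → V.carrier × ℝ := fun w => (r w, f w) with hΦ
  set P : W.carrier → Prop := fun w => CarriesOrientation
      (mfderiv (𝓡∂ (n + 1)) ((𝓡 n).prod 𝓘(ℝ, ℝ)) Φ w).toLinearMap
      (W.orientation w) (-productOrientation V.orientation (Φ w)) with hP
  have hloc : ∀ w ∈ O, ∀ᶠ w' in 𝓝 w, P w' ↔ P w := fun w hw =>
    eventually_carriesOrientation_mfderiv_iff (by simp)
      ((hc.contMDiffAt w hw).of_le (by simp)) (hc.bijective w hw) W.isLocallyConstant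
      V.isLocallyConstant.productOrientation.neg
  have hzero : ∀ x, P (ι x) := by
    intro x
    have hx : ι x ∈ O := by
      rw [← hc.zero]
      exact hc.mem x 0 ⟨le_rfl, hc.pos⟩
    have hΦx : ∀ x, Φ (ι x) = (x, 0) := fun x => by
      rw [hΦ, ← hc.zero]
      exact hc.right_inv x 0 ⟨le_rfl, hc.pos⟩
    set A : EuclideanSpace ℝ (Fin (n + 1)) →L[ℝ] EuclideanSpace ℝ (Fin n) × ℝ :=
      mfderiv (𝓡∂ (n + 1)) ((𝓡 n).prod 𝓘(ℝ, ℝ)) Φ (ι x) with hA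
    set B : EuclideanSpace ℝ (Fin n) →L[ℝ] EuclideanSpace ℝ (Fin (n + 1)) :=
      mfderiv (𝓡 n) (𝓡∂ (n + 1)) ι x with hB
    have hAd : HasMFDerivAt (𝓡∂ (n + 1)) ((𝓡 n).prod 𝓘(ℝ, ℝ)) Φ (ι x) A :=
      ((hc.contMDiffAt _ hx).mdifferentiableAt (by simp)).hasMFDerivAt
    have hBd : HasMFDerivAt (𝓡 n) (𝓡∂ (n + 1)) ι x B :=
      ((h.contMDiff x).mdifferentiableAt (by simp)).hasMFDerivAt
    have hAB : ∀ u, A (B u) = (u, 0) := by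
      have h1 : HasMFDerivAt (𝓡 n) ((𝓡 n).prod 𝓘(ℝ, ℝ)) (Φ ∘ ι) x
        (A ∘L B : EuclideanSpace ℝ (Fin n) →L[ℝ] EuclideanSpace ℝ (Fin n) × ℝ) := hAd.comp x hBd
      have h2 : Φ ∘ ι = fun x => (x, (0 : ℝ)) := funext hΦx
      rw [h2] at h1
      exact fun v => DFunLike.congr_fun (hasMFDerivAt_unique h1
        ((hasMFDerivAt_id x).prodMk (hasMFDerivAt_const (0 : ℝ) x))) v
    obtain ⟨D, hD, hpos⟩ := hc.mfderiv_pos x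
    have hAD : ∀ v, (A v).2 = D v := by
      have h1 : HasMFDerivAt (𝓡∂ (n + 1)) 𝓘(ℝ, ℝ) f (ι x)
          (ContinuousLinearMap.snd ℝ (EuclideanSpace ℝ (Fin n)) ℝ ∘L A :
            EuclideanSpace ℝ (Fin (n + 1)) →L[ℝ] ℝ) := (hasMFDerivAt_snd (Φ (ι x))).comp (ι x) hAd
      exact fun v => DFunLike.congr_fun (hasMFDerivAt_unique h1 hD) v
    -- If `v 0 ≥ 0`, then `v + s • e` is inward for every `s > 0`; the value `s = -D v / D e` would
    -- make `D` vanish on an inward vector.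
    have hneg : ∀ v, D v < 0 → v 0 < 0 := by
      intro v hv
      by_contra! h0
      set e : EuclideanSpace ℝ (Fin (n + 1)) := EuclideanSpace.single 0 1
      have h1 : ∀ s : ℝ, 0 < s → 0 < D v + s * D e := fun s hs => by
        have := hpos (v + s • e) (by simp [e]; linarith)
        simpa using this
      have h2 : 0 < D e := hpos e (by simp [e])
      have h3 := h1 (-D v / D e) (div_pos (by linarith) h2)
      rw [div_mul_cancel₀ _ h2.ne'] at h3
      linarith
    have hw : CarriesOrientation A.toLinearMap (W.orientation (ι x))
        (-stabilizeEuclidean n (V.orientation x)) := by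
      refine carriesOrientation_of_boundary_iff (by simp) (hc.bijective _ hx) (j := B.toLinearMap)
        hAB fun b b' h0 hs => ?_
      refine h.orientation_iff x (b' 0) ((isOutward_iff _ _).2 (hneg _ ((hAD _).symm.trans_lt h0))) b b' rfl hs
    have hf : (Φ (ι x)).1 = x := by rw [hΦx]
    -- The orientation lives over the base point, so the point is generalized before substituting.
    have hgoal : ∀ y, y = x → CarriesOrientation A.toLinearMap (W.orientation (ι x))
        (-stabilizeEuclidean n (V.orientation y)) := by
      rintro _ rfl
      exact hw
    exact hgoal _ hf
  have h0 : (0 : ℝ) ∈ Set.Ico 0 ε := ⟨le_rfl, hc.pos⟩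
  have key := isPreconnected_Ico.induction₂ (s := Set.Ico 0 ε)
    (fun t t' => P (c (r w, t)) ↔ P (c (r w, t')))
    (fun t ht => by
      have hcont : ContinuousWithinAt (fun t => c (r w, t)) (Set.Ico 0 ε) t :=
        (hc.continuousOn (r w, t) ⟨trivial, ht⟩).comp (by fun_prop)
          (fun s hs => ⟨trivial, hs⟩)
      exact (hcont.eventually (hloc _ (hc.mem _ t ht))).mono fun s hs => hs.symm)
    (fun _ _ _ _ _ _ h1 h2 => h1.trans h2) (fun _ _ _ _ h1 => h1.symm) h0 (hc.mem_Ico w hw)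
  rw [hc.zero, hc.left_inv w hw] at key
  exact key.1 (hzero _)

end CollarOrientation

/-! ### Manifolds modeled on another manifold by smoothly related local homeomorphisms. -/

section LocalModel

variable {E H : Type*} [NormedAddCommGroup E] [NormedSpace ℝ E] [TopologicalSpace H]

/-- A family of local homeomorphisms from `X` to a smooth manifold `W` whose transition maps are
smooth. -/
structure LocalModel (I : ModelWithCorners ℝ E H) (X W : Type*) [TopologicalSpace X]
    [TopologicalSpace W] [ChartedSpace H W] where
  chart : X → OpenPartialHomeomorph X W
  mem_source : ∀ x, x ∈ (chart x).source
  contMDiffAt : ∀ x y z, z ∈ (chart x).source → z ∈ (chart y).source →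
    ContMDiffAt I I ∞ (chart y ∘ (chart x).symm) (chart x z)

namespace LocalModel

variable {I : ModelWithCorners ℝ E H} {X W : Type*} [TopologicalSpace X]
    [TopologicalSpace W] [ChartedSpace H W] (L : LocalModel I X W)

/-- The smooth structure defined by a local model. -/
abbrev chartedSpace : ChartedSpace H X where
  atlas := Set.range fun x => L.chart x ≫ₕ chartAt H (L.chart x x)
  chartAt x := L.chart x ≫ₕ chartAt H (L.chart x x)
  mem_chart_source x := by simp [L.mem_source]
  chart_mem_atlas x := ⟨x, rfl⟩

theorem isManifold [IsManifold I ∞ W] : letI := L.chartedSpace; IsManifold I ∞ X := by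
  let _ := L.chartedSpace
  refine isManifold_of_contDiffOn I ∞ X ?_
  rintro _ _ ⟨x, rfl⟩ ⟨y, rfl⟩ _ ⟨hp, h, rfl⟩
  simp only [Set.mem_preimage, I.left_inv] at hp
  simp only [mfld_simps] at hp
  obtain ⟨⟨h1, h2⟩, h3, h4⟩ := hp
  set w := (chartAt H (L.chart x x)).symm h with hw
  have hz := (L.chart x).map_target h2
  have hT := L.contMDiffAt x y _ hz h3
  rw [(L.chart x).right_inv h2] at hT
  have hwx : w ∈ (chartAt H (L.chart x x)).source := (chartAt H (L.chart x x)).map_target h1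
  have key := ((contMDiffAt_iff_of_mem_source hwx h4).1 hT).2
  have he : extChartAt I (L.chart x x) w = I h := by
    simp [extChartAt, hw, (chartAt H (L.chart x x)).right_inv h1]
  rw [he] at key
  exact key.mono Set.inter_subset_right

/-- The preferred chart at `x` is `L.chart x` followed by the preferred chart of `W` at its value,
so in these charts `L.chart x` is the identity. Hence its differential at `x` is the identity of the
model space. -/
theorem eventuallyEq_chart (x : X) : letI := L.chartedSpace
    writtenInExtChartAt I I x (L.chart x) =ᶠ[𝓝[Set.range I] (extChartAt I x x)] id := by
  let _ := L.chartedSpace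
  filter_upwards [extChartAt_target_mem_nhdsWithin (I := I) x] with p hp
  have h := (extChartAt I x).right_inv hp
  exact h

theorem eventuallyEq_chart_symm (x : X) : letI := L.chartedSpace
    writtenInExtChartAt I I (L.chart x x) (L.chart x).symm
      =ᶠ[𝓝[Set.range I] (extChartAt I (L.chart x x) (L.chart x x))] id := by
  let _ := L.chartedSpace
  have h1 := (L.eventuallyEq_chart x)
  filter_upwards [extChartAt_target_mem_nhdsWithin (I := I) x] with p hp
  have h := (extChartAt I x).right_inv hp
  have e : (L.chart x).symm (L.chart x x) = x := (L.chart x).left_inv (L.mem_source x)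
  rw [writtenInExtChartAt, e]
  exact h

theorem contMDiffAt_chart (x : X) : letI := L.chartedSpace
    ContMDiffAt I I ∞ (L.chart x) x := by
  let _ := L.chartedSpace
  refine contMDiffAt_iff.2 ⟨(L.chart x).continuousAt (L.mem_source x), ?_⟩
  exact contDiffWithinAt_id.congr_of_eventuallyEq (L.eventuallyEq_chart x)
    ((L.eventuallyEq_chart x).self_of_nhdsWithin (by simp [extChartAt]))

theorem hasMFDerivAt_chart (x : X) : letI := L.chartedSpace
    HasMFDerivAt I I (L.chart x) x (ContinuousLinearMap.id ℝ E) := by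
  let _ := L.chartedSpace
  refine ⟨(L.chart x).continuousAt (L.mem_source x), ?_⟩
  exact (hasFDerivWithinAt_id _ _).congr_of_eventuallyEq (L.eventuallyEq_chart x)
    ((L.eventuallyEq_chart x).self_of_nhdsWithin (by simp [extChartAt]))

theorem contMDiffAt_chart_symm (x : X) : letI := L.chartedSpace
    ContMDiffAt I I ∞ (L.chart x).symm (L.chart x x) := by
  let _ := L.chartedSpace
  refine contMDiffAt_iff.2 ⟨(L.chart x).continuousAt_symm
    ((L.chart x).map_source (L.mem_source x)), ?_⟩
  exact contDiffWithinAt_id.congr_of_eventuallyEq (L.eventuallyEq_chart_symm x)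
    ((L.eventuallyEq_chart_symm x).self_of_nhdsWithin (by simp [extChartAt]))

theorem hasMFDerivAt_chart_symm (x : X) : letI := L.chartedSpace
    HasMFDerivAt I I (L.chart x).symm (L.chart x x) (ContinuousLinearMap.id ℝ E) := by
  let _ := L.chartedSpace
  refine ⟨(L.chart x).continuousAt_symm
    ((L.chart x).map_source (L.mem_source x)), ?_⟩
  exact (hasFDerivWithinAt_id _ _).congr_of_eventuallyEq (L.eventuallyEq_chart_symm x)
    ((L.eventuallyEq_chart_symm x).self_of_nhdsWithin (by simp [extChartAt]))

variable {E' H' Y : Type*} [NormedAddCommGroup E'] [NormedSpace ℝ E'] [TopologicalSpace H']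
  {I' : ModelWithCorners ℝ E' H'} [TopologicalSpace Y] [ChartedSpace H' Y]

theorem eventuallyEq_of_chart_comp {g : Y → X} {y : Y} {h : Y → W} (hg : ContinuousAt g y)
    (hh : ∀ᶠ z in 𝓝 y, g z ∈ (L.chart (g y)).source → L.chart (g y) (g z) = h z) :
    g =ᶠ[𝓝 y] (L.chart (g y)).symm ∘ h := by
  filter_upwards [hh, hg.eventually ((L.chart (g y)).open_source.mem_nhds (L.mem_source _))]
    with z h1 h2
  rw [Function.comp_apply, ← h1 h2, (L.chart (g y)).left_inv h2]

/-- A continuous map into `X` may be tested for smoothness after the local homeomorphism, as a map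
into `W`. -/
theorem contMDiffAt_of_chart_comp {g : Y → X} {y : Y} {h : Y → W} (hg : ContinuousAt g y)
    (hh : ∀ᶠ z in 𝓝 y, g z ∈ (L.chart (g y)).source → L.chart (g y) (g z) = h z)
    (hs : ContMDiffAt I' I ∞ h y) : letI := L.chartedSpace
    ContMDiffAt I' I ∞ g y := by
  let _ := L.chartedSpace
  have h0 : L.chart (g y) (g y) = h y := hh.self_of_nhds (L.mem_source _)
  refine ContMDiffAt.congr_of_eventuallyEq ?_ (L.eventuallyEq_of_chart_comp hg hh)
  have h1 := L.contMDiffAt_chart_symm (g y)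
  rw [h0] at h1
  exact h1.comp y hs

theorem hasMFDerivAt_of_chart_comp {g : Y → X} {y : Y} {h : Y → W} (hg : ContinuousAt g y)
    (hh : ∀ᶠ z in 𝓝 y, g z ∈ (L.chart (g y)).source → L.chart (g y) (g z) = h z) {D : E' →L[ℝ] E}
    (hs : HasMFDerivAt I' I h y D) : letI := L.chartedSpace
    HasMFDerivAt I' I g y D := by
  let _ := L.chartedSpace
  have h0 : L.chart (g y) (g y) = h y := hh.self_of_nhds (L.mem_source _)
  refine HasMFDerivAt.congr_of_eventuallyEq ?_ (L.eventuallyEq_of_chart_comp hg hh)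
  have h1 := L.hasMFDerivAt_chart_symm (g y)
  rw [h0] at h1
  exact h1.comp y hs

/-- Since `L.chart x` has identity differential at `x`, the orientation of `W` at `L.chart x x` is
literally an orientation of the tangent space at `x`. These choices fit together because transitions
preserve orientation. -/
theorem isLocallyConstant [FiniteDimensional ℝ E] [IsManifold I ∞ W] {m : ℕ}
    (hE : Module.finrank ℝ E = m)
    {o : ∀ w : W, Orientation ℝ (TangentSpace I w) (Fin m)} (ho : IsLocallyConstant I o)
    (hL : ∀ x y z, z ∈ (L.chart x).source → z ∈ (L.chart y).source →
      CarriesOrientation (mfderiv I I (L.chart y ∘ (L.chart x).symm) (L.chart x z)).toLinearMap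
        (o (L.chart x z)) (o (L.chart y z))) : letI := L.chartedSpace
    IsLocallyConstant I (M := X) (fun x => o (L.chart x x)) := by
  let _ := L.chartedSpace
  have := L.isManifold
  refine IsLocallyConstant.of_mfderiv hE ho fun x => ⟨L.chart x, (L.contMDiffAt_chart x).of_le
    (by simp), ?_⟩
  filter_upwards [(L.chart x).open_source.mem_nhds (L.mem_source x)] with z hz
  have h1 := (L.contMDiffAt z x z (L.mem_source z) hz).mdifferentiableAt (by simp)
  have h2 := h1.hasMFDerivAt.comp z (L.hasMFDerivAt_chart z)
  have h3 : L.chart x =ᶠ[𝓝 z] (L.chart x ∘ (L.chart z).symm) ∘ L.chart z := by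
    filter_upwards [(L.chart z).open_source.mem_nhds (L.mem_source z)] with y hy
    simp [(L.chart z).left_inv hy]
  have h4 := (h2.congr_of_eventuallyEq h3).mfderiv
  have h5 := hL z x z (L.mem_source z) hz
  have h6 : (mfderiv I I (L.chart x) z : E →L[ℝ] E) =
    (mfderiv I I (L.chart x ∘ (L.chart z).symm) (L.chart z z) : E →L[ℝ] E) := h4
  exact h6.symm ▸ h5

end LocalModel

end LocalModel

/-! ### The quotient of an open set by a partial involution. -/

section Gluing

/-- An involution `φ` of an open subset `U` of an open subset `A` of `W`, without fixed points and
with closed graph in `A × A`, together with a closed set `Z` that meets all orbits in `A`. -/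
structure PartialInvolution (W : Type*) [TopologicalSpace W] where
  A : Set W
  U : Set W
  Z : Set W
  K : Set (W × W)
  φ : W → W
  isOpen : IsOpen A
  isOpen_U : IsOpen U
  subset : U ⊆ A
  continuousOn : ContinuousOn φ U
  mapsTo : ∀ w ∈ U, φ w ∈ U
  involutive : ∀ w ∈ U, φ (φ w) = w
  ne : ∀ w ∈ U, φ w ≠ w
  isClosed : IsClosed K
  mem_iff : ∀ a ∈ A, ∀ b ∈ A, (a, b) ∈ K ↔ a ∈ U ∧ b = φ a
  isClosed_Z : IsClosed Z
  Z_subset : Z ⊆ A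
  covers : ∀ a ∈ A, a ∈ Z ∨ a ∈ U ∧ φ a ∈ Z

namespace PartialInvolution

variable {W : Type u} [TopologicalSpace W] (G : PartialInvolution W)

/-- The orbit relation of a partial involution. -/
def setoid : Setoid G.A where
  r a b := a.1 = b.1 ∨ a.1 ∈ G.U ∧ b.1 = G.φ a.1
  iseqv := by
    refine ⟨fun a => Or.inl rfl, ?_, ?_⟩
    · rintro a b (h | ⟨h1, h2⟩)
      · exact Or.inl h.symm
      · exact Or.inr ⟨h2 ▸ G.mapsTo _ h1, by rw [h2, G.involutive _ h1]⟩
    · rintro a b c (h | ⟨h1, h2⟩) (h' | ⟨h3, h4⟩)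
      · exact Or.inl (h.trans h')
      · exact Or.inr ⟨h ▸ h3, h ▸ h4⟩
      · exact Or.inr ⟨h1, h' ▸ h2⟩
      · exact Or.inl (by rw [h4, h2, G.involutive _ h1])

/-- The space of orbits of a partial involution. -/
def Orbits : Type u := Quotient G.setoid

instance : TopologicalSpace G.Orbits := inferInstanceAs (TopologicalSpace (Quotient G.setoid))

/-- The orbit of a point. -/
def orbit (a : G.A) : G.Orbits := Quotient.mk G.setoid a

variable {G} in
theorem orbit_eq_iff {a b : G.A} : G.orbit a = G.orbit b ↔ a.1 = b.1 ∨ a.1 ∈ G.U ∧ b.1 = G.φ a.1 :=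
  Quotient.eq (r := G.setoid)

theorem isOpenQuotientMap_orbit : IsOpenQuotientMap G.orbit := by
  refine ⟨Quotient.mk_surjective, continuous_quot_mk, fun S hS => ?_⟩
  obtain ⟨S, hS' : IsOpen S, rfl⟩ := isOpen_induced_iff.1 hS
  -- The saturation of an open set is the set together with its translate by the involution, hence
  -- open.
  have h : G.orbit ⁻¹' (G.orbit '' (Subtype.val ⁻¹' S)) = Subtype.val ⁻¹' (S ∪ (G.U ∩ G.φ ⁻¹' S)) := by
    ext b
    constructor
    · rintro ⟨a, ha, hab⟩
      rcases orbit_eq_iff.1 hab.symm with h | ⟨h1, h2⟩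
      · left
        rw [h]
        exact ha
      · exact Or.inr ⟨h1, by rw [Set.mem_preimage, ← h2]; exact ha⟩
    · rintro (h | ⟨h1, h2⟩)
      · exact ⟨b, h, rfl⟩
      · exact ⟨⟨G.φ b, G.subset (G.mapsTo _ h1)⟩, h2, (orbit_eq_iff.2 (Or.inr ⟨h1, rfl⟩)).symm⟩
  refine isOpen_coinduced.2 ?_
  change IsOpen (G.orbit ⁻¹' (G.orbit '' (Subtype.val ⁻¹' S)))
  rw [h]
  exact (hS'.union (G.continuousOn.isOpen_inter_preimage G.isOpen_U hS')).preimage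
    continuous_subtype_val

/-- The quotient map is open and its kernel relation is the diagonal together with the closed set
`K`. -/
instance [T2Space W] : T2Space G.Orbits := by
  rw [t2Space_iff_of_isOpenQuotientMap G.isOpenQuotientMap_orbit]
  have h : {q : G.A × G.A | G.orbit q.1 = G.orbit q.2} =
      {q | q.1 = q.2} ∪ Prod.map Subtype.val Subtype.val ⁻¹' G.K := by
    ext ⟨a, b⟩
    simp only [Set.mem_ofPred_eq, orbit_eq_iff, Set.mem_union, Set.mem_preimage, Prod.map_apply,
      G.mem_iff a.1 a.2 b.1 b.2, Subtype.ext_iff]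
  rw [h]
  exact (isClosed_eq continuous_fst continuous_snd).union
    (G.isClosed.preimage (continuous_subtype_val.prodMap continuous_subtype_val))

/-- `A` itself need not be compact; the quotient is the image of the compact set `Z`. -/
instance [CompactSpace W] : CompactSpace G.Orbits := by
  have h : IsCompact (Subtype.val ⁻¹' G.Z : Set G.A) := by
    rw [Topology.IsEmbedding.subtypeVal.isCompact_iff, Subtype.image_preimage_coe,
      Set.inter_eq_right.2 G.Z_subset]
    exact G.isClosed_Z.isCompact
  refine ⟨?_⟩
  convert h.image G.isOpenQuotientMap_orbit.continuous
  refine (Set.eq_univ_of_forall fun x => ?_).symm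
  obtain ⟨a, rfl⟩ := G.isOpenQuotientMap_orbit.surjective x
  rcases G.covers a.1 a.2 with h1 | ⟨h1, h2⟩
  · exact ⟨a, h1, rfl⟩
  · exact ⟨⟨_, G.Z_subset h2⟩, h2, (orbit_eq_iff.2 (Or.inr ⟨h1, rfl⟩)).symm⟩

/-- Since φ has no fixed points and `K` is closed, each point has a neighborhood containing no two
distinct points of one orbit. There the open projection is injective, hence a local homeomorphism.
-/
theorem exists_chart (a : G.A) : ∃ e : OpenPartialHomeomorph G.Orbits W, G.orbit a ∈ e.source ∧
    e (G.orbit a) = a ∧ ∀ z ∈ e.source, ∃ h : e z ∈ G.A, G.orbit ⟨e z, h⟩ = z := by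
  have h1 : (a.1, a.1) ∉ G.K := by
    rw [G.mem_iff _ a.2 _ a.2]
    rintro ⟨h2, h3⟩
    exact G.ne _ h2 h3.symm
  obtain ⟨S, hS, haS⟩ : ∃ S : Set W, IsOpen S ∧ a.1 ∈ S ∧ ∀ b ∈ S, ∀ c ∈ S, (b, c) ∉ G.K := by
    have h2 := G.isClosed.isOpen_compl.mem_nhds h1
    rw [nhds_prod_eq, Filter.mem_prod_self_iff] at h2
    obtain ⟨t, ht, ht'⟩ := h2
    obtain ⟨S, hSt, hS, haS⟩ := mem_nhds_iff.1 ht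
    exact ⟨S, hS, haS, fun b hb c hc => ht' ⟨hSt hb, hSt hc⟩⟩
  have hinj : Set.InjOn G.orbit (Subtype.val ⁻¹' S) := by
    intro b hb c hc hbc
    rcases orbit_eq_iff.1 hbc with h | h
    · exact Subtype.ext h
    · exact absurd ((G.mem_iff _ b.2 _ c.2).2 h) (haS.2 _ hb _ hc)
  have hSA : IsOpen (Subtype.val ⁻¹' S : Set G.A) := hS.preimage continuous_subtype_val
  have : Nonempty G.A := ⟨a⟩
  set e₁ : OpenPartialHomeomorph G.A G.Orbits :=
    OpenPartialHomeomorph.ofContinuousOpenRestrict (hinj.toPartialEquiv)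
      G.isOpenQuotientMap_orbit.continuous.continuousOn
      (G.isOpenQuotientMap_orbit.isOpenMap.domRestrict hSA) hSA with he₁
  set e₂ : OpenPartialHomeomorph G.A W :=
    (G.isOpen.isOpenEmbedding_subtypeVal).toOpenPartialHomeomorph with he₂
  have hs : e₁.source = Subtype.val ⁻¹' S := rfl
  have hm : ∀ b, e₁ b = G.orbit b := fun b => rfl
  refine ⟨e₁.symm ≫ₕ e₂, ?_, ?_, ?_⟩
  · simp only [mfld_simps, he₂]
    exact e₁.map_source (x := a) haS.1
  · have := e₁.left_inv (x := a) haS.1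
    rw [hm] at this
    simp [he₂, this]
  · intro z hz
    simp only [mfld_simps, he₂] at hz
    refine ⟨(e₁.symm z).2, ?_⟩
    exact e₁.right_inv hz

/-- A local inverse of the projection to the space of orbits. -/
def chart (x : G.Orbits) : OpenPartialHomeomorph G.Orbits W :=
  (G.exists_chart (Quotient.out x)).choose

theorem mem_chart_source (x : G.Orbits) : x ∈ (G.chart x).source := by
  have h := (G.exists_chart (Quotient.out x)).choose_spec.1
  exact Eq.subst (motive := fun y => y ∈ (G.chart x).source)
    (show G.orbit (Quotient.out x) = x from Quotient.out_eq x) h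

theorem chart_mem (x : G.Orbits) {z : G.Orbits} (hz : z ∈ (G.chart x).source) :
    G.chart x z ∈ G.A :=
  ((G.exists_chart (Quotient.out x)).choose_spec.2.2 z hz).choose

theorem orbit_chart (x : G.Orbits) {z : G.Orbits} (hz : z ∈ (G.chart x).source) :
    G.orbit ⟨G.chart x z, G.chart_mem x hz⟩ = z :=
  ((G.exists_chart (Quotient.out x)).choose_spec.2.2 z hz).choose_spec

/-- Outside `U` an orbit is a single point, so no choice of representative enters. This is what
keeps the surviving boundary unchanged. -/
theorem chart_orbit (x : G.Orbits) {a : G.A} (ha : G.orbit a ∈ (G.chart x).source) (hU : a.1 ∉ G.U) :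
    G.chart x (G.orbit a) = a := by
  rcases orbit_eq_iff.1 (G.orbit_chart x ha).symm with h | h
  · exact h.symm
  · exact absurd h.1 hU

/-- A transition map sends each point to itself or to its image under φ. Because `K` is closed and
avoids the diagonal of `A`, the two alternatives cannot mix near a point. -/
theorem transition (x y z : G.Orbits) (hx : z ∈ (G.chart x).source)
    (hy : z ∈ (G.chart y).source) :
    G.chart y ∘ (G.chart x).symm =ᶠ[𝓝 (G.chart x z)] id ∨
      G.chart x z ∈ G.U ∧ G.chart y ∘ (G.chart x).symm =ᶠ[𝓝 (G.chart x z)] G.φ := by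
  set w := G.chart x z with hw
  have hwA : w ∈ G.A := G.chart_mem x hx
  have hwt : w ∈ (G.chart x).target := (G.chart x).map_source hx
  have hsw : (G.chart x).symm w = z := (G.chart x).left_inv hx
  have hcs : ContinuousAt (G.chart x).symm w := (G.chart x).continuousAt_symm hwt
  have hcy : ContinuousAt (G.chart y) ((G.chart x).symm w) := by
    rw [hsw]
    exact (G.chart y).continuousAt hy
  have hcT : ContinuousAt (G.chart y ∘ (G.chart x).symm) w := hcy.comp hcs
  have hTw : (G.chart y ∘ (G.chart x).symm) w = G.chart y z := by
    rw [Function.comp_apply, hsw]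
  have hrel : ∀ᶠ w' in 𝓝 w, w' ∈ G.A ∧ (G.chart y ∘ (G.chart x).symm) w' ∈ G.A ∧
      (w' = (G.chart y ∘ (G.chart x).symm) w' ∨
        w' ∈ G.U ∧ (G.chart y ∘ (G.chart x).symm) w' = G.φ w') := by
    have h1 : ∀ᶠ w' in 𝓝 w, (G.chart x).symm w' ∈ (G.chart y).source :=
      hcs.eventually ((G.chart y).open_source.mem_nhds (by rwa [hsw]))
    filter_upwards [(G.chart x).open_target.mem_nhds hwt, h1, G.isOpen.mem_nhds hwA] with w' h2 h3 h4
    refine ⟨h4, G.chart_mem y h3, ?_⟩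
    have h5 := (G.orbit_chart x ((G.chart x).map_target h2)).trans (G.orbit_chart y h3).symm
    have h6 := orbit_eq_iff.1 h5
    simp only [(G.chart x).right_inv h2] at h6
    exact h6
  have hnot : ∀ a ∈ G.A, (a, a) ∉ G.K := fun a ha => by
    rw [G.mem_iff _ ha _ ha]
    rintro ⟨h2, h3⟩
    exact G.ne _ h2 h3.symm
  obtain ⟨-, hTA, h | ⟨h1, h2⟩⟩ := hrel.self_of_nhds
  · left
    have h3 : ∀ᶠ w' in 𝓝 w, (w', (G.chart y ∘ (G.chart x).symm) w') ∉ G.K := by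
      refine (continuousAt_id.prodMk hcT).eventually (G.isClosed.isOpen_compl.mem_nhds ?_)
      change (w, (G.chart y ∘ (G.chart x).symm) w) ∉ G.K
      rw [← h]
      exact hnot w hwA
    filter_upwards [hrel, h3] with w' h4 h5
    rcases h4.2.2 with h6 | h6
    · exact h6.symm
    · exact absurd ((G.mem_iff _ h4.1 _ h4.2.1).2 h6) h5
  · right
    refine ⟨h1, ?_⟩
    -- At `w` the pair is diagonal, hence outside `K`. If the transition fixed a nearby `w'`, the
    -- pair would be (φ w', w'), which lies in `K`.
    have h3 : ∀ᶠ w' in 𝓝 w, (G.φ w', (G.chart y ∘ (G.chart x).symm) w') ∉ G.K := by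
      refine ((G.continuousOn.continuousAt (G.isOpen_U.mem_nhds h1)).prodMk hcT).eventually
        (G.isClosed.isOpen_compl.mem_nhds ?_)
      change (G.φ w, (G.chart y ∘ (G.chart x).symm) w) ∉ G.K
      rw [h2]
      exact hnot _ (G.subset (G.mapsTo _ h1))
    filter_upwards [hrel, h3, G.isOpen_U.mem_nhds h1] with w' h4 h5 h7
    rcases h4.2.2 with h6 | h6
    · exfalso
      refine h5 ((G.mem_iff _ (G.subset (G.mapsTo _ h7)) _ h4.2.1).2 ⟨G.mapsTo _ h7, ?_⟩)
      rw [← h6, G.involutive _ h7]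
    · exact h6.2

end PartialInvolution

end Gluing

/-! ### The gluing involution of a collar. -/

section CollarFlip

variable {n : ℕ} {W : CompactOrientedManifoldWithBoundary.{u} n}
  {P : ClosedOrientedManifold.{u} n} {ι : P.carrier → W.carrier}

theorem hasMFDerivAt_prodMap_sub {τ : P.carrier → P.carrier} (hτ : ContMDiff (𝓡 n) (𝓡 n) ∞ τ)
    (δ : ℝ) (y : P.carrier × ℝ) :
    HasMFDerivAt ((𝓡 n).prod 𝓘(ℝ, ℝ)) ((𝓡 n).prod 𝓘(ℝ, ℝ)) (Prod.map τ (fun t => δ - t)) y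
      ((mfderiv (𝓡 n) (𝓡 n) τ y.1 : EuclideanSpace ℝ (Fin n) →L[ℝ] EuclideanSpace ℝ (Fin n)).prodMap
        (-ContinuousLinearMap.id ℝ ℝ)) := by
  have h1 : HasMFDerivAt (𝓡 n) (𝓡 n) τ y.1 (mfderiv (𝓡 n) (𝓡 n) τ y.1) :=
    ((hτ y.1).mdifferentiableAt (by simp)).hasMFDerivAt
  have h2 : HasMFDerivAt 𝓘(ℝ, ℝ) 𝓘(ℝ, ℝ) (fun t : ℝ => δ - t) y.2
      (-ContinuousLinearMap.id ℝ ℝ) :=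
    (HasFDerivAt.const_sub (hasFDerivAt_id y.2) δ).hasMFDerivAt
  have h := HasMFDerivAt.prodMap (p := y) h1 h2
  rw [h2.mfderiv] at h
  exact h

/-- The involution of a collar that reflects the collar parameter and applies an orientation
reversing involution of the boundary preserves the orientation. -/
theorem IsCollar.carriesOrientation_flip (h : IsOrientedBoundaryMap W P ι)
    {r : W.carrier → P.carrier} {f : W.carrier → ℝ} {ε : ℝ} {O : Set W.carrier}
    {c : P.carrier × ℝ → W.carrier} (hc : IsCollar n ι r f ε O c)
    {τ : P.carrier → P.carrier} (hτ : ContMDiff (𝓡 n) (𝓡 n) ∞ τ) {δ : ℝ} {φ : W.carrier → W.carrier}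
    {w : W.carrier} (hw : w ∈ O) (hφw : φ w ∈ O)
    (ho : CarriesOrientation (mfderiv (𝓡 n) (𝓡 n) τ (r w)).toLinearMap (P.orientation (r w))
      (-P.orientation (τ (r w))))
    (hφ : ContMDiffAt (𝓡∂ (n + 1)) (𝓡∂ (n + 1)) ∞ φ w)
    (hφe : ∀ᶠ w' in 𝓝 w, (r (φ w'), f (φ w')) = (τ (r w'), δ - f w')) :
    CarriesOrientation (mfderiv (𝓡∂ (n + 1)) (𝓡∂ (n + 1)) φ w).toLinearMap
      (W.orientation w) (W.orientation (φ w)) := by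
  set Φ : W.carrier → P.carrier × ℝ := fun w => (r w, f w) with hΦ
  have h1 := hc.carriesOrientation h hw
  have h2 := hc.carriesOrientation h hφw
  set A : EuclideanSpace ℝ (Fin (n + 1)) →L[ℝ] EuclideanSpace ℝ (Fin n) × ℝ :=
    mfderiv (𝓡∂ (n + 1)) ((𝓡 n).prod 𝓘(ℝ, ℝ)) Φ w with hA
  set A' : EuclideanSpace ℝ (Fin (n + 1)) →L[ℝ] EuclideanSpace ℝ (Fin n) × ℝ :=
    mfderiv (𝓡∂ (n + 1)) ((𝓡 n).prod 𝓘(ℝ, ℝ)) Φ (φ w) with hA'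
  set B : EuclideanSpace ℝ (Fin (n + 1)) →L[ℝ] EuclideanSpace ℝ (Fin (n + 1)) :=
    mfderiv (𝓡∂ (n + 1)) (𝓡∂ (n + 1)) φ w with hB
  set T : EuclideanSpace ℝ (Fin n) →L[ℝ] EuclideanSpace ℝ (Fin n) :=
    mfderiv (𝓡 n) (𝓡 n) τ (r w) with hT
  have hAd : HasMFDerivAt (𝓡∂ (n + 1)) ((𝓡 n).prod 𝓘(ℝ, ℝ)) Φ w A :=
    ((hc.contMDiffAt _ hw).mdifferentiableAt (by simp)).hasMFDerivAt
  have hAd' : HasMFDerivAt (𝓡∂ (n + 1)) ((𝓡 n).prod 𝓘(ℝ, ℝ)) Φ (φ w) A' :=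
    ((hc.contMDiffAt _ hφw).mdifferentiableAt (by simp)).hasMFDerivAt
  have hBd : HasMFDerivAt (𝓡∂ (n + 1)) (𝓡∂ (n + 1)) φ w B :=
    (hφ.mdifferentiableAt (by simp)).hasMFDerivAt
  have h3 : HasMFDerivAt (𝓡∂ (n + 1)) ((𝓡 n).prod 𝓘(ℝ, ℝ)) (Φ ∘ φ) w (A' ∘L B) :=
    hAd'.comp w hBd
  have h4 : HasMFDerivAt (𝓡∂ (n + 1)) ((𝓡 n).prod 𝓘(ℝ, ℝ)) (Prod.map τ (fun t => δ - t) ∘ Φ) w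
      (T.prodMap (-ContinuousLinearMap.id ℝ ℝ) ∘L A) :=
    (hasMFDerivAt_prodMap_sub hτ δ (Φ w)).comp w hAd
  -- In collar coordinates φ is τ times the reflection. The collar differentials at `w` and `φ w`
  -- introduce the same sign, so it drops out.
  have h5 : A' ∘L B = T.prodMap (-ContinuousLinearMap.id ℝ ℝ) ∘L A :=
    hasMFDerivAt_unique (h3.congr_of_eventuallyEq (hφe.mono fun _ h => h.symm)) h4
  have hstab : CarriesOrientation (T.prodMap (-ContinuousLinearMap.id ℝ ℝ)).toLinearMap
      (-stabilizeEuclidean n (P.orientation (r w)))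
      (-stabilizeEuclidean n (P.orientation (τ (r w)))) :=
    CarriesOrientation.neg (CarriesOrientation.stabilize_neg (V := EuclideanSpace ℝ (Fin n))
      (W := EuclideanSpace ℝ (Fin n)) (by simp) (by simp) ho)
  have h6 : r (φ w) = τ (r w) := congrArg Prod.fst hφe.self_of_nhds
  have h7 : ∀ y, y = τ (r w) → CarriesOrientation A'.toLinearMap (W.orientation (φ w))
      (-stabilizeEuclidean n (P.orientation y)) → CarriesOrientation A'.toLinearMap
      (W.orientation (φ w)) (-stabilizeEuclidean n (P.orientation (τ (r w)))) := by
    rintro _ rfl h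
    exact h
  have h8 : CarriesOrientation (A' ∘L B).toLinearMap (W.orientation w)
      (-stabilizeEuclidean n (P.orientation (τ (r w)))) := by
    rw [h5]
    exact hstab.comp h1
  exact CarriesOrientation.of_comp_right (L' := A'.toLinearMap) (L := B.toLinearMap) h8 (h7 _ h6 h2)

/-- Over `C` the collar is folded by (x, t) ↦ (τ x, δ - t). It has no fixed points because τ has
none, not even at height δ / 2, and it exchanges the two ends of (0, δ), so that after removal of `ι
'' C` no boundary remains over `C`. -/
theorem IsOrientedBoundaryMap.exists_partialInvolution [Nonempty P.carrier]
    (h : IsOrientedBoundaryMap W P ι) {C : Set P.carrier} (hC : IsClopen C)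
    {τ : P.carrier → P.carrier} (hτ : ContMDiff (𝓡 n) (𝓡 n) ∞ τ) (hτC : ∀ x ∈ C, τ x ∈ C)
    (hττ : ∀ x ∈ C, τ (τ x) = x) (hne : ∀ x ∈ C, τ x ≠ x)
    (ho : ∀ x ∈ C, CarriesOrientation (mfderiv (𝓡 n) (𝓡 n) τ x).toLinearMap (P.orientation x)
      (-P.orientation (τ x))) :
    ∃ G : PartialInvolution W.carrier, G.A = (ι '' C)ᶜ ∧
      (∀ w ∈ G.U, (𝓡∂ (n + 1)).IsInteriorPoint w) ∧
      ∀ w ∈ G.U, ContMDiffAt (𝓡∂ (n + 1)) (𝓡∂ (n + 1)) ∞ G.φ w ∧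
        CarriesOrientation (mfderiv (𝓡∂ (n + 1)) (𝓡∂ (n + 1)) G.φ w).toLinearMap
          (W.orientation w) (W.orientation (G.φ w)) := by
  obtain ⟨r, f, ε, O, c, hc⟩ := h.isBoundaryEmbedding.exists_isCollar
  have hε := hc.pos
  -- Any 0 < δ < ε works: the closed range [0, δ] must lie in the domain [0, ε) of the collar.
  set δ := ε / 2 with hδ
  have hδ0 : 0 < δ := half_pos hε
  have hδε : δ < ε := half_lt_self hε
  have hr : ∀ x, ∀ t ∈ Set.Ico 0 ε, r (c (x, t)) = x := fun x t ht =>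
    congrArg Prod.fst (hc.right_inv x t ht)
  have hf : ∀ x, ∀ t ∈ Set.Ico 0 ε, f (c (x, t)) = t := fun x t ht =>
    congrArg Prod.snd (hc.right_inv x t ht)
  have hΦ : ContinuousOn (fun w => (r w, f w)) O := fun w hw =>
    (hc.contMDiffAt w hw).continuousAt.continuousWithinAt
  have hopen : ∀ s : Set (P.carrier × ℝ), IsOpen s → IsOpen {w | w ∈ O ∧ (r w, f w) ∈ s} :=
    fun s hs => hΦ.isOpen_inter_preimage hc.isOpen hs
  set U : Set W.carrier := {w | w ∈ O ∧ (r w, f w) ∈ C ×ˢ Set.Ioo 0 δ} with hU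
  -- The outer half of the folded region. A point of it with positive height is sent above δ / 2, so
  -- the complement of `S` meets every orbit and avoids the deleted boundary.
  set S : Set W.carrier := {w | w ∈ O ∧ (r w, f w) ∈ C ×ˢ Set.Iio (δ / 2)} with hS
  set φ : W.carrier → W.carrier := fun w => c (τ (r w), δ - f w) with hφ
  have hIco : ∀ w ∈ U, δ - f w ∈ Set.Ico 0 ε := by
    rintro w ⟨-, -, h1, h2⟩
    simp only at h1 h2
    constructor <;> linarith
  have hmaps : ∀ w ∈ U, φ w ∈ U := by
    intro w hw
    refine ⟨hc.mem _ _ (hIco w hw), ?_⟩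
    simp only [hφ]
    rw [hc.right_inv _ _ (hIco w hw)]
    obtain ⟨-, h0, h1, h2⟩ := hw
    simp only at h0 h1 h2
    exact ⟨hτC _ h0, by simp only; linarith, by simp only; linarith⟩
  have hsm : ∀ w ∈ U, ContMDiffAt (𝓡∂ (n + 1)) (𝓡∂ (n + 1)) ∞ φ w := by
    rintro w ⟨hwO, h0, h1, h2⟩
    simp only at h0 h1 h2
    have h3 : ContMDiffAt (𝓡∂ (n + 1)) ((𝓡 n).prod 𝓘(ℝ, ℝ)) ∞
        (Prod.map τ (fun t => δ - t) ∘ fun w => (r w, f w)) w := by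
      refine ContMDiffAt.comp w (ContMDiff.prodMap hτ ?_).contMDiffAt (hc.contMDiffAt w hwO)
      exact (contDiff_const.sub contDiff_id).contMDiff
    exact ContMDiffAt.comp w (hc.contMDiffAt_symm (τ (r w)) (δ - f w) ⟨by linarith, by linarith⟩) h3
  have hUo : IsOpen U := hopen _ (hC.isOpen.prod isOpen_Ioo)
  have hιC : ∀ w ∈ O, r w ∈ C → f w = 0 → w ∈ ι '' C := by
    intro w hw h1 h2
    refine ⟨r w, h1, ?_⟩
    rw [← hc.zero, ← h2, hc.left_inv w hw]
  have hfι : ∀ x, f (ι x) = 0 := fun x => by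
    rw [← hc.zero]
    exact hf x 0 ⟨le_rfl, hε⟩
  have hιO : ∀ x, ι x ∈ O := fun x => by
    rw [← hc.zero]
    exact hc.mem x 0 ⟨le_rfl, hε⟩
  have hrι : ∀ x, r (ι x) = x := fun x => by
    rw [← hc.zero]
    exact hr x 0 ⟨le_rfl, hε⟩
  have hc1 : ContinuousOn (fun p : P.carrier × ℝ => c p) (C ×ˢ Set.Icc 0 δ) :=
    hc.continuousOn.mono fun p hp => ⟨trivial, hp.2.1, hp.2.2.trans_lt hδε⟩
  have hc2 : ContinuousOn (fun p : P.carrier × ℝ => c (τ p.1, δ - p.2)) (C ×ˢ Set.Icc 0 δ) := by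
    refine hc.continuousOn.comp (f := fun p : P.carrier × ℝ => (τ p.1, δ - p.2)) ?_
      fun p hp => ⟨trivial, ?_⟩
    · have := hτ.continuous
      fun_prop
    · obtain ⟨-, h1, h2⟩ := hp
      exact ⟨sub_nonneg.2 h2, (sub_le_self δ h1).trans_lt hδε⟩
  refine ⟨
    { A := (ι '' C)ᶜ
      U := U
      Z := Sᶜ
      -- Including the heights 0 and δ makes this set compact. The extra pairs each contain a point
      -- of `ι '' C`, so they do not meet `A × A`.
      K := (fun p : P.carrier × ℝ => (c p, c (τ p.1, δ - p.2))) '' (C ×ˢ Set.Icc 0 δ)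
      φ := φ
      isOpen := (hC.isClosed.isCompact.image h.contMDiff.continuous).isClosed.isOpen_compl
      isOpen_U := hUo
      subset := ?_
      continuousOn := fun w hw => (hsm w hw).continuousAt.continuousWithinAt
      mapsTo := hmaps
      involutive := ?_
      ne := ?_
      isClosed := ((hC.isClosed.isCompact.prod isCompact_Icc).image_of_continuousOn
        (hc1.prodMk hc2)).isClosed
      mem_iff := ?_
      isClosed_Z := (hopen _ (hC.isOpen.prod isOpen_Iio)).isClosed_compl
      Z_subset := ?_
      covers := ?_ }, rfl, ?_, ?_⟩
  · rintro w hw ⟨x, hx, rfl⟩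
    have h1 := hw.2.2.1
    simp only [hfι] at h1
    exact lt_irrefl _ h1
  · intro w hw
    simp only [hφ]
    rw [hr _ _ (hIco w hw), hf _ _ (hIco w hw), sub_sub_cancel, hττ _ hw.2.1]
    exact hc.left_inv w hw.1
  · intro w hw h1
    apply hne _ hw.2.1
    conv_rhs => rw [← h1]
    exact (hr _ _ (hIco w hw)).symm
  · intro a ha b hb
    constructor
    · rintro ⟨⟨x, t⟩, ⟨hx, ht⟩, hab⟩
      simp only [Prod.mk.injEq] at hab hx ht
      obtain ⟨rfl, rfl⟩ := hab
      have ht0 : t ≠ 0 := by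
        rintro rfl
        exact ha ⟨x, hx, (hc.zero x).symm⟩
      have ht1 : t ≠ δ := by
        rintro rfl
        rw [sub_self] at hb
        exact hb ⟨τ x, hτC x hx, (hc.zero _).symm⟩
      have ht' : t ∈ Set.Ico 0 ε := ⟨ht.1, ht.2.trans_lt hδε⟩
      refine ⟨⟨hc.mem x t ht', ?_⟩, ?_⟩
      · rw [hc.right_inv x t ht']
        exact ⟨hx, lt_of_le_of_ne ht.1 ht0.symm, lt_of_le_of_ne ht.2 ht1⟩
      · simp only [hφ]
        rw [hr x t ht', hf x t ht']
    · rintro ⟨h1, rfl⟩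
      refine ⟨(r a, f a), ⟨h1.2.1, h1.2.2.1.le, h1.2.2.2.le⟩, ?_⟩
      simp only [hφ]
      rw [hc.left_inv a h1.1]
  · rintro w hw ⟨x, hx, rfl⟩
    refine hw ⟨hιO x, ?_⟩
    rw [hrι, hfι]
    exact ⟨hx, by simpa using hδ0⟩
  · intro a ha
    by_cases hZ : a ∈ S
    · right
      obtain ⟨h1, h2, h3⟩ := hZ
      simp only [Set.mem_Iio] at h2 h3
      have h4 := (hc.mem_Ico a h1).1
      have haU : a ∈ U := by
        refine ⟨h1, h2, lt_of_le_of_ne h4 fun h5 => ha (hιC a h1 h2 h5.symm), ?_⟩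
        simp only
        linarith
      refine ⟨haU, fun h5 => ?_⟩
      have h6 := h5.2.2
      simp only [hφ, Set.mem_Iio] at h6
      rw [hf _ _ (hIco a haU)] at h6
      linarith
    · exact Or.inl hZ
  · exact fun w hw => hc.isInteriorPoint w hw.1 hw.2.2.1
  · intro w hw
    refine ⟨hsm w hw, hc.carriesOrientation_flip h hτ (δ := δ) hw.1 (hmaps w hw).1 (ho _ hw.2.1)
      (hsm w hw) ?_⟩
    filter_upwards [hUo.mem_nhds hw] with w' hw'
    exact hc.right_inv _ _ (hIco w' hw')

end CollarFlip

/-! ### The glued oriented manifold and its boundary. -/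

section GluedManifold

variable {n : ℕ} {W : CompactOrientedManifoldWithBoundary.{u} n}

/-- The local model of the space of orbits of a smooth partial involution. -/
def PartialInvolution.localModel (G : PartialInvolution W.carrier)
    (hG : ∀ w ∈ G.U, ContMDiffAt (𝓡∂ (n + 1)) (𝓡∂ (n + 1)) ∞ G.φ w) :
    LocalModel (𝓡∂ (n + 1)) G.Orbits W.carrier where
  chart := G.chart
  mem_source := G.mem_chart_source
  contMDiffAt x y z hx hy := by
    rcases G.transition x y z hx hy with h | ⟨h1, h⟩
    · exact contMDiffAt_id.congr_of_eventuallyEq h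
    · exact (hG _ h1).congr_of_eventuallyEq h

/-- The oriented manifold of orbits of an orientation preserving partial involution. -/
def PartialInvolution.manifold (G : PartialInvolution W.carrier)
    (hG : ∀ w ∈ G.U, ContMDiffAt (𝓡∂ (n + 1)) (𝓡∂ (n + 1)) ∞ G.φ w ∧
        CarriesOrientation (mfderiv (𝓡∂ (n + 1)) (𝓡∂ (n + 1)) G.φ w).toLinearMap
          (W.orientation w) (W.orientation (G.φ w))) :
    CompactOrientedManifoldWithBoundary.{u} n where
  carrier := G.Orbits
  chartedSpace := (G.localModel fun w hw => (hG w hw).1).chartedSpace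
  isManifold := (G.localModel fun w hw => (hG w hw).1).isManifold
  orientation x := W.orientation (G.chart x x)
  isLocallyConstant := by
    refine (G.localModel fun w hw => (hG w hw).1).isLocallyConstant (by simp) W.isLocallyConstant
      fun x y z hx hy => ?_
    change CarriesOrientation (mfderiv (𝓡∂ (n + 1)) (𝓡∂ (n + 1)) (G.chart y ∘ (G.chart x).symm)
      (G.chart x z)).toLinearMap (W.orientation (G.chart x z)) (W.orientation (G.chart y z))
    -- Only the germ of the transition matters, so it may be replaced by the identity or by φ.
    have hT : ∀ g : W.carrier → W.carrier,
        G.chart y ∘ (G.chart x).symm =ᶠ[𝓝 (G.chart x z)] g →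
        CarriesOrientation (mfderiv (𝓡∂ (n + 1)) (𝓡∂ (n + 1)) g (G.chart x z)).toLinearMap
          (W.orientation (G.chart x z)) (W.orientation (g (G.chart x z))) →
        CarriesOrientation (mfderiv (𝓡∂ (n + 1)) (𝓡∂ (n + 1)) (G.chart y ∘ (G.chart x).symm)
          (G.chart x z)).toLinearMap (W.orientation (G.chart x z))
            (W.orientation (G.chart y z)) := by
      intro g hg h
      have h1 := hg.self_of_nhds
      rw [Function.comp_apply, (G.chart x).left_inv hx] at h1
      have h2 : ∀ w, w = g (G.chart x z) → CarriesOrientation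
          (mfderiv (𝓡∂ (n + 1)) (𝓡∂ (n + 1)) g (G.chart x z) :
            EuclideanSpace ℝ (Fin (n + 1)) →L[ℝ] EuclideanSpace ℝ (Fin (n + 1))).toLinearMap
          (W.orientation (G.chart x z)) (W.orientation w) := by
        rintro _ rfl
        exact h
      have h3 : (mfderiv (𝓡∂ (n + 1)) (𝓡∂ (n + 1)) (G.chart y ∘ (G.chart x).symm)
          (G.chart x z) : EuclideanSpace ℝ (Fin (n + 1)) →L[ℝ] EuclideanSpace ℝ (Fin (n + 1))) =
          (mfderiv (𝓡∂ (n + 1)) (𝓡∂ (n + 1)) g (G.chart x z) :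
            EuclideanSpace ℝ (Fin (n + 1)) →L[ℝ] EuclideanSpace ℝ (Fin (n + 1))) :=
        hg.mfderiv_eq
      exact h3.symm ▸ h2 _ h1
    rcases G.transition x y z hx hy with h | ⟨h1, h⟩
    · refine hT _ h ?_
      rw [mfderiv_id]
      exact CarriesOrientation.id _
    · exact hT _ h (hG _ h1).2

/-- The part `V` of the boundary lies in `A` but outside `U`, so the charts of the quotient return
it unchanged. Differentials, outward vectors and orientations along `V` are therefore the old ones.
-/
theorem PartialInvolution.isOrientedBoundary_manifold {V N : ClosedOrientedManifold.{u} n}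
    {ι : (V.disjointUnion N).carrier → W.carrier}
    (h : IsOrientedBoundaryMap W (V.disjointUnion N) ι) (G : PartialInvolution W.carrier)
    (hG : ∀ w ∈ G.U, ContMDiffAt (𝓡∂ (n + 1)) (𝓡∂ (n + 1)) ∞ G.φ w ∧
        CarriesOrientation (mfderiv (𝓡∂ (n + 1)) (𝓡∂ (n + 1)) G.φ w).toLinearMap
          (W.orientation w) (W.orientation (G.φ w)))
    (hA : G.A = (ι '' Set.range Sum.inr)ᶜ) (hU : ∀ w ∈ G.U, (𝓡∂ (n + 1)).IsInteriorPoint w) :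
    IsOrientedBoundary (G.manifold hG) V := by
  set L := G.localModel fun w hw => (hG w hw).1 with hL
  set j : V.carrier → W.carrier := fun x => ι (Sum.inl x) with hj
  have hjA : ∀ x, j x ∈ G.A := by
    rw [hA]
    rintro x ⟨_, ⟨y, rfl⟩, hy⟩
    exact Sum.inr_ne_inl (h.isEmbedding.injective hy)
  have hjb : ∀ x, j x ∈ (𝓡∂ (n + 1)).boundary W.carrier := fun x => by
    rw [← h.range_eq]
    exact ⟨_, rfl⟩
  have hjU : ∀ x, j x ∉ G.U := fun x hx =>
    ((𝓡∂ (n + 1)).isInteriorPoint_iff_not_isBoundaryPoint _).1 (hU _ hx) (hjb x)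
  set k : V.carrier → G.Orbits := fun x => G.orbit ⟨j x, hjA x⟩ with hk
  have hjd : ∀ x, HasMFDerivAt (𝓡 n) (𝓡∂ (n + 1)) j x
      (mfderiv (𝓡 n) (𝓡∂ (n + 1)) ι (Sum.inl x) :
        EuclideanSpace ℝ (Fin n) →L[ℝ] EuclideanSpace ℝ (Fin (n + 1))) := fun x => by
    have h1 : HasMFDerivAt (𝓡 n) (𝓡∂ (n + 1)) ι (Sum.inl x) _ :=
      ((h.contMDiff (Sum.inl x)).mdifferentiableAt (by simp)).hasMFDerivAt
    have h2 : HasMFDerivAt (𝓡 n) (𝓡 n) (M' := (V.disjointUnion N).carrier) Sum.inl x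
        (ContinuousLinearMap.id ℝ (EuclideanSpace ℝ (Fin n))) :=
      hasMFDerivAt_inl (p := (Sum.inl x : V.carrier ⊕ N.carrier))
    exact h1.comp x h2
  have hjs : ContMDiff (𝓡 n) (𝓡∂ (n + 1)) ∞ j :=
    ContMDiff.comp (f := (Sum.inl : V.carrier → V.carrier ⊕ N.carrier)) h.contMDiff ContMDiff.inl
  have hkc : Continuous k :=
    G.isOpenQuotientMap_orbit.continuous.comp (hjs.continuous.subtype_mk hjA)
  have hch : ∀ x y, k x ∈ (G.chart y).source → G.chart y (k x) = j x := fun x y hx =>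
    G.chart_orbit y hx (hjU x)
  have hkinj : Function.Injective k := by
    intro x y hxy
    rcases G.orbit_eq_iff.1 hxy with h1 | h1
    · exact Sum.inl_injective (h.isEmbedding.injective h1)
    · exact absurd h1.1 (hjU x)
  have hkd : ∀ x, HasMFDerivAt (𝓡 n) (𝓡∂ (n + 1)) (M' := (G.manifold hG).carrier) k x
      (mfderiv (𝓡 n) (𝓡∂ (n + 1)) ι (Sum.inl x) :
        EuclideanSpace ℝ (Fin n) →L[ℝ] EuclideanSpace ℝ (Fin (n + 1))) := fun x =>
    L.hasMFDerivAt_of_chart_comp hkc.continuousAt (Eventually.of_forall fun y => hch y _) (hjd x)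
  refine ⟨k, ⟨fun x => ?_, ?_, fun x => ?_, ?_, ?_⟩⟩
  · exact L.contMDiffAt_of_chart_comp hkc.continuousAt (Eventually.of_forall fun y => hch y _)
      (hjs x)
  · exact (hkc.isClosedEmbedding hkinj).isEmbedding
  · have h1 := h.injective_mfderiv (Sum.inl x)
    have h2 : (mfderiv (𝓡 n) (𝓡∂ (n + 1)) (M' := (G.manifold hG).carrier) k x :
        EuclideanSpace ℝ (Fin n) →L[ℝ] EuclideanSpace ℝ (Fin (n + 1))) = _ := (hkd x).mfderiv
    exact h2 ▸ h1
  · ext z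
    have hz := G.mem_chart_source z
    -- The preferred chart at `z` factors through that of `W` at `G.chart z z`, so the two boundary
    -- conditions coincide by definition.
    have key : z ∈ (𝓡∂ (n + 1)).boundary (G.manifold hG).carrier ↔
        G.chart z z ∈ (𝓡∂ (n + 1)).boundary W.carrier := Iff.rfl
    rw [key, ← h.range_eq]
    constructor
    · rintro ⟨x, rfl⟩
      exact ⟨Sum.inl x, (hch x _ hz).symm⟩
    · rintro ⟨x | x, hx⟩
      · refine ⟨x, ?_⟩
        rw [← G.orbit_chart z hz]
        exact G.orbit_eq_iff.2 (Or.inl hx)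
      · have h1 := G.chart_mem z hz
        rw [hA] at h1
        exact absurd ⟨_, ⟨x, rfl⟩, hx⟩ h1
  · intro x v hv b b' hb0 hbs
    have h1 : (mfderiv (𝓡 n) (𝓡∂ (n + 1)) (M' := (G.manifold hG).carrier) k x :
        EuclideanSpace ℝ (Fin n) →L[ℝ] EuclideanSpace ℝ (Fin (n + 1))) = _ := (hkd x).mfderiv
    have h2 := (isOutward_iff (W := G.manifold hG) _ v).1 hv
    have h3 := h.orientation_iff (Sum.inl x) v ((isOutward_iff _ _).2 h2) b b' hb0
      fun i => (hbs i).trans (DFunLike.congr_fun h1 (b i))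
    have h4 : ((G.manifold hG).orientation (k x) :
        Orientation ℝ (EuclideanSpace ℝ (Fin (n + 1))) (Fin (n + 1))) = W.orientation (j x) := by
      have h5 : ∀ w w' : W.carrier, w = w' → (W.orientation w :
        Orientation ℝ (EuclideanSpace ℝ (Fin (n + 1))) (Fin (n + 1))) = W.orientation w' := by
        rintro w _ rfl
        rfl
      exact h5 _ _ (hch x _ (G.mem_chart_source _))
    have h6 : ∀ o o' o'' : Orientation ℝ (EuclideanSpace ℝ (Fin (n + 1))) (Fin (n + 1)),
        o' = o'' → (o = o'' ↔ o = o') := by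
      rintro _ _ _ rfl
      rfl
    exact h3.trans (h6 _ _ _ h4)

/-- If the disjoint union of `V` and of an oriented manifold `N` with an orientation reversing
involution without fixed points is an oriented boundary, then so is `V`. -/
theorem IsOrientedBoundary.of_disjointUnion {V N : ClosedOrientedManifold.{u} n}
    (h : IsOrientedBoundary W (V.disjointUnion N)) [Nonempty N.carrier] {τ : N.carrier → N.carrier}
    (hτ : ContMDiff (𝓡 n) (𝓡 n) ∞ τ) (hττ : ∀ x, τ (τ x) = x) (hne : ∀ x, τ x ≠ x)
    (ho : ∀ x, CarriesOrientation (mfderiv (𝓡 n) (𝓡 n) τ x).toLinearMap (N.orientation x)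
      (-N.orientation (τ x))) :
    ∃ W', IsOrientedBoundary W' V := by
  obtain ⟨ι, hι⟩ := h
  have : Nonempty (V.disjointUnion N).carrier := ⟨Sum.inr (Classical.arbitrary N.carrier)⟩
  have hs : ContMDiff (𝓡 n) (𝓡 n) ∞ (Sum.map id τ : V.carrier ⊕ N.carrier → V.carrier ⊕ N.carrier) :=
    contMDiff_id.sumMap hτ
  have ho' : ∀ x ∈ Set.range (Sum.inr : N.carrier → V.carrier ⊕ N.carrier), CarriesOrientation
      (mfderiv (𝓡 n) (𝓡 n)
        (Sum.map id τ : V.carrier ⊕ N.carrier → V.carrier ⊕ N.carrier) x).toLinearMap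
      ((V.disjointUnion N).orientation x) (-(V.disjointUnion N).orientation (Sum.map id τ x)) := by
    rintro _ ⟨x, rfl⟩
    have h1 : HasMFDerivAt (𝓡 n) (𝓡 n)
        ((Sum.map id τ : V.carrier ⊕ N.carrier → V.carrier ⊕ N.carrier) ∘ Sum.inr) x _ :=
      HasMFDerivAt.comp (f := (Sum.inr : N.carrier → V.carrier ⊕ N.carrier)) x
        ((hs (Sum.inr x)).mdifferentiableAt (by simp)).hasMFDerivAt
        (hasMFDerivAt_inr (p := (Sum.inr x : V.carrier ⊕ N.carrier)))
    have h2 : HasMFDerivAt (𝓡 n) (𝓡 n) ((Sum.inr : N.carrier → V.carrier ⊕ N.carrier) ∘ τ) x _ :=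
      HasMFDerivAt.comp (f := τ) x (hasMFDerivAt_inr (p := (Sum.inr (τ x) : V.carrier ⊕ N.carrier)))
        ((hτ x).mdifferentiableAt (by simp)).hasMFDerivAt
    have h3 : (mfderiv (𝓡 n) (𝓡 n) (Sum.map id τ : V.carrier ⊕ N.carrier → V.carrier ⊕ N.carrier)
        (Sum.inr x) : EuclideanSpace ℝ (Fin n) →L[ℝ] EuclideanSpace ℝ (Fin n)) =
        mfderiv (𝓡 n) (𝓡 n) τ x := by
      have h4 := hasMFDerivAt_unique h1 h2
      exact ContinuousLinearMap.ext fun v => DFunLike.congr_fun h4 v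
    exact h3.symm ▸ ho x
  have hττ' : ∀ x ∈ Set.range (Sum.inr : N.carrier → V.carrier ⊕ N.carrier),
      (Sum.map id τ (Sum.map id τ x) : V.carrier ⊕ N.carrier) = x := by
    rintro _ ⟨x, rfl⟩
    simp [hττ]
  have hne' : ∀ x ∈ Set.range (Sum.inr : N.carrier → V.carrier ⊕ N.carrier),
      (Sum.map id τ x : V.carrier ⊕ N.carrier) ≠ x := by
    rintro _ ⟨x, rfl⟩ h
    exact hne x (Sum.inr_injective h)
  have hC' : ∀ x ∈ Set.range (Sum.inr : N.carrier → V.carrier ⊕ N.carrier),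
      (Sum.map id τ x : V.carrier ⊕ N.carrier) ∈ Set.range Sum.inr := by
    rintro _ ⟨x, rfl⟩
    exact ⟨_, rfl⟩
  -- τ is extended by the identity on `V`; its hypotheses are only needed on the clopen summand `N`.
  obtain ⟨G, hA, hU, hG⟩ := hι.exists_partialInvolution (τ := Sum.map id τ)
    ⟨isClosed_range_inr, isOpen_range_inr⟩ hs hC' hττ' hne' ho'
  exact ⟨_, G.isOrientedBoundary_manifold hι hG hA hU⟩

end GluedManifold

/-! ### The smooth structure of the cylinder M × [0, 1]. -/

section Cylinder

variable (n : ℕ)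

/-- The isomorphism of `ℝⁿ⁺¹` with `ℝⁿ × ℝ` that splits off the first coordinate. -/
def splitFirst : EuclideanSpace ℝ (Fin (n + 1)) ≃L[ℝ] EuclideanSpace ℝ (Fin n) × ℝ :=
  (((EuclideanSpace.equiv (Fin (n + 1)) ℝ).trans (Fin.consEquivL ℝ fun _ => ℝ).symm).trans
    (ContinuousLinearEquiv.prodComm ℝ ℝ (Fin n → ℝ))).trans
      ((EuclideanSpace.equiv (Fin n) ℝ).symm.prodCongr (ContinuousLinearEquiv.refl ℝ ℝ))

variable {n}

theorem splitFirst_snd (v : EuclideanSpace ℝ (Fin (n + 1))) : (splitFirst n v).2 = v 0 := rfl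

theorem splitFirst_symm_zero (y : EuclideanSpace ℝ (Fin n) × ℝ) :
    (splitFirst n).symm y 0 = y.2 := by
  rw [← splitFirst_snd, ContinuousLinearEquiv.apply_symm_apply]

/-- The distance to the end of `[0, 1]` used for the chart at `t`. -/
def endParameter (t : ℝ) : ℝ → ℝ := if t < 1 then fun s => s else fun s => 1 - s

theorem endParameter_endParameter (t s : ℝ) : endParameter t (endParameter t s) = s := by
  unfold endParameter
  split_ifs <;> simp

theorem endParameter_mem (t : ℝ) {s : ℝ} (hs : s ∈ Set.Icc (0 : ℝ) 1) :
    endParameter t s ∈ Set.Icc (0 : ℝ) 1 := by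
  unfold endParameter
  split_ifs
  · exact hs
  · exact ⟨sub_nonneg.2 hs.2, sub_le_self 1 hs.1⟩

theorem contDiff_endParameter (t : ℝ) : ContDiff ℝ ∞ (endParameter t) := by
  unfold endParameter
  split_ifs
  · exact contDiff_id
  · exact contDiff_const.sub contDiff_id

theorem endParameter_self_lt {t : ℝ} : endParameter t t < 1 := by
  unfold endParameter
  split_ifs with h
  · exact h
  · linarith

theorem endParameter_self_eq_zero {t : ℝ} (ht : t ∈ Set.Icc (0 : ℝ) 1) :
    endParameter t t = 0 ↔ t = 0 ∨ t = 1 := by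
  unfold endParameter
  split_ifs with h
  · exact ⟨Or.inl, fun h' => h'.resolve_right h.ne⟩
  · have := ht.2
    constructor
    · intro h'
      right
      linarith
    · rintro (h' | h') <;> linarith

variable {M : Type*} [TopologicalSpace M] [ChartedSpace (EuclideanSpace ℝ (Fin n)) M]

variable (n) in
/-- The chart of the cylinder `M × [0, 1]` at a point. -/
def cylinderChart (p : M × Set.Icc (0 : ℝ) 1) :
    OpenPartialHomeomorph (M × Set.Icc (0 : ℝ) 1) (EuclideanHalfSpace (n + 1)) where
  toFun z := ⟨(splitFirst n).symm
    (chartAt (EuclideanSpace ℝ (Fin n)) p.1 z.1, endParameter p.2 z.2), by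
      rw [splitFirst_symm_zero]
      exact (endParameter_mem _ z.2.2).1⟩
  invFun h := ((chartAt (EuclideanSpace ℝ (Fin n)) p.1).symm (splitFirst n h.1).1,
    -- The projection to [0, 1] only makes the inverse total; it does nothing on the target.
    Set.projIcc 0 1 zero_le_one (endParameter p.2 (splitFirst n h.1).2))
  source := {z | z.1 ∈ (chartAt (EuclideanSpace ℝ (Fin n)) p.1).source ∧ endParameter p.2 z.2 < 1}
  target := {h | (splitFirst n h.1).1 ∈ (chartAt (EuclideanSpace ℝ (Fin n)) p.1).target ∧
    (splitFirst n h.1).2 < 1}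
  map_source' z hz := by
    simp only [Set.mem_ofPred_eq, ContinuousLinearEquiv.apply_symm_apply]
    exact ⟨(chartAt _ p.1).map_source hz.1, hz.2⟩
  map_target' h hh := by
    have h1 : (splitFirst n h.1).2 ∈ Set.Icc (0 : ℝ) 1 := ⟨h.2, hh.2.le⟩
    simp only [Set.mem_ofPred_eq]
    rw [Set.projIcc_of_mem zero_le_one (endParameter_mem _ h1)]
    simp only [endParameter_endParameter]
    exact ⟨(chartAt _ p.1).map_target hh.1, hh.2⟩
  left_inv' z hz := by
    simp only [ContinuousLinearEquiv.apply_symm_apply, endParameter_endParameter,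
      Set.projIcc_val]
    rw [(chartAt _ p.1).left_inv hz.1]
  right_inv' h hh := by
    have h1 : (splitFirst n h.1).2 ∈ Set.Icc (0 : ℝ) 1 := ⟨h.2, hh.2.le⟩
    apply Subtype.ext
    simp only
    rw [(chartAt _ p.1).right_inv hh.1, Set.projIcc_of_mem zero_le_one (endParameter_mem _ h1)]
    simp only [endParameter_endParameter]
    exact (splitFirst n).symm_apply_apply _
  open_source := ((chartAt _ p.1).open_source.preimage continuous_fst).inter
    (isOpen_lt ((contDiff_endParameter _).continuous.comp
      (continuous_subtype_val.comp continuous_snd)) continuous_const)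
  open_target := by
    have hc : Continuous fun h : EuclideanHalfSpace (n + 1) => splitFirst n h.1 :=
      (splitFirst n).continuous.comp continuous_subtype_val
    exact ((chartAt _ p.1).open_target.preimage (continuous_fst.comp hc)).inter
      (isOpen_lt (continuous_snd.comp hc) continuous_const)
  continuousOn_toFun := by
    refine Topology.IsInducing.subtypeVal.continuousOn_iff.2
      ((splitFirst n).symm.continuous.comp_continuousOn ?_)
    refine ContinuousOn.prodMk ?_ ((contDiff_endParameter _).continuous.comp
      (continuous_subtype_val.comp continuous_snd)).continuousOn
    exact (chartAt _ p.1).continuousOn.comp continuous_fst.continuousOn fun z hz => hz.1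
  continuousOn_invFun := by
    have hc : Continuous fun h : EuclideanHalfSpace (n + 1) => splitFirst n h.1 :=
      (splitFirst n).continuous.comp continuous_subtype_val
    refine ContinuousOn.prodMk ?_ (continuous_projIcc.comp
      ((contDiff_endParameter _).continuous.comp (continuous_snd.comp hc))).continuousOn
    exact (chartAt _ p.1).continuousOn_symm.comp (continuous_fst.comp hc).continuousOn
      fun h hh => hh.1

/-- The inclusion of the cylinder into `M × ℝ`. -/
def cylinderInclusion (z : M × Set.Icc (0 : ℝ) 1) : M × ℝ := (z.1, z.2)

variable (n) in
/-- The coordinates of the chart of the cylinder at a point, extended to `M × ℝ`. -/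
def cylinderCoord (p : M × Set.Icc (0 : ℝ) 1) (z : M × ℝ) : EuclideanSpace ℝ (Fin (n + 1)) :=
  (splitFirst n).symm (chartAt (EuclideanSpace ℝ (Fin n)) p.1 z.1, endParameter p.2 z.2)

theorem mem_cylinderChart_source (p : M × Set.Icc (0 : ℝ) 1) :
    p ∈ (cylinderChart n p).source :=
  ⟨mem_chart_source _ _, endParameter_self_lt⟩

theorem contMDiffAt_val (h : EuclideanHalfSpace (n + 1)) :
    ContMDiffAt (𝓡∂ (n + 1)) 𝓘(ℝ, EuclideanSpace ℝ (Fin (n + 1))) ∞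
      (fun h : EuclideanHalfSpace (n + 1) => h.1) h :=
  contMDiffAt_extChartAt (I := 𝓡∂ (n + 1)) (x := h)

theorem hasMFDerivAt_val (h : EuclideanHalfSpace (n + 1)) :
    HasMFDerivAt (𝓡∂ (n + 1)) 𝓘(ℝ, EuclideanSpace ℝ (Fin (n + 1)))
      (fun h : EuclideanHalfSpace (n + 1) => h.1) h
      (ContinuousLinearMap.id ℝ (EuclideanSpace ℝ (Fin (n + 1)))) := by
  have h1 : HasMFDerivAt (𝓡∂ (n + 1)) 𝓘(ℝ, EuclideanSpace ℝ (Fin (n + 1)))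
      (extChartAt (𝓡∂ (n + 1)) h) h _ :=
    (mdifferentiableAt_extChartAt (mem_chart_source _ h)).hasMFDerivAt
  rw [mfderiv_extChartAt_self] at h1
  exact h1

variable [IsManifold (𝓡 n) ∞ M]

theorem contMDiffAt_cylinderCoord (p : M × Set.Icc (0 : ℝ) 1) {z : M × ℝ}
    (hz : z.1 ∈ (chartAt (EuclideanSpace ℝ (Fin n)) p.1).source) :
    ContMDiffAt ((𝓡 n).prod 𝓘(ℝ, ℝ)) 𝓘(ℝ, EuclideanSpace ℝ (Fin (n + 1))) ∞
      (cylinderCoord n p) z := by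
  have h1 : ContMDiffAt ((𝓡 n).prod 𝓘(ℝ, ℝ)) 𝓘(ℝ, EuclideanSpace ℝ (Fin n)) ∞
      (fun z : M × ℝ => chartAt (EuclideanSpace ℝ (Fin n)) p.1 z.1) z :=
    ((contMDiffOn_chart (I := 𝓡 n)).contMDiffAt ((chartAt _ p.1).open_source.mem_nhds hz)).comp z
      contMDiffAt_fst
  have h2 : ContMDiffAt ((𝓡 n).prod 𝓘(ℝ, ℝ)) 𝓘(ℝ, ℝ) ∞
      (fun z : M × ℝ => endParameter p.2 z.2) z :=
    (contDiff_endParameter p.2).contMDiff.contMDiffAt.comp z contMDiffAt_snd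
  exact ((splitFirst n).symm.contDiff.contMDiff.contMDiffAt).comp z (h1.prodMk_space h2)

theorem contMDiffAt_cylinderInclusion_comp (p : M × Set.Icc (0 : ℝ) 1)
    {h : EuclideanHalfSpace (n + 1)} (hh : h ∈ (cylinderChart n p).target) :
    ContMDiffAt (𝓡∂ (n + 1)) ((𝓡 n).prod 𝓘(ℝ, ℝ)) ∞
      (cylinderInclusion ∘ (cylinderChart n p).symm) h := by
  have h0 : cylinderInclusion ∘ (cylinderChart n p).symm =ᶠ[𝓝 h] fun h =>
      ((chartAt (EuclideanSpace ℝ (Fin n)) p.1).symm (splitFirst n h.1).1,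
        endParameter p.2 (splitFirst n h.1).2) := by
    filter_upwards [(cylinderChart n p).open_target.mem_nhds hh] with h' hh'
    have h1 : (splitFirst n h'.1).2 ∈ Set.Icc (0 : ℝ) 1 := ⟨h'.2, hh'.2.le⟩
    refine Prod.ext rfl ?_
    change ((Set.projIcc 0 1 zero_le_one (endParameter p.2 (splitFirst n h'.1).2) :
      Set.Icc (0 : ℝ) 1) : ℝ) = _
    rw [Set.projIcc_of_mem zero_le_one (endParameter_mem _ h1)]
  refine ContMDiffAt.congr_of_eventuallyEq ?_ h0
  have hs : ContMDiffAt (𝓡∂ (n + 1)) 𝓘(ℝ, EuclideanSpace ℝ (Fin n) × ℝ) ∞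
      (fun h : EuclideanHalfSpace (n + 1) => splitFirst n h.1) h :=
    ((splitFirst n).contDiff.contMDiff.contMDiffAt).comp h (contMDiffAt_val h)
  have h1 : ContMDiffAt (𝓡∂ (n + 1)) 𝓘(ℝ, EuclideanSpace ℝ (Fin n)) ∞
      (fun h : EuclideanHalfSpace (n + 1) => (splitFirst n h.1).1) h :=
    contDiff_fst.contMDiff.contMDiffAt.comp h hs
  have h2 : ContMDiffAt (𝓡∂ (n + 1)) 𝓘(ℝ, ℝ) ∞
      (fun h : EuclideanHalfSpace (n + 1) => (splitFirst n h.1).2) h :=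
    contDiff_snd.contMDiff.contMDiffAt.comp h hs
  refine ContMDiffAt.prodMk ?_ ((contDiff_endParameter p.2).contMDiff.contMDiffAt.comp h h2)
  exact ((contMDiffOn_chart_symm (I := 𝓡 n)).contMDiffAt
    ((chartAt _ p.1).open_target.mem_nhds hh.1)).comp h h1

/-- The transition factors through M × ℝ, as the inverse chart followed by the extended coordinates,
and both factors are smooth. -/
theorem contMDiffAt_cylinderChart_transition (p q : M × Set.Icc (0 : ℝ) 1)
    {h : EuclideanHalfSpace (n + 1)} (hh : h ∈ (cylinderChart n p).target)
    (hq : (cylinderChart n p).symm h ∈ (cylinderChart n q).source) :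
    ContMDiffAt (𝓡∂ (n + 1)) (𝓡∂ (n + 1)) ∞ (cylinderChart n q ∘ (cylinderChart n p).symm) h := by
  have h1 := contMDiffAt_cylinderInclusion_comp p hh
  have h2 : ContMDiffAt (𝓡∂ (n + 1)) 𝓘(ℝ, EuclideanSpace ℝ (Fin (n + 1))) ∞
      (cylinderCoord n q ∘ (cylinderInclusion ∘ (cylinderChart n p).symm)) h :=
    ContMDiffAt.comp h (contMDiffAt_cylinderCoord q hq.1) h1
  have h3 : ContinuousAt (cylinderChart n q ∘ (cylinderChart n p).symm) h :=
    ((cylinderChart n q).continuousAt hq).comp ((cylinderChart n p).continuousAt_symm hh)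
  exact contMDiffAt_iff_target.2 ⟨h3, h2⟩

variable (n M) in
/-- The charts of the cylinder form a local model. -/
def cylinderModel : LocalModel (𝓡∂ (n + 1)) (M × Set.Icc (0 : ℝ) 1) (EuclideanHalfSpace (n + 1)) where
  chart := cylinderChart n
  mem_source := mem_cylinderChart_source
  contMDiffAt p q z hp hq := by
    refine contMDiffAt_cylinderChart_transition p q ((cylinderChart n p).map_source hp) ?_
    rwa [(cylinderChart n p).left_inv hp]

theorem contMDiffAt_cylinderInclusion (p : M × Set.Icc (0 : ℝ) 1) :
    let _ := (cylinderModel n M).chartedSpace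
    ContMDiffAt (𝓡∂ (n + 1)) ((𝓡 n).prod 𝓘(ℝ, ℝ)) ∞ cylinderInclusion p := by
  let _ := (cylinderModel n M).chartedSpace
  have h1 := (contMDiffAt_cylinderInclusion_comp p
    ((cylinderChart n p).map_source (mem_cylinderChart_source p))).comp p
      ((cylinderModel n M).contMDiffAt_chart p)
  refine h1.congr_of_eventuallyEq ?_
  filter_upwards [(cylinderChart n p).open_source.mem_nhds (mem_cylinderChart_source p)]
    with z hz
  exact congrArg cylinderInclusion ((cylinderChart n p).left_inv hz).symm

/-- Coordinates after inclusion give the chart at `p`, whose differential at `p` is the identity.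
This makes the differential of the inclusion injective. -/
theorem cylinderCoord_mfderiv (p : M × Set.Icc (0 : ℝ) 1)
    (v : EuclideanSpace ℝ (Fin (n + 1))) :
    let _ := (cylinderModel n M).chartedSpace
    mfderiv ((𝓡 n).prod 𝓘(ℝ, ℝ)) 𝓘(ℝ, EuclideanSpace ℝ (Fin (n + 1))) (cylinderCoord n p)
      (cylinderInclusion p)
      (mfderiv (𝓡∂ (n + 1)) ((𝓡 n).prod 𝓘(ℝ, ℝ)) cylinderInclusion p v) = v := by
  let _ := (cylinderModel n M).chartedSpace
  have h1 : HasMFDerivAt (𝓡∂ (n + 1)) 𝓘(ℝ, EuclideanSpace ℝ (Fin (n + 1)))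
      (cylinderCoord n p ∘ cylinderInclusion) p _ :=
    ((contMDiffAt_cylinderCoord p (mem_chart_source _ _)).mdifferentiableAt
      (by simp)).hasMFDerivAt.comp p
      ((contMDiffAt_cylinderInclusion p).mdifferentiableAt (by simp)).hasMFDerivAt
  have h2 : HasMFDerivAt (𝓡∂ (n + 1)) 𝓘(ℝ, EuclideanSpace ℝ (Fin (n + 1)))
      (cylinderCoord n p ∘ cylinderInclusion) p _ :=
    (hasMFDerivAt_val (cylinderChart n p p)).comp p ((cylinderModel n M).hasMFDerivAt_chart p)
  exact DFunLike.congr_fun (hasMFDerivAt_unique h1 h2) v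

theorem bijective_mfderiv_cylinderInclusion (p : M × Set.Icc (0 : ℝ) 1) :
    let _ := (cylinderModel n M).chartedSpace
    Function.Bijective
      (mfderiv (𝓡∂ (n + 1)) ((𝓡 n).prod 𝓘(ℝ, ℝ)) cylinderInclusion p) := by
  let _ := (cylinderModel n M).chartedSpace
  set A : EuclideanSpace ℝ (Fin (n + 1)) →L[ℝ] EuclideanSpace ℝ (Fin n) × ℝ :=
    mfderiv (𝓡∂ (n + 1)) ((𝓡 n).prod 𝓘(ℝ, ℝ)) cylinderInclusion p with hA
  have hinj : Function.Injective A := by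
    intro v w hvw
    rw [← cylinderCoord_mfderiv p v, ← cylinderCoord_mfderiv p w]
    exact congrArg _ hvw
  exact ⟨hinj, (LinearMap.injective_iff_surjective_of_finrank_eq_finrank
    (f := A.toLinearMap) (by simp)).1 hinj⟩

/-- At the ends `D` is 1 or -1 and turns the outward condition in the chart into the sign of the
∂/∂t component. -/
theorem mfderiv_cylinderInclusion_snd (p : M × Set.Icc (0 : ℝ) 1)
    (v : EuclideanSpace ℝ (Fin (n + 1))) {D : ℝ} (hD : HasDerivAt (endParameter p.2) D p.2) :
    let _ := (cylinderModel n M).chartedSpace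
    D * ((mfderiv (𝓡∂ (n + 1)) ((𝓡 n).prod 𝓘(ℝ, ℝ)) cylinderInclusion p :
      EuclideanSpace ℝ (Fin (n + 1)) →L[ℝ] EuclideanSpace ℝ (Fin n) × ℝ) v).2 = v 0 := by
  let _ := (cylinderModel n M).chartedSpace
  set A : EuclideanSpace ℝ (Fin (n + 1)) →L[ℝ] EuclideanSpace ℝ (Fin n) × ℝ :=
    mfderiv (𝓡∂ (n + 1)) ((𝓡 n).prod 𝓘(ℝ, ℝ)) cylinderInclusion p with hA
  have hAd : HasMFDerivAt (𝓡∂ (n + 1)) ((𝓡 n).prod 𝓘(ℝ, ℝ)) cylinderInclusion p A :=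
    ((contMDiffAt_cylinderInclusion p).mdifferentiableAt (by simp)).hasMFDerivAt
  have hsnd : HasMFDerivAt (𝓡∂ (n + 1)) 𝓘(ℝ, ℝ)
      (fun z : M × Set.Icc (0 : ℝ) 1 => (z.2 : ℝ)) p
      (ContinuousLinearMap.snd ℝ (EuclideanSpace ℝ (Fin n)) ℝ ∘L A :
        EuclideanSpace ℝ (Fin (n + 1)) →L[ℝ] ℝ) :=
    (hasMFDerivAt_snd (cylinderInclusion p)).comp p hAd
  have h1 : HasMFDerivAt (𝓡∂ (n + 1)) 𝓘(ℝ, ℝ)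
      (endParameter p.2 ∘ fun z : M × Set.Icc (0 : ℝ) 1 => (z.2 : ℝ)) p _ :=
    hD.hasFDerivAt.hasMFDerivAt.comp p hsnd
  have h2 : HasMFDerivAt (𝓡∂ (n + 1)) 𝓘(ℝ, EuclideanSpace ℝ (Fin (n + 1)))
      (fun z => (cylinderChart n p z).1) p
      (ContinuousLinearMap.id ℝ (EuclideanSpace ℝ (Fin (n + 1)))) :=
    (hasMFDerivAt_val (cylinderChart n p p)).comp p ((cylinderModel n M).hasMFDerivAt_chart p)
  have h3 : HasMFDerivAt (𝓡∂ (n + 1)) 𝓘(ℝ, ℝ)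
      ((fun v : EuclideanSpace ℝ (Fin (n + 1)) => v 0) ∘
        fun z => (cylinderChart n p z).1) p _ :=
    (EuclideanSpace.proj (𝕜 := ℝ) (0 : Fin (n + 1))).hasFDerivAt.hasMFDerivAt.comp p h2
  have h4 : ((fun v : EuclideanSpace ℝ (Fin (n + 1)) => v 0) ∘
        fun z => (cylinderChart n p z).1) =
      (endParameter p.2 ∘ fun z : M × Set.Icc (0 : ℝ) 1 => (z.2 : ℝ)) :=
    funext fun z => splitFirst_symm_zero _
  rw [h4] at h3
  have h5 := DFunLike.congr_fun (hasMFDerivAt_unique h1 h3) v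
  exact (mul_comm _ _).trans h5

end Cylinder

/-! ### The oriented cylinder and its boundary -M ⨿ M. -/

section CylinderManifold

variable {n : ℕ} (M : ClosedOrientedManifold.{u} n)

/-- The cylinder `M × [0, 1]`, with the orientation for which the inclusion into `M × ℝ` preserves
the orientation. -/
def ClosedOrientedManifold.cylinder : CompactOrientedManifoldWithBoundary.{u} n where
  carrier := M.carrier × Set.Icc (0 : ℝ) 1
  chartedSpace := (cylinderModel n M.carrier).chartedSpace
  isManifold := (cylinderModel n M.carrier).isManifold
  orientation p := (exists_carriesOrientation_left (bijective_mfderiv_cylinderInclusion p)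
    (productOrientation M.orientation (cylinderInclusion p))).choose
  isLocallyConstant := by
    let _ := (cylinderModel n M.carrier).chartedSpace
    have := (cylinderModel n M.carrier).isManifold
    refine IsLocallyConstant.of_mfderiv (by simp) M.isLocallyConstant.productOrientation fun p =>
      ⟨cylinderInclusion, (contMDiffAt_cylinderInclusion p).of_le (by simp),
        Eventually.of_forall fun q => ?_⟩
    exact (exists_carriesOrientation_left (bijective_mfderiv_cylinderInclusion q)
      (productOrientation M.orientation (cylinderInclusion q))).choose_spec

/-- The inclusion of the cylinder into `M × ℝ`. -/
def ClosedOrientedManifold.cylinderVal : M.cylinder.carrier → M.carrier × ℝ := cylinderInclusion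

/-- The inclusion of `M` as the slice at `t` of the cylinder. -/
def ClosedOrientedManifold.cylinderMk (t : Set.Icc (0 : ℝ) 1) : M.carrier → M.cylinder.carrier :=
  fun x => (x, t)

theorem stabilizeEuclidean_neg (o : Orientation ℝ (EuclideanSpace ℝ (Fin n)) (Fin n)) :
    -stabilizeEuclidean n (-o) = stabilizeEuclidean n o := by
  unfold stabilizeEuclidean
  rw [stabilize_neg, orientation_neg_neg]

theorem carriesOrientation_cylinderInclusion (p : M.cylinder.carrier) :
    CarriesOrientation (mfderiv (𝓡∂ (n + 1)) ((𝓡 n).prod 𝓘(ℝ, ℝ))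
      M.cylinderVal p).toLinearMap
      (M.cylinder.orientation p) (stabilizeEuclidean n (M.orientation p.1)) := by
  let _ := (cylinderModel n M.carrier).chartedSpace
  have h : ∀ q : M.carrier × Set.Icc (0 : ℝ) 1, CarriesOrientation
      (mfderiv (𝓡∂ (n + 1)) ((𝓡 n).prod 𝓘(ℝ, ℝ)) cylinderInclusion q).toLinearMap _
      (productOrientation M.orientation (cylinderInclusion q)) := fun q =>
    (exists_carriesOrientation_left (bijective_mfderiv_cylinderInclusion q)
      (productOrientation M.orientation (cylinderInclusion q))).choose_spec
  exact h p

theorem contMDiff_cylinderInclusion : ContMDiff (𝓡∂ (n + 1)) ((𝓡 n).prod 𝓘(ℝ, ℝ)) ∞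
    M.cylinderVal :=
  fun p => contMDiffAt_cylinderInclusion p

theorem contMDiff_cylinder_mk (t : Set.Icc (0 : ℝ) 1) : ContMDiff (𝓡 n) (𝓡∂ (n + 1)) ∞
    (M.cylinderMk t) := by
  intro x
  have hc : Continuous (fun x => (x, t) : M.carrier → M.carrier × Set.Icc (0 : ℝ) 1) := by fun_prop
  have h1 : ContMDiffAt (𝓡 n) ((𝓡 n).prod 𝓘(ℝ, ℝ)) ∞ (fun x : M.carrier => (x, (t : ℝ))) x :=
    contMDiffAt_id.prodMk contMDiffAt_const
  have h2 : ContMDiffAt (𝓡 n) 𝓘(ℝ, EuclideanSpace ℝ (Fin (n + 1))) ∞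
      (cylinderCoord n (x, t) ∘ fun x : M.carrier => (x, (t : ℝ))) x :=
    ContMDiffAt.comp x (contMDiffAt_cylinderCoord (x, t) (mem_chart_source _ x)) h1
  have h3 : ContinuousAt (fun y => cylinderChart n (x, t) (y, t)) x :=
    ContinuousAt.comp (f := fun y => (y, t)) (g := cylinderChart n (x, t))
      ((cylinderChart n (x, t)).continuousAt (mem_cylinderChart_source _)) hc.continuousAt
  have h4 : ContMDiffAt (𝓡 n) (𝓡∂ (n + 1)) ∞ (fun y => cylinderChart n (x, t) (y, t)) x :=
    contMDiffAt_iff_target.2 ⟨h3, h2⟩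
  exact (cylinderModel n M.carrier).contMDiffAt_of_chart_comp hc.continuousAt
    (Eventually.of_forall fun _ _ => rfl) h4

theorem mem_boundary_cylinder (p : M.carrier × Set.Icc (0 : ℝ) 1) :
    p ∈ (𝓡∂ (n + 1)).boundary M.cylinder.carrier ↔ (p.2 : ℝ) = 0 ∨ (p.2 : ℝ) = 1 := by
  rw [← endParameter_self_eq_zero p.2.2]
  have h1 : p ∈ (𝓡∂ (n + 1)).boundary M.cylinder.carrier ↔
      (𝓡∂ (n + 1)).IsBoundaryPoint (cylinderChart n p p) := Iff.rfl
  rw [h1, isBoundaryPoint_iff_extChartAt_eq_zero (mem_chart_source _ (cylinderChart n p p))]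
  have h2 : extChartAt (𝓡∂ (n + 1)) (cylinderChart n p p) (cylinderChart n p p) 0 =
    endParameter p.2 p.2 := splitFirst_symm_zero _
  rw [h2]

/-- The two ends of the cylinder. -/
def cylinderEnds : (M.neg.disjointUnion M).carrier → M.cylinder.carrier :=
  Sum.elim (M.cylinderMk ⟨0, by simp⟩) (M.cylinderMk ⟨1, by simp⟩)

theorem contMDiff_cylinderEnds : ContMDiff (𝓡 n) (𝓡∂ (n + 1)) ∞ (cylinderEnds M) :=
  ContMDiff.sumElim (contMDiff_cylinder_mk M _) (contMDiff_cylinder_mk M _)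

theorem mfderiv_cylinderInclusion_ends (x : M.carrier ⊕ M.carrier)
    (u : EuclideanSpace ℝ (Fin n)) :
    (mfderiv (𝓡∂ (n + 1)) ((𝓡 n).prod 𝓘(ℝ, ℝ))
      M.cylinderVal (cylinderEnds M x) :
        EuclideanSpace ℝ (Fin (n + 1)) →L[ℝ] EuclideanSpace ℝ (Fin n) × ℝ)
      ((mfderiv (𝓡 n) (𝓡∂ (n + 1)) (cylinderEnds M) x :
        EuclideanSpace ℝ (Fin n) →L[ℝ] EuclideanSpace ℝ (Fin (n + 1))) u) = (u, 0) := by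
  have h1 : HasMFDerivAt (𝓡 n) ((𝓡 n).prod 𝓘(ℝ, ℝ)) (M := M.carrier ⊕ M.carrier)
      (M.cylinderVal ∘ cylinderEnds M) x
      ((mfderiv (𝓡∂ (n + 1)) ((𝓡 n).prod 𝓘(ℝ, ℝ))
      M.cylinderVal (cylinderEnds M x) :
        EuclideanSpace ℝ (Fin (n + 1)) →L[ℝ] EuclideanSpace ℝ (Fin n) × ℝ) ∘L
      (mfderiv (𝓡 n) (𝓡∂ (n + 1)) (cylinderEnds M) x :
        EuclideanSpace ℝ (Fin n) →L[ℝ] EuclideanSpace ℝ (Fin (n + 1)))) :=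
    HasMFDerivAt.comp (f := cylinderEnds M) x
      ((contMDiff_cylinderInclusion M _).mdifferentiableAt (by simp)).hasMFDerivAt
      ((contMDiff_cylinderEnds M x).mdifferentiableAt (by simp)).hasMFDerivAt
  have h3 : ∀ (t : ℝ) (x : M.carrier), HasMFDerivAt (𝓡 n) ((𝓡 n).prod 𝓘(ℝ, ℝ))
      (fun x : M.carrier => (x, t)) x ((ContinuousLinearMap.id ℝ (EuclideanSpace ℝ (Fin n))).prod
        (0 : EuclideanSpace ℝ (Fin n) →L[ℝ] ℝ)) := fun t x =>
    (hasMFDerivAt_id x).prodMk (hasMFDerivAt_const t x)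
  rcases x with x | x
  · have h2 := h1.comp (f := (Sum.inl : M.carrier → M.carrier ⊕ M.carrier)) x
      (hasMFDerivAt_inl (p := (Sum.inl x : M.carrier ⊕ M.carrier)))
    exact DFunLike.congr_fun (hasMFDerivAt_unique h2 (h3 0 x)) u
  · have h2 := h1.comp (f := (Sum.inr : M.carrier → M.carrier ⊕ M.carrier)) x
      (hasMFDerivAt_inr (p := (Sum.inr x : M.carrier ⊕ M.carrier)))
    exact DFunLike.congr_fun (hasMFDerivAt_unique h2 (h3 1 x)) u

/-- Outward means decreasing t at the end 0 and increasing t at the end 1. With ∂/∂t first in the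
product orientation, the end 0 acquires the opposite orientation and the end 1 the given one. -/
theorem isOrientedBoundary_cylinder : IsOrientedBoundary M.cylinder (M.neg.disjointUnion M) := by
  have hinj : Function.Injective (cylinderEnds M) := by
    rintro (x | x) (y | y) h
    · exact congrArg Sum.inl (congrArg Prod.fst h)
    · have h1 : (0 : ℝ) = 1 := congrArg (fun z : M.carrier × Set.Icc (0 : ℝ) 1 => (z.2 : ℝ)) h
      exact absurd h1 zero_ne_one
    · have h1 : (1 : ℝ) = 0 := congrArg (fun z : M.carrier × Set.Icc (0 : ℝ) 1 => (z.2 : ℝ)) h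
      exact absurd h1 one_ne_zero
    · exact congrArg Sum.inr (congrArg Prod.fst h)
  refine ⟨cylinderEnds M, contMDiff_cylinderEnds M,
    ((contMDiff_cylinderEnds M).continuous.isClosedEmbedding hinj).isEmbedding, fun x => ?_, ?_, ?_⟩
  · intro u v huv
    have h1 := mfderiv_cylinderInclusion_ends M x u
    have h2 := mfderiv_cylinderInclusion_ends M x v
    exact congrArg Prod.fst (h1.symm.trans ((congrArg _ huv).trans h2))
  · ext p
    refine Iff.trans ?_ (mem_boundary_cylinder M p).symm
    constructor
    · rintro ⟨x | x, rfl⟩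
      · exact Or.inl rfl
      · exact Or.inr rfl
    · obtain ⟨x, t⟩ := p
      rintro (h | h)
      · exact ⟨Sum.inl x, Prod.ext rfl (Subtype.ext h.symm)⟩
      · exact ⟨Sum.inr x, Prod.ext rfl (Subtype.ext h.symm)⟩
  · intro x v hv b b' hb0 hbs
    have hv0 := (isOutward_iff _ v).1 hv
    have h1 := mfderiv_cylinderInclusion_ends M x
    have h2 := carriesOrientation_cylinderInclusion M (cylinderEnds M x)
    have h3 := fun D hD => mfderiv_cylinderInclusion_snd (D := D) (cylinderEnds M x) v hD
    set A : EuclideanSpace ℝ (Fin (n + 1)) →L[ℝ] EuclideanSpace ℝ (Fin n) × ℝ :=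
      mfderiv (𝓡∂ (n + 1)) ((𝓡 n).prod 𝓘(ℝ, ℝ))
        M.cylinderVal (cylinderEnds M x) with hA
    set B : EuclideanSpace ℝ (Fin n) →L[ℝ] EuclideanSpace ℝ (Fin (n + 1)) :=
      mfderiv (𝓡 n) (𝓡∂ (n + 1)) (cylinderEnds M) x with hB
    have h4 : ∀ w : EuclideanSpace ℝ (Fin (n + 1)), w = v → (A w).2 = (A v).2 := by
      rintro _ rfl
      rfl
    rcases x with x | x
    · have hD : HasDerivAt (endParameter 0) 1 0 := by
        have : endParameter 0 = fun s => s := by simp [endParameter]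
        rw [this]
        exact hasDerivAt_id 0
      have h5 : 1 * (A v).2 < 0 := (h3 1 hD).trans_lt hv0
      -- The summand is `M.neg`: the product orientation is rewritten as the negative of the
      -- stabilization of the reversed one, the form used for a negative last component.
      have h6 : CarriesOrientation A.toLinearMap (M.cylinder.orientation (cylinderEnds M (Sum.inl x)))
          (-stabilizeEuclidean n (-M.orientation x)) := by
        have h7 := stabilizeEuclidean_neg (M.orientation x)
        exact h7.symm ▸ h2
      exact h6.boundary_iff (V := EuclideanSpace ℝ (Fin n)) (by simp) (j := B.toLinearMap) h1 b b'
        ((h4 _ hb0).trans_lt (by linarith)) hbs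
    · have hD : HasDerivAt (endParameter 1) (-1) 1 := by
        have : endParameter 1 = fun s => 1 - s := by simp [endParameter]
        rw [this]
        exact (hasDerivAt_id 1).const_sub 1
      have h5 : -1 * (A v).2 < 0 := (h3 (-1) hD).trans_lt hv0
      exact CarriesOrientation.boundary_iff' (V := EuclideanSpace ℝ (Fin n)) (by simp)
        (j := B.toLinearMap) h1 h2 b b' (lt_of_lt_of_eq (by linarith) (h4 _ hb0).symm) hbs

end CylinderManifold

/-! ### Orientation preserving maps between sums and reversed manifolds. -/

section OrientedMaps

variable {n : ℕ}

/-- A smooth map of closed oriented manifolds whose differentials preserve the orientation. -/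
structure IsOrientedMap (V V' : ClosedOrientedManifold.{u} n) (g : V.carrier → V'.carrier) :
    Prop where
  contMDiff : ContMDiff (𝓡 n) (𝓡 n) ∞ g
  carriesOrientation : ∀ x, CarriesOrientation (mfderiv (𝓡 n) (𝓡 n) g x).toLinearMap
    (V.orientation x) (V'.orientation (g x))

variable {V V' V'' V₁ V₂ : ClosedOrientedManifold.{u} n}

theorem IsOrientedMap.refl : IsOrientedMap V V id := by
  refine ⟨contMDiff_id, fun x => ?_⟩
  rw [mfderiv_id]
  exact CarriesOrientation.id _

theorem IsOrientedMap.comp {g : V'.carrier → V''.carrier} {f : V.carrier → V'.carrier}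
    (hg : IsOrientedMap V' V'' g) (hf : IsOrientedMap V V' f) : IsOrientedMap V V'' (g ∘ f) := by
  refine ⟨hg.contMDiff.comp hf.contMDiff, fun x => ?_⟩
  have h := mfderiv_comp x ((hg.contMDiff (f x)).mdifferentiableAt (by simp))
    ((hf.contMDiff x).mdifferentiableAt (by simp))
  exact h.symm ▸ (hg.carriesOrientation (f x)).comp (hf.carriesOrientation x)

theorem IsOrientedMap.neg {f : V.carrier → V'.carrier} (hf : IsOrientedMap V V' f) :
    IsOrientedMap V.neg V'.neg f :=
  ⟨hf.contMDiff, fun x => CarriesOrientation.neg (V := EuclideanSpace ℝ (Fin n))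
    (W := EuclideanSpace ℝ (Fin n)) (hf.carriesOrientation x)⟩

theorem IsOrientedMap.neg_left {f : V.carrier → V'.carrier} (h : IsOrientedMap V V'.neg f) :
    IsOrientedMap V.neg V' f := by
  refine ⟨h.contMDiff, fun x => ?_⟩
  have h1 := CarriesOrientation.neg (V := EuclideanSpace ℝ (Fin n))
    (W := EuclideanSpace ℝ (Fin n)) (h.carriesOrientation x)
  exact orientation_neg_neg (V'.orientation (f x)) ▸ h1

theorem IsOrientedMap.inl : IsOrientedMap V (V.disjointUnion V') Sum.inl := by
  refine ⟨ContMDiff.inl, fun x => ?_⟩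
  have h : HasMFDerivAt (𝓡 n) (𝓡 n) (M' := (V.disjointUnion V').carrier) Sum.inl x
      (ContinuousLinearMap.id ℝ (EuclideanSpace ℝ (Fin n))) :=
    hasMFDerivAt_inl (p := (Sum.inl x : V.carrier ⊕ V'.carrier))
  rw [h.mfderiv]
  exact CarriesOrientation.id _

theorem IsOrientedMap.inr : IsOrientedMap V' (V.disjointUnion V') Sum.inr := by
  refine ⟨ContMDiff.inr, fun x => ?_⟩
  have h : HasMFDerivAt (𝓡 n) (𝓡 n) (M' := (V.disjointUnion V').carrier) Sum.inr x
      (ContinuousLinearMap.id ℝ (EuclideanSpace ℝ (Fin n))) :=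
    hasMFDerivAt_inr (p := (Sum.inr x : V.carrier ⊕ V'.carrier))
  rw [h.mfderiv]
  exact CarriesOrientation.id _

theorem mfderiv_sum_inl {E H E' H' M N X : Type*} [NormedAddCommGroup E] [NormedSpace ℝ E]
    [TopologicalSpace H] {I : ModelWithCorners ℝ E H} [NormedAddCommGroup E'] [NormedSpace ℝ E']
    [TopologicalSpace H'] {I' : ModelWithCorners ℝ E' H'} [TopologicalSpace M] [ChartedSpace H M]
    [TopologicalSpace N] [ChartedSpace H N] [TopologicalSpace X] [ChartedSpace H' X]
    {g : M ⊕ N → X} {x : M} (hg : MDifferentiableAt I I' g (Sum.inl x)) :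
    (mfderiv I I' g (Sum.inl x) : E →L[ℝ] E') = mfderiv I I' (fun y => g (Sum.inl y)) x := by
  have h : HasMFDerivAt I I' (g ∘ Sum.inl) x _ := hg.hasMFDerivAt.comp
    (f := (Sum.inl : M → M ⊕ N)) x (hasMFDerivAt_inl (p := (Sum.inl x : M ⊕ N)))
  exact h.mfderiv.symm

theorem mfderiv_sum_inr {E H E' H' M N X : Type*} [NormedAddCommGroup E] [NormedSpace ℝ E]
    [TopologicalSpace H] {I : ModelWithCorners ℝ E H} [NormedAddCommGroup E'] [NormedSpace ℝ E']
    [TopologicalSpace H'] {I' : ModelWithCorners ℝ E' H'} [TopologicalSpace M] [ChartedSpace H M]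
    [TopologicalSpace N] [ChartedSpace H N] [TopologicalSpace X] [ChartedSpace H' X]
    {g : M ⊕ N → X} {x : N} (hg : MDifferentiableAt I I' g (Sum.inr x)) :
    (mfderiv I I' g (Sum.inr x) : E →L[ℝ] E') = mfderiv I I' (fun y => g (Sum.inr y)) x := by
  have h : HasMFDerivAt I I' (g ∘ Sum.inr) x _ := hg.hasMFDerivAt.comp
    (f := (Sum.inr : N → M ⊕ N)) x (hasMFDerivAt_inr (p := (Sum.inr x : M ⊕ N)))
  exact h.mfderiv.symm

theorem IsOrientedMap.elim {f : V.carrier → V''.carrier} {g : V'.carrier → V''.carrier}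
    (hf : IsOrientedMap V V'' f) (hg : IsOrientedMap V' V'' g) :
    IsOrientedMap (V.disjointUnion V') V'' (Sum.elim f g) := by
  have hs : ContMDiff (𝓡 n) (𝓡 n) ∞ (Sum.elim f g : V.carrier ⊕ V'.carrier → V''.carrier) :=
    hf.contMDiff.sumElim hg.contMDiff
  refine ⟨hs, ?_⟩
  rintro (x | x)
  · exact (mfderiv_sum_inl ((hs (Sum.inl x)).mdifferentiableAt (by simp))).symm ▸
      hf.carriesOrientation x
  · exact (mfderiv_sum_inr ((hs (Sum.inr x)).mdifferentiableAt (by simp))).symm ▸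
      hg.carriesOrientation x

theorem IsOrientedMap.id_neg_neg : IsOrientedMap V V.neg.neg id := by
  refine ⟨contMDiff_id, fun x => ?_⟩
  have h : CarriesOrientation (ContinuousLinearMap.id ℝ (EuclideanSpace ℝ (Fin n))).toLinearMap
      (V.orientation x) (- -V.orientation x) :=
    (orientation_neg_neg (V.orientation x)).symm ▸ CarriesOrientation.id _
  have h1 : mfderiv (𝓡 n) (𝓡 n) (id : V.carrier → V.carrier) x =
      ContinuousLinearMap.id ℝ (EuclideanSpace ℝ (Fin n)) := mfderiv_id
  exact h1.symm ▸ h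

theorem IsOrientedMap.neg_right {f : V.carrier → V'.carrier} (h : IsOrientedMap V.neg V' f) :
    IsOrientedMap V V'.neg f :=
  h.neg.comp IsOrientedMap.id_neg_neg

theorem IsOrientedMap.elim_neg {f : V.carrier → V''.carrier} {g : V'.carrier → V''.carrier}
    (hf : IsOrientedMap V.neg V'' f) (hg : IsOrientedMap V'.neg V'' g) :
    IsOrientedMap (V.disjointUnion V').neg V'' (Sum.elim f g) :=
  (IsOrientedMap.elim hf.neg_right hg.neg_right).neg_left

end OrientedMaps

/-! ### Operations on oriented boundaries. -/

section Boundaries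

variable {n : ℕ} {W W' : CompactOrientedManifoldWithBoundary.{u} n}
  {V V' : ClosedOrientedManifold.{u} n}

/-- Bijectivity is enough: by compactness `g` is a topological embedding, and its differentials are
isomorphisms because they carry orientations. -/
theorem IsOrientedBoundary.of_isOrientedMap (h : IsOrientedBoundary W V)
    {g : V'.carrier → V.carrier} (hg : IsOrientedMap V' V g) (hb : Function.Bijective g) :
    IsOrientedBoundary W V' := by
  obtain ⟨ι, h⟩ := h
  have hge : Topology.IsEmbedding g :=
    (hg.contMDiff.continuous.isClosedEmbedding hb.injective).isEmbedding
  have hd : ∀ x, mfderiv (𝓡 n) (𝓡∂ (n + 1)) (ι ∘ g) x =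
      (mfderiv (𝓡 n) (𝓡∂ (n + 1)) ι (g x)).comp (mfderiv (𝓡 n) (𝓡 n) g x) := fun x =>
    mfderiv_comp x ((h.contMDiff (g x)).mdifferentiableAt (by simp))
      ((hg.contMDiff x).mdifferentiableAt (by simp))
  refine ⟨ι ∘ g, h.contMDiff.comp hg.contMDiff, h.isEmbedding.comp hge, fun x => ?_, ?_, ?_⟩
  · rw [hd]
    exact (h.injective_mfderiv (g x)).comp (hg.carriesOrientation x).bijective.injective
  · rw [hb.surjective.range_comp, h.range_eq]
  · intro x v hv b b' h0 hs
    have hc := hg.carriesOrientation x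
    set b₁ := b.map (LinearEquiv.ofBijective _ hc.bijective)
    rw [hc.basis_iff b b₁ fun i => by simp [b₁]]
    refine h.orientation_iff (g x) v hv b₁ b' h0 fun i => ?_
    rw [hs, hd]
    simp [b₁]

/-- The same manifold with boundary with the opposite orientation. -/
def CompactOrientedManifoldWithBoundary.neg (W : CompactOrientedManifoldWithBoundary.{u} n) :
    CompactOrientedManifoldWithBoundary.{u} n where
  carrier := W.carrier
  orientation := fun x => -W.orientation x
  isLocallyConstant := W.isLocallyConstant.neg

theorem basis_orientation_eq_neg_iff {E : Type*} [AddCommGroup E] [Module ℝ E] {m : ℕ}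
    (b : Module.Basis (Fin m) ℝ E) (o : Orientation ℝ E (Fin m)) :
    b.orientation = -o ↔ ¬ b.orientation = o := by
  constructor
  · intro h h'
    rw [h'] at h
    exact Module.Ray.ne_neg_self o h
  · intro h
    rcases b.orientation_eq_or_eq_neg o with h' | h'
    · exact absurd h'.symm h
    · rw [h']
      exact (orientation_neg_neg _).symm

theorem IsOrientedBoundary.neg (h : IsOrientedBoundary W V) : IsOrientedBoundary W.neg V.neg := by
  obtain ⟨ι, h⟩ := h
  refine ⟨ι, h.contMDiff, h.isEmbedding, h.injective_mfderiv, h.range_eq, ?_⟩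
  intro x v hv b b' h0 hs
  have h1 := h.orientation_iff x v hv b b' h0 hs
  exact ((basis_orientation_eq_neg_iff (E := EuclideanSpace ℝ (Fin n)) b (V.orientation x)).trans
    (not_congr h1)).trans (basis_orientation_eq_neg_iff (E := EuclideanSpace ℝ (Fin (n + 1))) b'
      (W.orientation (ι x))).symm

/-- The disjoint union of two compact oriented manifolds with boundary. -/
def CompactOrientedManifoldWithBoundary.disjointUnion
    (W W' : CompactOrientedManifoldWithBoundary.{u} n) :
    CompactOrientedManifoldWithBoundary.{u} n where
  carrier := W.carrier ⊕ W'.carrier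
  orientation := sumOrientation W.orientation W'.orientation
  isLocallyConstant := W.isLocallyConstant.sum W'.isLocallyConstant

theorem IsOrientedBoundary.disjointUnion (h : IsOrientedBoundary W V)
    (h' : IsOrientedBoundary W' V') :
    IsOrientedBoundary (W.disjointUnion W') (V.disjointUnion V') := by
  obtain ⟨ι, h⟩ := h
  obtain ⟨ι', h'⟩ := h'
  have hs : ContMDiff (𝓡 n) (𝓡∂ (n + 1)) ∞
      (Sum.map ι ι' : V.carrier ⊕ V'.carrier → W.carrier ⊕ W'.carrier) :=
    h.contMDiff.sumMap h'.contMDiff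
  have hinj : Function.Injective (Sum.map ι ι') :=
    h.isEmbedding.injective.sumMap h'.isEmbedding.injective
  have hl : ∀ x : V.carrier, (mfderiv (𝓡 n) (𝓡∂ (n + 1))
      (Sum.map ι ι' : V.carrier ⊕ V'.carrier → W.carrier ⊕ W'.carrier) (Sum.inl x) :
        EuclideanSpace ℝ (Fin n) →L[ℝ] EuclideanSpace ℝ (Fin (n + 1))) =
      mfderiv (𝓡 n) (𝓡∂ (n + 1)) ι x := fun x => by
    rw [mfderiv_sum_inl ((hs (Sum.inl x)).mdifferentiableAt (by simp))]
    have h1 : HasMFDerivAt (𝓡 n) (𝓡∂ (n + 1))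
        ((Sum.inl : W.carrier → W.carrier ⊕ W'.carrier) ∘ ι) x _ :=
      HasMFDerivAt.comp (f := ι) x (hasMFDerivAt_inl (p := (Sum.inl (ι x) : W.carrier ⊕ W'.carrier)))
        ((h.contMDiff x).mdifferentiableAt (by simp)).hasMFDerivAt
    exact h1.mfderiv
  have hr : ∀ x : V'.carrier, (mfderiv (𝓡 n) (𝓡∂ (n + 1))
      (Sum.map ι ι' : V.carrier ⊕ V'.carrier → W.carrier ⊕ W'.carrier) (Sum.inr x) :
        EuclideanSpace ℝ (Fin n) →L[ℝ] EuclideanSpace ℝ (Fin (n + 1))) =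
      mfderiv (𝓡 n) (𝓡∂ (n + 1)) ι' x := fun x => by
    rw [mfderiv_sum_inr ((hs (Sum.inr x)).mdifferentiableAt (by simp))]
    have h1 : HasMFDerivAt (𝓡 n) (𝓡∂ (n + 1))
        ((Sum.inr : W'.carrier → W.carrier ⊕ W'.carrier) ∘ ι') x _ :=
      HasMFDerivAt.comp (f := ι') x
        (hasMFDerivAt_inr (p := (Sum.inr (ι' x) : W.carrier ⊕ W'.carrier)))
        ((h'.contMDiff x).mdifferentiableAt (by simp)).hasMFDerivAt
    exact h1.mfderiv
  refine ⟨Sum.map ι ι', hs, (hs.continuous.isClosedEmbedding hinj).isEmbedding, ?_, ?_, ?_⟩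
  · rintro (x | x)
    · exact (hl x).symm ▸ h.injective_mfderiv x
    · exact (hr x).symm ▸ h'.injective_mfderiv x
  · have h1 := ModelWithCorners.boundary_disjointUnion (I := 𝓡∂ (n + 1)) (M := W.carrier)
      (M' := W'.carrier)
    have h2 : Set.range (Sum.map ι ι') = Sum.inl '' Set.range ι ∪ Sum.inr '' Set.range ι' := by
      ext (x | x) <;> simp
    rw [h.range_eq, h'.range_eq] at h2
    exact h2.trans h1.symm
  · rintro (x | x) v hv b b' h0 hb
    · exact h.orientation_iff x v ((isOutward_iff _ _).2 ((isOutward_iff _ _).1 hv)) b b' h0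
        fun i => (hb i).trans (DFunLike.congr_fun (hl x) (b i))
    · exact h'.orientation_iff x v ((isOutward_iff _ _).2 ((isOutward_iff _ _).1 hv)) b b' h0
        fun i => (hb i).trans (DFunLike.congr_fun (hr x) (b i))

/-- Every orientation preserving diffeomorphism yields a cobordism. -/
theorem Cobordant.of_isOrientedMap {g : V'.carrier → V.carrier} (hg : IsOrientedMap V' V g)
    (hb : Function.Bijective g) : Cobordant V V' := by
  refine ⟨V.cylinder, (isOrientedBoundary_cylinder V).of_isOrientedMap
    (g := Sum.elim Sum.inl (Sum.inr ∘ g)) (IsOrientedMap.elim IsOrientedMap.inl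
      (IsOrientedMap.inr.comp hg)) ?_⟩
  have h : (Sum.elim Sum.inl (Sum.inr ∘ g) : V.carrier ⊕ V'.carrier → V.carrier ⊕ V.carrier) =
      Sum.map id g := rfl
  exact h ▸ ⟨Function.injective_id.sumMap hb.injective, Function.surjective_id.sumMap hb.surjective⟩

/-- Two copies of `N` with opposite orientations can be cancelled from an oriented boundary. -/
theorem IsOrientedBoundary.cancel {N : ClosedOrientedManifold.{u} n}
    (h : IsOrientedBoundary W (V.disjointUnion (N.neg.disjointUnion N))) :
    ∃ W', IsOrientedBoundary W' V := by
  -- The gluing assumes a nonempty summand; an empty one is simply dropped.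
  rcases isEmpty_or_nonempty N.carrier with hN | hN
  · refine ⟨W, h.of_isOrientedMap IsOrientedMap.inl ⟨Sum.inl_injective, ?_⟩⟩
    rintro (x | x | x)
    · exact ⟨x, rfl⟩
    · exact (hN.false x).elim
    · exact (hN.false x).elim
  · have : Nonempty (N.neg.disjointUnion N).carrier := ⟨Sum.inr (Classical.arbitrary N.carrier)⟩
    -- Exchanging the two copies preserves orientation up to the reversal of both, and it has no
    -- fixed points.
    have hτ : IsOrientedMap (N.neg.disjointUnion N) (N.neg.disjointUnion N).neg Sum.swap :=
      IsOrientedMap.elim IsOrientedMap.inr.neg (IsOrientedMap.neg_right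
        IsOrientedMap.inl)
    refine h.of_disjointUnion hτ.contMDiff Sum.swap_swap ?_ hτ.carriesOrientation
    rintro (x | x) h <;> cases h

end Boundaries

/-! ### The equivalence relation and the group of classes. -/

section CobordismGroup

variable {n : ℕ}

/-- The empty oriented manifold. -/
def ClosedOrientedManifold.empty (n : ℕ) : ClosedOrientedManifold.{u} n where
  carrier := PEmpty
  topologicalSpace := ⊥
  chartedSpace := @ChartedSpace.empty _ _ PEmpty ⊥ _
  isManifold := by
    let _ : TopologicalSpace PEmpty.{u + 1} := ⊥
    let _ : ChartedSpace (EuclideanSpace ℝ (Fin n)) PEmpty.{u + 1} := ChartedSpace.empty _ _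
    exact isManifold_of_contDiffOn _ _ _ fun _ _ h => h.elim
  t2Space := ⟨fun x => x.elim⟩
  compactSpace := ⟨by rw [Set.univ_eq_empty_iff.2 inferInstance]; exact isCompact_empty⟩
  orientation x := x.elim
  isLocallyConstant x := x.elim

variable {L M N L' M' N' : ClosedOrientedManifold.{u} n}

theorem IsOrientedMap.elim_empty (M : ClosedOrientedManifold.{u} n) :
    IsOrientedMap (M.disjointUnion (.empty n)) M (Sum.elim id PEmpty.elim) :=
  IsOrientedMap.elim IsOrientedMap.refl
    ⟨fun x => PEmpty.elim x, fun x => PEmpty.elim x⟩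

theorem bijective_elim_pempty (M : ClosedOrientedManifold.{u} n) :
    Function.Bijective (Sum.elim id PEmpty.elim : M.carrier ⊕ PEmpty.{u + 1} → M.carrier) :=
  ⟨by rintro (x | x) (y | y) h <;> [exact congrArg _ h; cases y; cases x; cases x],
    fun x => ⟨Sum.inl x, rfl⟩⟩

theorem Cobordant.refl (M : ClosedOrientedManifold.{u} n) : Cobordant M M :=
  ⟨M.cylinder, isOrientedBoundary_cylinder M⟩

theorem Cobordant.symm (h : Cobordant M N) : Cobordant N M := by
  obtain ⟨W, h⟩ := h
  refine ⟨W.neg, h.neg.of_isOrientedMap (g := Sum.swap) (IsOrientedMap.elim IsOrientedMap.inr.neg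
    (IsOrientedMap.neg_right IsOrientedMap.inl)) (Equiv.sumComm _ _).bijective⟩

theorem Cobordant.trans (h : Cobordant L M) (h' : Cobordant M N) : Cobordant L N := by
  obtain ⟨W, h⟩ := h
  obtain ⟨W', h'⟩ := h'
  -- The boundary (-L ⨿ M) ⨿ (-M ⨿ N) is rearranged as (-L ⨿ N) ⨿ (-M ⨿ M).
  refine IsOrientedBoundary.cancel (V := L.neg.disjointUnion N) (N := M)
    ((h.disjointUnion h').of_isOrientedMap
      (g := Sum.elim (Sum.elim (Sum.inl ∘ Sum.inl) (Sum.inr ∘ Sum.inr))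
        (Sum.elim (Sum.inr ∘ Sum.inl) (Sum.inl ∘ Sum.inr)))
      (.elim (.elim (.comp .inl .inl) (.comp .inr .inr))
        (.elim (.comp .inr .inl) (.comp .inl .inr))) ?_)
  refine ⟨?_, ?_⟩
  · rintro ((x | x) | (x | x)) ((y | y) | (y | y)) h <;> cases h <;> rfl
  · rintro ((x | x) | (x | x))
    exacts [⟨.inl (.inl x), rfl⟩, ⟨.inr (.inr x), rfl⟩, ⟨.inr (.inl x), rfl⟩, ⟨.inl (.inr x), rfl⟩]

theorem equivalence_cobordant (n : ℕ) : Equivalence (fun M N : ClosedOrientedManifold.{u} n =>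
    Cobordant M N) :=
  ⟨Cobordant.refl, Cobordant.symm, Cobordant.trans⟩

theorem Cobordant.neg (h : Cobordant M N) : Cobordant M.neg N.neg := by
  obtain ⟨W, h⟩ := h
  refine ⟨W.neg, h.neg.of_isOrientedMap (g := Sum.elim Sum.inl Sum.inr)
    (.elim (.neg .inl) (.neg .inr)) ⟨?_, ?_⟩⟩
  · rintro (x | x) (y | y) h <;> cases h <;> rfl
  · rintro (x | x)
    exacts [⟨.inl x, rfl⟩, ⟨.inr x, rfl⟩]

theorem Cobordant.disjointUnion (h : Cobordant M N) (h' : Cobordant M' N') :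
    Cobordant (M.disjointUnion M') (N.disjointUnion N') := by
  obtain ⟨W, h⟩ := h
  obtain ⟨W', h'⟩ := h'
  refine ⟨_, (h.disjointUnion h').of_isOrientedMap
    (g := Sum.elim (Sum.elim (Sum.inl ∘ Sum.inl) (Sum.inr ∘ Sum.inl))
      (Sum.elim (Sum.inl ∘ Sum.inr) (Sum.inr ∘ Sum.inr)))
    (.elim (.elim_neg (.comp .inl .inl) (.comp .inr .inl)) (.elim (.comp .inl .inr) (.comp .inr .inr))) ?_⟩
  refine ⟨?_, ?_⟩
  · rintro ((x | x) | (x | x)) ((y | y) | (y | y)) h <;> cases h <;> rfl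
  · rintro ((x | x) | (x | x))
    exacts [⟨.inl (.inl x), rfl⟩, ⟨.inr (.inl x), rfl⟩, ⟨.inl (.inr x), rfl⟩, ⟨.inr (.inr x), rfl⟩]

/-- The source of a cobordism appears with reversed orientation, so the manifold to use is -W, with
boundary -M ⨿ ∅. -/
theorem Cobordant.of_isOrientedBoundary {W : CompactOrientedManifoldWithBoundary.{u} n}
    (h : IsOrientedBoundary W M) : Cobordant M (.empty n) :=
  ⟨W.neg, h.neg.of_isOrientedMap (IsOrientedMap.elim_empty M.neg) (bijective_elim_pempty M.neg)⟩

theorem Cobordant.disjointUnion_comm (M N : ClosedOrientedManifold.{u} n) :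
    Cobordant (M.disjointUnion N) (N.disjointUnion M) :=
  .of_isOrientedMap (g := Sum.swap) (.elim .inr .inl) (Equiv.sumComm _ _).bijective

theorem Cobordant.disjointUnion_assoc (L M N : ClosedOrientedManifold.{u} n) :
    Cobordant ((L.disjointUnion M).disjointUnion N) (L.disjointUnion (M.disjointUnion N)) := by
  refine .of_isOrientedMap (g := Sum.elim (Sum.inl ∘ Sum.inl) (Sum.elim (Sum.inl ∘ Sum.inr) Sum.inr))
    (.elim (.comp .inl .inl) (.elim (.comp .inl .inr) .inr)) ⟨?_, ?_⟩
  · rintro (x | (x | x)) (y | (y | y)) h <;> cases h <;> rfl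
  · rintro ((x | x) | x)
    exacts [⟨.inl x, rfl⟩, ⟨.inr (.inl x), rfl⟩, ⟨.inr (.inr x), rfl⟩]

theorem Cobordant.disjointUnion_empty (M : ClosedOrientedManifold.{u} n) :
    Cobordant (M.disjointUnion (.empty n)) M :=
  (Cobordant.of_isOrientedMap (IsOrientedMap.elim_empty M) (bijective_elim_pempty M)).symm

local instance : Add (CobordismClasses.{u} n) :=
  ⟨Quot.map₂ ClosedOrientedManifold.disjointUnion
    (fun M _ _ h => (Cobordant.refl M).disjointUnion h)
    (fun _ _ M h => h.disjointUnion (Cobordant.refl M))⟩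

local instance : Zero (CobordismClasses.{u} n) := ⟨cobordismClass (.empty n)⟩

local instance : Neg (CobordismClasses.{u} n) :=
  ⟨Quot.map ClosedOrientedManifold.neg fun _ _ h => h.neg⟩

/-- The group of oriented cobordism classes. -/
abbrev cobordismGroup (n : ℕ) : AddCommGroup (CobordismClasses.{u} n) where
  nsmul := nsmulRec
  zsmul := zsmulRec
  add_assoc := by
    rintro ⟨L⟩ ⟨M⟩ ⟨N⟩
    exact Quot.sound (Cobordant.disjointUnion_assoc L M N)
  add_comm := by
    rintro ⟨M⟩ ⟨N⟩
    exact Quot.sound (Cobordant.disjointUnion_comm M N)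
  zero_add := by
    rintro ⟨M⟩
    exact Quot.sound ((Cobordant.disjointUnion_comm _ M).trans (Cobordant.disjointUnion_empty M))
  add_zero := by
    rintro ⟨M⟩
    exact Quot.sound (Cobordant.disjointUnion_empty M)
  neg_add_cancel := by
    rintro ⟨M⟩
    -- The cylinder that proves reflexivity also bounds -M ⨿ M.
    exact Quot.sound (Cobordant.of_isOrientedBoundary (isOrientedBoundary_cylinder M))

end CobordismGroup

end OrientedCobordism

end

/-! ### The main theorem. -/

theorem mainTheorem2 (n : ℕ) :
    Equivalence (fun M N : OrientedCobordism.ClosedOrientedManifold.{u} n =>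
      OrientedCobordism.Cobordant M N) ∧
    ∃ _ : AddCommGroup (OrientedCobordism.CobordismClasses.{u} n),
      (∀ M N : OrientedCobordism.ClosedOrientedManifold.{u} n,
        OrientedCobordism.cobordismClass M + OrientedCobordism.cobordismClass N =
          OrientedCobordism.cobordismClass (M.disjointUnion N)) ∧
      (∀ (W : OrientedCobordism.CompactOrientedManifoldWithBoundary.{u} n)
        (V : OrientedCobordism.ClosedOrientedManifold.{u} n),
        OrientedCobordism.IsOrientedBoundary W V → OrientedCobordism.cobordismClass V = 0) ∧
      (∀ M : OrientedCobordism.ClosedOrientedManifold.{u} n,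
        -OrientedCobordism.cobordismClass M = OrientedCobordism.cobordismClass M.neg) :=
  ⟨OrientedCobordism.equivalence_cobordant n, OrientedCobordism.cobordismGroup n,
    fun _ _ => rfl,
    fun _ _ h => Quot.sound (OrientedCobordism.Cobordant.of_isOrientedBoundary h),
    fun _ => rfl⟩
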